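/- Let $R\subset\mathbb R^n$ be a reduced irreducible (crystallographic) root system with fixed simple roots, $W$ its Weyl group, $P=\{b:(b,\alpha^\vee)\in\mathbb Z\ \forall\alpha\in R\}$ the weight lattice, $(\cdot,\cdot)$ the $W$-invariant form with $(\alpha,\alpha)=2$ for short roots, $\rho$ the sum of the fundamental weights, $\vartheta$ the highest coroot, $h=1+(\rho,\vartheta)$ the Coxeter number, $N=1+h$, and $m$ the least positive integer with $m(P,P)\subset\mathbb Z$. Let $q$ be a primitive $N$-th root of unity, $K=\mathbb Q_q=\mathbb Q(q)$ the $N$-th cyclotomic field, and let $q^{1/m}$ be chosen among the $N$-th roots of unity in $K$; this defines $q^{(a,b)}$ for $a,b\in P$. Let $HH^\bullet$ be the $K$-algebra generated by pairwise commuting $X_a$, pairwise commuting $Y_b$ ($a,b\in P$; $X_{a+a'}=X_aX_{a'}$, $Y_{b+b'}=Y_bY_{b'}$, $X_0=Y_0=1$) and the group $W$, with relations $wX_aw^{-1}=X_{w(a)}$, $wY_bw^{-1}=Y_{w(b)}$, $X_aY_bX_a^{-1}Y_b^{-1}=q^{-(a,b)}$. It acts on $K[X]=\bigoplus_{a\in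 P}KX_a$, where $X_b$ acts by multiplication, $Y_b(X_a)=q^{(a,b)}X_a$, $w(X_a)=X_{w(a)}$. Let $HH^\bullet_N$ be the quotient of $HH^\bullet$ by the relations $X_a^N=1=Y_a^N$ ($a\in P$), let $\mathcal W_N\subset HH^\bullet_N$ be the subalgebra generated by all $X_a,Y_b$ (the Weyl algebra modulo $X^N=1=Y^N$), and let $V^\bullet=K[X]/(X_a^N=1,\ a\in P)$, which is an $HH^\bullet_N$-module. Let $\Delta^\bullet=\prod_{\alpha>0}(X_\alpha^{1/2}-X_\alpha^{-1/2})=X_\rho\prod_{\alpha>0}(1-X_{-\alpha})\in K[X]$, and let $\mathcal I_o^\bullet$ be the set of all $H\in HH^\bullet$ that commute with $W$ and satisfy $H(\Delta^\bullet)=0$ in $V^\bullet$. Then: (i) $V^\bullet$ is an irreducible $HH^\bullet_N$-module with $\dim_K V^\bullet=N^n$. It is irreducible over $\mathcal W_N$, and every irreducible $\mathcal W_N$-module is isomorphic to it. It is the only irreducible quotient of the $HH^\bullet$-module $K[X]$ in which $X_a^N=1=Y_a^N$ for all $a\in P$. Every irreducible $HH^\bullet_N$-module is isomorphic to $V^\bullet\otimes_K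 U$ for some irreducible finite-dimensional $K[W]$-module $U$, where $X_a,Y_b$ act on the first factor and $W$ acts diagonally. (ii) $V^\bullet\cong K[P/NP]$ as a $W$-module. The sign character of $W$ has multiplicity one in $V^\bullet$, and its isotypic component is spanned by the image of $\Delta^\bullet$. The $W$-orbit of $\rho$ in $P/NP$ is simple (trivial stabilizer) and is the only simple $W$-orbit in $P/NP$. (iii) The quotient $\tilde V^\bullet$ of $K[X]$ by the $HH^\bullet$-submodule $HH^\bullet\,\mathcal I_o^\bullet(\Delta^\bullet)$ is an $HH^\bullet_N$-module and coincides with $V^\bullet$, i.e. $HH^\bullet\,\mathcal I_o^\bullet(\Delta^\bullet)$ is the kernel of $K[X]\to V^\bullet$. -/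

import Mathlib

set_option linter.unusedSectionVars false

noncomputable section

namespace Daha

variable {κ E E' : Type*} [Fintype κ] [AddCommGroup E] [Module ℝ E] [AddCommGroup E'] [Module ℝ E']
variable (R : RootPairing κ ℝ E E')

/-! ### The weight lattice, the normalized form, `ρ`, and the Coxeter number -/

/-- The weight lattice `P`: all vectors whose pairing with every coroot is an integer. -/
def weightLattice : AddSubgroup E where
  carrier := {x | ∀ i, ∃ z : ℤ, R.toLinearMap x (R.coroot i) = z}
  zero_mem' := fun _ => ⟨0, by simp⟩
  add_mem' := by
    intro x y hx hy i
    obtain ⟨m, hm⟩ := hx i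
    obtain ⟨n, hn⟩ := hy i
    exact ⟨m + n, by simp [hm, hn]⟩
  neg_mem' := by
    intro x hx i
    obtain ⟨m, hm⟩ := hx i
    exact ⟨-m, by simp [hm]⟩

variable {R} in
theorem weyl_smul_mem (w : R.weylGroup) {x : E} (hx : x ∈ weightLattice R) :
    w • x ∈ weightLattice R := by
  obtain ⟨g, hg⟩ := w
  revert x
  induction hg using RootPairing.weylGroup.induction with
  | mem j =>
    intro x hx i
    obtain ⟨z, hz⟩ := hx (R.reflectionPerm j i)
    refine ⟨z, ?_⟩
    rw [← hz]
    change R.toLinearMap (R.reflection j x) (R.coroot i) = _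
    have := R.coroot'_reflection (i := j) (j := i) (y := x)
    simpa using this
  | one => intro x hx; exact hx
  | mul g₁ g₂ hg₁ hg₂ h₁ h₂ =>
    intro x hx
    exact h₁ (h₂ hx)

/-- The action of the Weyl group `W` on the weight lattice. -/
instance : DistribMulAction R.weylGroup (weightLattice R) where
  smul w x := ⟨w • (x : E), weyl_smul_mem w x.2⟩
  one_smul x := Subtype.ext (one_smul R.weylGroup (x : E))
  mul_smul w v x := Subtype.ext (mul_smul w v (x : E))
  smul_zero w := Subtype.ext (smul_zero w)
  smul_add w x y := Subtype.ext (smul_add w (x : E) (y : E))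

theorem coe_weyl_smul (w : R.weylGroup) (x : weightLattice R) :
    ((w • x : weightLattice R) : E) = w • (x : E) := rfl

/-- The squared length of a short root with respect to the canonical invariant form. -/
def shortSq : ℝ := ⨅ i, R.RootForm (R.root i) (R.root i)

/-- The `W`-invariant form `(x, y)`, normalized by `(α, α) = 2` for the short roots `α`. -/
def normForm (x y : E) : ℝ := 2 / shortSq R * R.RootForm x y

/-- The least natural number `m > 0` such that `m (a, b) ∈ ℤ` for all weights `a, b`. -/
def formDenom : ℕ :=
  sInf {k : ℕ | 0 < k ∧ ∀ a b : weightLattice R, ∃ z : ℤ, (k : ℝ) * normForm R a b = z}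

theorem rootForm_int (a b : weightLattice R) : ∃ z : ℤ, R.RootForm (a : E) (b : E) = z := by
  choose f hf using a.2
  choose g hg using b.2
  refine ⟨∑ i, f i * g i, ?_⟩
  rw [RootPairing.rootForm_apply_apply]
  push_cast
  refine Finset.sum_congr rfl fun i _ => ?_
  rw [← hf, ← hg]
  simp

theorem root_mem [R.IsCrystallographic] (i : κ) : R.root i ∈ weightLattice R := by
  intro j
  refine ⟨R.pairingIn ℤ i j, ?_⟩
  rw [RootPairing.root_coroot_eq_pairing, ← R.algebraMap_pairingIn ℤ i j]
  simp

/-- A root, viewed as an element of the weight lattice. -/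
def rootWt [R.IsCrystallographic] (i : κ) : weightLattice R := ⟨R.root i, root_mem R i⟩

theorem formDenom_spec [R.IsCrystallographic] :
    0 < formDenom R ∧ ∀ a b : weightLattice R, ∃ z : ℤ, (formDenom R : ℝ) * normForm R a b = z := by
  suffices h : {k : ℕ | 0 < k ∧
      ∀ a b : weightLattice R, ∃ z : ℤ, (k : ℝ) * normForm R a b = z}.Nonempty from Nat.sInf_mem h
  rcases isEmpty_or_nonempty κ with hκ | hκ
  · exact ⟨1, one_pos, fun a b => ⟨0, by simp [normForm, shortSq]⟩⟩
  · obtain ⟨i, hi⟩ := exists_eq_ciInf_of_finite (f := fun i => R.RootForm (R.root i) (R.root i))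
    obtain ⟨s, hs⟩ := rootForm_int R (rootWt R i) (rootWt R i)
    have hss : shortSq R = s := by rw [shortSq, ← hi, ← hs]; rfl
    have hpos : 0 < shortSq R := by
      rw [shortSq, ← hi]
      simp only [RootPairing.rootForm_root_self]
      refine Finset.sum_pos' (fun j _ => mul_self_nonneg _) ⟨i, Finset.mem_univ _, ?_⟩
      simp
    have hs0 : 0 < s := by rw [hss] at hpos; exact_mod_cast hpos
    obtain ⟨k, rfl⟩ := Int.eq_ofNat_of_zero_le hs0.le
    refine ⟨k, by exact_mod_cast hs0, fun a b => ?_⟩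
    obtain ⟨z, hz⟩ := rootForm_int R a b
    refine ⟨2 * z, ?_⟩
    have hk : (k : ℝ) = shortSq R := by rw [hss]; simp
    rw [normForm, hz, hk]
    field_simp
    push_cast
    ring

/-- The integer `m (a, b)` for weights `a, b`, where `m = formDenom R`. -/
def scaledForm (a b : weightLattice R) : ℤ := ⌊(formDenom R : ℝ) * normForm R a b⌋

theorem scaledForm_cast [R.IsCrystallographic] (a b : weightLattice R) :
    (scaledForm R a b : ℝ) = (formDenom R : ℝ) * normForm R a b := by
  obtain ⟨z, hz⟩ := (formDenom_spec R).2 a b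
  rw [scaledForm, hz, Int.floor_intCast]

theorem scaledForm_add_left [R.IsCrystallographic] (a a' b : weightLattice R) :
    scaledForm R (a + a') b = scaledForm R a b + scaledForm R a' b := by
  have h : (scaledForm R (a + a') b : ℝ) = scaledForm R a b + scaledForm R a' b := by
    simp only [scaledForm_cast, normForm, AddSubgroup.coe_add, map_add, LinearMap.add_apply]
    ring
  exact_mod_cast h

theorem scaledForm_add_right [R.IsCrystallographic] (a b b' : weightLattice R) :
    scaledForm R a (b + b') = scaledForm R a b + scaledForm R a b' := by
  have h : (scaledForm R a (b + b') : ℝ) = scaledForm R a b + scaledForm R a b' := by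
    simp only [scaledForm_cast, normForm, AddSubgroup.coe_add, map_add]
    ring
  exact_mod_cast h

theorem scaledForm_zero_left (b : weightLattice R) : scaledForm R 0 b = 0 := by
  simp [scaledForm, normForm]

theorem scaledForm_zero_right (a : weightLattice R) : scaledForm R a 0 = 0 := by
  simp [scaledForm, normForm]

theorem rootForm_weyl (w : R.weylGroup) (x y : E) :
    R.RootForm (w • x) (w • y) = R.RootForm x y := by
  revert x y
  obtain ⟨g, hg⟩ := w
  induction hg using RootPairing.weylGroup.induction with
  | mem i => intro x y; exact R.rootForm_reflection_reflection_apply i x y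
  | one => intro x y; rfl
  | mul g₁ g₂ hg₁ hg₂ h₁ h₂ => intro x y; exact (h₁ _ _).trans (h₂ x y)

theorem scaledForm_weyl (w : R.weylGroup) (a b : weightLattice R) :
    scaledForm R (w • a) (w • b) = scaledForm R a b := by
  simp only [scaledForm, normForm, coe_weyl_smul, rootForm_weyl]

variable {R}

/-- The fundamental weights: `(ω_i, α_j^∨) = δ_ij` for the simple coroots `α_j^∨`. -/
def fundamentalWeight [R.IsRootSystem] (b : R.Base) (i : b.support) : E :=
  R.toPerfPair.symm (b.toCoweightBasis.coord i)

theorem fundamentalWeight_coroot [R.IsRootSystem] (b : R.Base) (i : b.support) (y : E') :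
    R.toLinearMap (fundamentalWeight b i) y = b.toCoweightBasis.coord i y := by
  change R.toPerfPair (fundamentalWeight b i) y = _
  rw [fundamentalWeight, LinearEquiv.apply_symm_apply]

theorem fundamentalWeight_mem [R.IsRootSystem] (b : R.Base) (i : b.support) :
    fundamentalWeight b i ∈ weightLattice R := by
  intro j
  rw [fundamentalWeight_coroot]
  have hj := b.coroot_mem_span_int j
  generalize R.coroot j = y at hj ⊢
  induction hj using Submodule.span_induction with
  | mem x hx =>
    obtain ⟨k, hk, rfl⟩ := hx
    have := b.toCoweightBasis_repr_coroot ⟨k, hk⟩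
    simp only [Module.Basis.coord_apply, this]
    by_cases h : (⟨k, hk⟩ : b.support) = i
    · subst h
      exact ⟨1, by simp⟩
    · exact ⟨0, by simp [Finsupp.single_eq_of_ne' h]⟩
  | zero => exact ⟨0, by simp⟩
  | add x y _ _ hx hy =>
    obtain ⟨m, hm⟩ := hx
    obtain ⟨n, hn⟩ := hy
    exact ⟨m + n, by rw [map_add, hm, hn]; push_cast; rfl⟩
  | smul c x _ hx =>
    obtain ⟨m, hm⟩ := hx
    exact ⟨c * m, by rw [map_zsmul, hm]; simp⟩

/-- `ρ = ∑ ω_i`, the sum of the fundamental weights. -/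
def rho [R.IsRootSystem] (b : R.Base) : weightLattice R :=
  ∑ i : b.support, ⟨fundamentalWeight b i, fundamentalWeight_mem b i⟩

/-- The Coxeter number `h = 1 + (ρ, ϑ)` for the highest coroot `ϑ`; the coroot `ϑ` is the one
with the greatest value of `(ρ, α^∨)`. -/
def coxeterNumber [R.IsRootSystem] (b : R.Base) : ℕ :=
  1 + Finset.univ.sup fun i => ⌊R.toLinearMap (rho b : E) (R.coroot i)⌋₊

/-- The sublattice `N P` of the weight lattice. -/
def multiples (R : RootPairing κ ℝ E E') (N : ℕ) : AddSubgroup (weightLattice R) :=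
  (nsmulAddMonoidHom (α := weightLattice R) N).range

/-- The finite group `P / N P`. -/
abbrev WeightQuot (R : RootPairing κ ℝ E E') (N : ℕ) : Type _ := weightLattice R ⧸ multiples R N

/-- The action of the Weyl group on `P / N P`. -/
instance (N : ℕ) : DistribMulAction R.weylGroup (WeightQuot R N) where
  smul w := QuotientAddGroup.map (multiples R N) (multiples R N)
    (DistribSMul.toAddMonoidHom (weightLattice R) w) (by
      rintro _ ⟨x, rfl⟩
      exact ⟨w • x, by simp [smul_comm w N x]⟩)
  one_smul := by
    rintro ⟨x⟩
    exact congrArg (QuotientAddGroup.mk (s := multiples R N)) (one_smul R.weylGroup x)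
  mul_smul := by
    rintro w v ⟨x⟩
    exact congrArg (QuotientAddGroup.mk (s := multiples R N)) (mul_smul w v x)
  smul_zero w := map_zero _
  smul_add w x y := map_add _ x y

/-- The sign character `w ↦ det w = ±1` of the Weyl group, with values in a field. -/
def sgn (K : Type*) [Field K] (w : R.weylGroup) : K :=
  ((SignType.sign (LinearMap.det (R.weylGroupRootRep w)) : SignType) : K)

/-! ### The double affine Hecke algebra at `k = 0` -/

variable {K : Type*} [Field K]

/-- `q ^ (a, b)`, where `ζ` is the chosen root `q ^ (1 / m)`. -/
def qPow (ζ : Kˣ) (a b : weightLattice R) : Kˣ := ζ ^ scaledForm R a b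

/-- Symbols for the generators `X_a`, `Y_b` (`a, b ∈ P`) and `w ∈ W`. -/
inductive Gen (R : RootPairing κ ℝ E E')
  | X (a : weightLattice R)
  | Y (b : weightLattice R)
  | T (w : R.weylGroup)

/-- The defining relations of the semidirect product of the Weyl algebra and `K[W]`. -/
inductive Rel (R : RootPairing κ ℝ E E') (ζ : Kˣ) :
    FreeAlgebra K (Gen R) → FreeAlgebra K (Gen R) → Prop
  | X_zero : Rel R ζ (FreeAlgebra.ι K (.X 0)) 1
  | X_add (a b) : Rel R ζ (FreeAlgebra.ι K (.X (a + b))) (FreeAlgebra.ι K (.X a) * FreeAlgebra.ι K (.X b))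
  | Y_zero : Rel R ζ (FreeAlgebra.ι K (.Y 0)) 1
  | Y_add (a b) : Rel R ζ (FreeAlgebra.ι K (.Y (a + b))) (FreeAlgebra.ι K (.Y a) * FreeAlgebra.ι K (.Y b))
  | T_one : Rel R ζ (FreeAlgebra.ι K (.T 1)) 1
  | T_mul (w v) : Rel R ζ (FreeAlgebra.ι K (.T (w * v))) (FreeAlgebra.ι K (.T w) * FreeAlgebra.ι K (.T v))
  | T_X (w a) : Rel R ζ (FreeAlgebra.ι K (.T w) * FreeAlgebra.ι K (.X a)) (FreeAlgebra.ι K (.X (w • a)) * FreeAlgebra.ι K (.T w))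
  | T_Y (w b) : Rel R ζ (FreeAlgebra.ι K (.T w) * FreeAlgebra.ι K (.Y b)) (FreeAlgebra.ι K (.Y (w • b)) * FreeAlgebra.ι K (.T w))
  | X_Y (a b) : Rel R ζ (FreeAlgebra.ι K (.X a) * FreeAlgebra.ι K (.Y b))
      (((qPow ζ a b)⁻¹ : Kˣ) • (FreeAlgebra.ι K (.Y b) * FreeAlgebra.ι K (.X a)))

/-- The algebra `HH^•`: generated by pairwise commuting `X_a`, pairwise commuting `Y_b`
and the group `W`, with `w X_a w⁻¹ = X_{w a}`, `w Y_b w⁻¹ = Y_{w b}` and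
`X_a Y_b X_a⁻¹ Y_b⁻¹ = q^{-(a, b)}`. -/
def HH (R : RootPairing κ ℝ E E') (ζ : Kˣ) : Type _ := RingQuot (Rel R ζ)

instance (ζ : Kˣ) : Ring (HH R ζ) := inferInstanceAs (Ring (RingQuot (Rel R ζ)))

instance (ζ : Kˣ) : Algebra K (HH R ζ) := inferInstanceAs (Algebra K (RingQuot (Rel R ζ)))

/-- The generator `X_a`. -/
def X (ζ : Kˣ) (a : weightLattice R) : HH R ζ :=
  RingQuot.mkAlgHom K (Rel R ζ) (FreeAlgebra.ι K (.X a))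

/-- The generator `Y_b`. -/
def Y (ζ : Kˣ) (b : weightLattice R) : HH R ζ :=
  RingQuot.mkAlgHom K (Rel R ζ) (FreeAlgebra.ι K (.Y b))

/-- The element `w ∈ W`. -/
def T (ζ : Kˣ) (w : R.weylGroup) : HH R ζ :=
  RingQuot.mkAlgHom K (Rel R ζ) (FreeAlgebra.ι K (.T w))

/-! ### The polynomial representation -/

/-- The Laurent polynomials `K[X]`, with basis the monomials `X_a = single a 1`, `a ∈ P`. -/
abbrev Poly (K : Type*) [Field K] (R : RootPairing κ ℝ E E') : Type _ :=
  AddMonoidAlgebra K (weightLattice R)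

/-- `X_a` acts by multiplication. -/
def opX (a : weightLattice R) : Module.End K (Poly K R) :=
  LinearMap.mulLeft K (AddMonoidAlgebra.single a 1)

/-- `Y_b` acts by `X_a ↦ q^{(a, b)} X_a`. -/
def opY [R.IsCrystallographic] (ζ : Kˣ) (b : weightLattice R) : Module.End K (Poly K R) :=
  (AddMonoidAlgebra.lift K (Poly K R) (weightLattice R)
    { toFun := fun a => AddMonoidAlgebra.single a.toAdd (qPow ζ a.toAdd b : K)
      map_one' := by
        simp [qPow, scaledForm_zero_left, AddMonoidAlgebra.one_def]
      map_mul' := fun a a' => by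
        simp [qPow, scaledForm_add_left, AddMonoidAlgebra.single_mul_single,
          zpow_add] }).toLinearMap

/-- `w` acts by `X_a ↦ X_{w a}`. -/
def opT (w : R.weylGroup) : Module.End K (Poly K R) :=
  AddMonoidAlgebra.mapDomainLinearMap K K (fun a => w • a)

theorem opX_single (a c : weightLattice R) (r : K) :
    opX a (AddMonoidAlgebra.single c r) = AddMonoidAlgebra.single (a + c) r := by
  simp [opX, AddMonoidAlgebra.single_mul_single]

theorem opY_single [R.IsCrystallographic] (ζ : Kˣ) (b c : weightLattice R) (r : K) :
    opY ζ b (AddMonoidAlgebra.single c r) = AddMonoidAlgebra.single c ((qPow ζ c b : K) * r) := by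
  simp [opY, mul_comm]

theorem opT_single (w : R.weylGroup) (c : weightLattice R) (r : K) :
    opT w (AddMonoidAlgebra.single c r) = AddMonoidAlgebra.single (w • c) r := by
  simp [opT]

/-- The operators of the generators on the Laurent polynomials. -/
def genOp [R.IsCrystallographic] (ζ : Kˣ) : Gen R → Module.End K (Poly K R)
  | .X a => opX a
  | .Y b => opY ζ b
  | .T w => opT w

theorem end_ext {f g : Module.End K (Poly K R)}
    (h : ∀ c r, f (AddMonoidAlgebra.single c r) = g (AddMonoidAlgebra.single c r)) : f = g := by
  refine LinearMap.ext fun x => ?_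
  induction x using AddMonoidAlgebra.induction_linear with
  | zero => simp
  | add x y hx hy => simp [hx, hy]
  | single c r => exact h c r

/-- The polynomial representation of `HH^•`. -/
def polyRep [R.IsCrystallographic] (ζ : Kˣ) : HH R ζ →ₐ[K] Module.End K (Poly K R) :=
  RingQuot.liftAlgHom K ⟨FreeAlgebra.lift K (genOp ζ), by
    intro x y h
    apply end_ext
    intro c r
    cases h with
    | X_zero => simp [genOp, opX_single]
    | X_add a b => simp [genOp, opX_single, add_assoc]
    | Y_zero => simp [genOp, opY_single, qPow, scaledForm_zero_right]
    | Y_add a b => simp [genOp, opY_single, qPow, scaledForm_add_right, zpow_add, mul_assoc]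
    | T_one => simp [genOp, opT_single]
    | T_mul w v => simp [genOp, opT_single, mul_smul]
    | T_X w a => simp [genOp, opT_single, opX_single]
    | T_Y w b => simp [genOp, opT_single, opY_single, qPow, scaledForm_weyl]
    | X_Y a b =>
      simp [genOp, opX_single, opY_single, qPow, scaledForm_add_left, zpow_add, Units.smul_def,
        mul_assoc]
      field_simp⟩

instance [R.IsCrystallographic] (ζ : Kˣ) : Module (HH R ζ) (Poly K R) :=
  Module.compHom (Poly K R) (polyRep (R := R) ζ).toRingHom

theorem smul_def [R.IsCrystallographic] (ζ : Kˣ) (H : HH R ζ) (f : Poly K R) :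
    H • f = polyRep ζ H f := rfl

instance [R.IsCrystallographic] (ζ : Kˣ) : IsScalarTower K (HH R ζ) (Poly K R) where
  smul_assoc c H f := by simp [smul_def]

theorem X_smul_single [R.IsCrystallographic] (ζ : Kˣ) (a c : weightLattice R) (r : K) :
    X ζ a • (AddMonoidAlgebra.single c r : Poly K R) = AddMonoidAlgebra.single (a + c) r := by
  rw [smul_def, polyRep, X]
  erw [RingQuot.liftAlgHom_mkAlgHom_apply]
  simp [genOp, opX_single]

theorem Y_smul_single [R.IsCrystallographic] (ζ : Kˣ) (b c : weightLattice R) (r : K) :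
    Y ζ b • (AddMonoidAlgebra.single c r : Poly K R) =
      AddMonoidAlgebra.single c ((qPow ζ c b : K) * r) := by
  rw [smul_def, polyRep, Y]
  erw [RingQuot.liftAlgHom_mkAlgHom_apply]
  simp [genOp, opY_single]

theorem T_smul_single [R.IsCrystallographic] (ζ : Kˣ) (w : R.weylGroup) (c : weightLattice R)
    (r : K) :
    T ζ w • (AddMonoidAlgebra.single c r : Poly K R) = AddMonoidAlgebra.single (w • c) r := by
  rw [smul_def, polyRep, T]
  erw [RingQuot.liftAlgHom_mkAlgHom_apply]
  simp [genOp, opT_single]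

/-! ### The quotient `HH^•_N` by `X^N = 1 = Y^N`, and `V^•` -/

/-- The two-sided ideal of `HH^•` generated by all `X_a^N - 1` and `Y_b^N - 1`. -/
def relIdeal (R : RootPairing κ ℝ E E') (ζ : Kˣ) (N : ℕ) : Ideal (HH R ζ) :=
  (TwoSidedIdeal.span
    {z : HH R ζ | ∃ a : weightLattice R, z = X ζ a ^ N - 1 ∨ z = Y ζ a ^ N - 1}).asIdeal

instance (ζ : Kˣ) (N : ℕ) : (relIdeal R ζ N).IsTwoSided := by
  unfold relIdeal; infer_instance

/-- The algebra `HH^•_N = HH^• / (X^N = 1 = Y^N)`, where `ζ = q^{1/m}` is an `N`-th root of `1`. -/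
abbrev HHN {N : ℕ} (R : RootPairing κ ℝ E E') (ζ : rootsOfUnity N K) : Type _ :=
  HH R (ζ : Kˣ) ⧸ relIdeal R (ζ : Kˣ) N

/-- The image of `X_a` in `HH^•_N`. -/
def XN {N : ℕ} (ζ : rootsOfUnity N K) (a : weightLattice R) : HHN R ζ :=
  Ideal.Quotient.mk _ (X (ζ : Kˣ) a)

/-- The image of `Y_b` in `HH^•_N`. -/
def YN {N : ℕ} (ζ : rootsOfUnity N K) (b : weightLattice R) : HHN R ζ :=
  Ideal.Quotient.mk _ (Y (ζ : Kˣ) b)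

/-- The image of `w` in `HH^•_N`. -/
def TN {N : ℕ} (ζ : rootsOfUnity N K) (w : R.weylGroup) : HHN R ζ :=
  Ideal.Quotient.mk _ (T (ζ : Kˣ) w)

/-- The Weyl algebra modulo `X^N = 1 = Y^N`: the subalgebra of `HH^•_N` generated by the `X_a`
and `Y_b`. -/
def weylAlg {N : ℕ} (R : RootPairing κ ℝ E E') (ζ : rootsOfUnity N K) : Subalgebra K (HHN R ζ) :=
  Algebra.adjoin K (Set.range (XN (R := R) ζ) ∪ Set.range (YN (R := R) ζ))

/-- The `HH^•`-submodule of `K[X]` generated by all `X_a^N - 1`, `a ∈ P`. -/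
def kerV {N : ℕ} (R : RootPairing κ ℝ E E') [R.IsCrystallographic] (ζ : rootsOfUnity N K) :
    Submodule (HH R (ζ : Kˣ)) (Poly K R) :=
  Submodule.span _ {f | ∃ a : weightLattice R, f = AddMonoidAlgebra.single a 1 ^ N - 1}

/-- `V^• = K[X] / (X^N = 1)`. -/
abbrev V {N : ℕ} (R : RootPairing κ ℝ E E') [R.IsCrystallographic] (ζ : rootsOfUnity N K) :
    Type _ := Poly K R ⧸ kerV R ζ

theorem X_pow_smul_single [R.IsCrystallographic] (ζ : Kˣ) (N : ℕ) (a c : weightLattice R) (r : K) :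
    X ζ a ^ N • (AddMonoidAlgebra.single c r : Poly K R) = AddMonoidAlgebra.single (N • a + c) r := by
  induction N with
  | zero => simp
  | succ n ih => rw [pow_succ', mul_smul, ih, X_smul_single]; congr 1; module

theorem Y_pow_smul_single [R.IsCrystallographic] (ζ : Kˣ) (N : ℕ) (b c : weightLattice R) (r : K) :
    Y ζ b ^ N • (AddMonoidAlgebra.single c r : Poly K R) =
      AddMonoidAlgebra.single c ((qPow ζ c b : K) ^ N * r) := by
  induction N with
  | zero => simp
  | succ n ih => rw [pow_succ', mul_smul, ih, Y_smul_single]; congr 1; ring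

theorem V_torsion {N : ℕ} [R.IsCrystallographic] (ζ : rootsOfUnity N K) :
    Module.IsTorsionBySet (HH R (ζ : Kˣ)) (V R ζ) (relIdeal R (ζ : Kˣ) N) := by
  have hX : ∀ (a : weightLattice R) (f : Poly K R),
      X (ζ : Kˣ) a ^ N • f - f ∈ kerV R ζ := by
    intro a f
    induction f using AddMonoidAlgebra.induction_linear with
    | zero => simp
    | add x y hx hy =>
      have := (kerV R ζ).add_mem hx hy
      rw [smul_add]
      convert this using 1
      abel
    | single c r =>
      have h1 : (AddMonoidAlgebra.single a 1 ^ N - 1 : Poly K R) ∈ kerV R ζ :=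
        Submodule.subset_span ⟨a, rfl⟩
      have h2 := (kerV R ζ).smul_mem (algebraMap K (HH R (ζ : Kˣ)) r * X (ζ : Kˣ) c) h1
      convert h2 using 1
      rw [X_pow_smul_single, mul_smul, algebraMap_smul, AddMonoidAlgebra.single_pow,
        AddMonoidAlgebra.one_def, smul_sub, X_smul_single, X_smul_single]
      simp [smul_sub, add_comm]
  have hY : ∀ (a : weightLattice R) (f : Poly K R), Y (ζ : Kˣ) a ^ N • f = f := by
    intro a f
    induction f using AddMonoidAlgebra.induction_linear with
    | zero => simp
    | add x y hx hy => rw [smul_add, hx, hy]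
    | single c r =>
      have h1 : (ζ : Kˣ) ^ N = 1 := (mem_rootsOfUnity N _).1 ζ.2
      have h2 : (qPow (ζ : Kˣ) c a : Kˣ) ^ N = 1 := by
        rw [qPow, ← zpow_natCast, zpow_comm, zpow_natCast, h1, one_zpow]
      rw [Y_pow_smul_single, ← Units.val_pow_eq_pow_val, h2]
      simp
  have key : relIdeal R (ζ : Kˣ) N ≤ Module.annihilator (HH R (ζ : Kˣ)) (V R ζ) := by
    have h : TwoSidedIdeal.span
        {z : HH R (ζ : Kˣ) | ∃ a : weightLattice R, z = X (ζ : Kˣ) a ^ N - 1 ∨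
          z = Y (ζ : Kˣ) a ^ N - 1} ≤
        (Module.annihilator (HH R (ζ : Kˣ)) (V R ζ)).toTwoSided := by
      rw [TwoSidedIdeal.span_le]
      rintro z ⟨a, rfl | rfl⟩
      all_goals
        rw [SetLike.mem_coe, Ideal.mem_toTwoSided, Module.mem_annihilator]
        intro v
        obtain ⟨f, rfl⟩ := Submodule.Quotient.mk_surjective _ v
        rw [← Submodule.Quotient.mk_smul, Submodule.Quotient.mk_eq_zero, sub_smul, one_smul]
      · exact hX a f
      · rw [hY]; simp
    intro z hz
    exact Ideal.mem_toTwoSided.1 (h hz)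
  rintro v ⟨z, hz⟩
  exact Module.mem_annihilator.1 (key hz) v

/-- `V^•` is an `HH^•_N`-module. -/
instance {N : ℕ} [R.IsCrystallographic] (ζ : rootsOfUnity N K) : Module (HHN R ζ) (V R ζ) :=
  (V_torsion ζ).module

instance {N : ℕ} [R.IsCrystallographic] (ζ : rootsOfUnity N K) :
    IsScalarTower K (HHN R ζ) (V R ζ) :=
  (V_torsion ζ).isScalarTower

/-! ### The discriminant `Δ^•`, the ideal `I_o^•` and the quotient of `K[X]` it defines -/

open Classical in
/-- `Δ^• = ∏_{α > 0} (X_α^{1/2} - X_α^{-1/2}) = X_ρ ∏_{α > 0} (1 - X_{-α})`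
(recall that `ρ` is half the sum of the positive roots). -/
def delta (K : Type*) [Field K] [R.IsRootSystem] [R.IsCrystallographic] (b : R.Base) : Poly K R :=
  AddMonoidAlgebra.single (rho b) 1 *
    ∏ i with b.IsPos i, (1 - AddMonoidAlgebra.single (-rootWt R i) 1)

/-- The subalgebra of the elements of `HH^•` that commute with `W`. -/
def invSubalg (R : RootPairing κ ℝ E E') (ζ : Kˣ) : Subalgebra K (HH R ζ) :=
  Subalgebra.centralizer K (Set.range (T (R := R) ζ))

/-- `I_o^•`: the `W`-invariant elements `H` of `HH^•` such that `H(Δ^•) = 0` in `V^•`. -/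
def idealIo {N : ℕ} [R.IsRootSystem] [R.IsCrystallographic] (ζ : rootsOfUnity N K) (b : R.Base) :
    Set (HH R (ζ : Kˣ)) :=
  {H | H ∈ invSubalg R (ζ : Kˣ) ∧ H • (Submodule.Quotient.mk (delta K b) : V R ζ) = 0}

/-- The `HH^•`-submodule `HH^• I_o^•(Δ^•)` of `K[X]`. -/
def kerVtilde {N : ℕ} [R.IsRootSystem] [R.IsCrystallographic] (ζ : rootsOfUnity N K)
    (b : R.Base) : Submodule (HH R (ζ : Kˣ)) (Poly K R) :=
  Submodule.span _ ((fun H => H • delta K b) '' idealIo ζ b)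

/-- The space of all `v ∈ V^•` with `w v = sgn(w) v` for all `w ∈ W`. -/
def signPart {N : ℕ} [R.IsCrystallographic] (ζ : rootsOfUnity N K) : Submodule K (V R ζ) where
  carrier := {v | ∀ w : R.weylGroup, TN ζ w • v = sgn K w • v}
  zero_mem' := fun w => by simp
  add_mem' := fun hx hy w => by rw [smul_add, smul_add, hx w, hy w]
  smul_mem' := fun c x hx w => by rw [smul_comm, hx w, smul_comm]

end Daha

end

open Daha
open scoped TensorProduct

set_option linter.unusedSectionVars false

noncomputable section

namespace Daha

section

variable {κ E E' : Type*} [Fintype κ] [AddCommGroup E] [Module ℝ E] [AddCommGroup E'] [Module ℝ E']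
variable {R : RootPairing κ ℝ E E'}

/-! ### Integral pairings of weights with coroots -/

/-! Write N = 2 + (ρ, ϑ). The theorem rests on an arithmetic fact about N, a Stone–von Neumann
argument, a count of regular orbits, and a projection trick.

Arithmetic. Since q = ζ^m is primitive of order N and ζ^N = 1, the root ζ has order N and m is prime
to N. For a simple root α, m(a, α) = mν(a, α^∨), where ν ∈ {1, 2, 3} is the squared length of α
relative to a short root. Computing 2(ρ, ϑ) as the sum of the positive pairings (α, ϑ) shows that N
is odd when ν = 2 occurs and prime to 3 when ν = 3 occurs. Hence q^{(a, c)} is a nondegenerate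
pairing on P/NP (`isNondeg_of_isPrimitiveRoot`).

Stone–von Neumann. By nondegeneracy the characters of the Y's separate the classes of P/NP, so
averaging the Y's against a character gives a projector onto each weight space (`eigenproj`), and
X_c moves weight 0 to weight c. Every module over the Weyl algebra is therefore V ⊗ (vectors fixed
by all Y) (`IsWeylPair.bijective_lift`). In V the fixed vectors form the line through 1, and 1
generates V, so V is simple. In a simple module over `HHN`, W acts on the fixed vectors, and
irreducibly (`eq_fixedY_of_stable`); this gives the factor U.

Regular orbits. A class in P/NP with trivial stabilizer lies on no wall, i.e. N divides no (x, α^∨).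
In its orbit under W ⋉ NP the point y closest to ρ satisfies (y, α_k^∨) ≥ 1 for simple α_k and (y,
ϑ) ≤ N - 1 = (ρ, ϑ) + 1. So y is ρ, or ρ + ω_r with ω_r minuscule, and in the second case y - Nω_r
is W-conjugate to ρ, by a symmetry of the extended Dynkin diagram (`IsHighest.exists_eq_smul_rho`).
Conversely wρ ≡ ρ mod N forces w = 1. An antisymmetric vector of K[P/NP] vanishes at classes fixed
by a reflection, so it is determined by its coefficient at ρ. That coefficient is 1 for Δ, by the
denominator formula Δ = ∑ sgn(w) X_{wρ} (`delta_eq_sum`).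

Projection. Let P be the projector onto the class of ρ. The points wρ are distinct mod N, so P(Δ) =
X_ρ, and (X_{Na} - 1)P sends Δ to g = X_{ρ+Na} - X_ρ. Summing the W-conjugates of this operator
gives an element of I_o. Applying P to its value on Δ recovers g, and X_{-ρ} g = X_a^N - 1 is a
generator of the kernel (`IsHighest.kerVtilde_eq`). -/

/-- The integer `(x, α_i^∨)` for a weight `x`. -/
def wp (i : κ) : weightLattice R →+ ℤ where
  toFun x := (x.2 i).choose
  map_zero' := by
    have h := (((0 : weightLattice R)).2 i).choose_spec
    have : ((((0 : weightLattice R)).2 i).choose : ℝ) = 0 := by rw [← h]; simp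
    exact_mod_cast this
  map_add' x y := by
    have h := ((x + y).2 i).choose_spec
    have hx := (x.2 i).choose_spec
    have hy := (y.2 i).choose_spec
    have : (((x + y).2 i).choose : ℝ) = (x.2 i).choose + (y.2 i).choose := by
      rw [← h, ← hx, ← hy]; simp
    exact_mod_cast this

theorem wp_cast (i : κ) (x : weightLattice R) :
    (wp i x : ℝ) = R.toLinearMap (x : E) (R.coroot i) := ((x.2 i).choose_spec).symm

theorem wp_eq_iff {i : κ} {x : weightLattice R} {z : ℤ} :
    wp i x = z ↔ R.toLinearMap (x : E) (R.coroot i) = z := by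
  rw [← wp_cast]; norm_cast

theorem wp_rootWt [R.IsCrystallographic] (i j : κ) :
    wp i (rootWt R j) = R.pairingIn ℤ j i := by
  rw [wp_eq_iff]
  change R.toLinearMap (R.root j) (R.coroot i) = _
  rw [RootPairing.root_coroot_eq_pairing, ← R.algebraMap_pairingIn ℤ]
  simp

theorem rootWt_injective [R.IsCrystallographic] : Function.Injective (rootWt R) := fun i j h => by
  simpa [rootWt] using h

/-- The reflection in the root `α_i`. -/
abbrev refl (R : RootPairing κ ℝ E E') (i : κ) : R.weylGroup := RootPairing.weylGroup.ofIdx R i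

theorem refl_smul [R.IsCrystallographic] (i : κ) (x : weightLattice R) :
    refl R i • x = x - wp i x • rootWt R i := by
  ext
  rw [coe_weyl_smul]
  simp only [RootPairing.weylGroup.ofIdx_smul, RootPairing.Equiv.reflection_smul,
    RootPairing.reflection_apply, AddSubgroup.coe_sub, AddSubgroup.coe_zsmul, rootWt]
  rw [← Int.cast_smul_eq_zsmul ℝ, wp_cast]
  rfl

theorem rootWt_smul [R.IsCrystallographic] (w : R.weylGroup) (i : κ) :
    rootWt R (w • i) = w • rootWt R i := by
  ext
  exact RootPairing.Equiv.root_indexEquiv_eq_smul (P := R) i w.1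

theorem refl_smul_idx (i j : κ) : refl R i • j = R.reflectionPerm i j := rfl

theorem wp_smul (w : R.weylGroup) (i : κ) (x : weightLattice R) :
    wp (w • i) (w • x) = wp i x := by
  rw [wp_eq_iff, wp_cast]
  obtain ⟨x, hx⟩ := x
  change R.toLinearMap (w • x) (R.coroot (w • i)) = R.toLinearMap x (R.coroot i)
  clear hx
  revert i x
  obtain ⟨g, hg⟩ := w
  induction hg using RootPairing.weylGroup.induction with
  | mem j =>
    intro i x
    have := R.coroot'_reflection (i := j) (j := R.reflectionPerm j i) (y := x)
    rw [RootPairing.reflectionPerm_self] at this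
    exact this
  | one => intro i x; rfl
  | mul g₁ g₂ hg₁ hg₂ h₁ h₂ =>
    intro i x
    exact (h₁ _ _).trans (h₂ i x)

theorem wp_inv_smul (w : R.weylGroup) (i : κ) (x : weightLattice R) :
    wp i (w • x) = wp (w⁻¹ • i) x := by
  rw [← wp_smul w (w⁻¹ • i) x, smul_inv_smul]

theorem wp_refl_self (i : κ) (x : weightLattice R) :
    wp (R.reflectionPerm i i) x = - wp i x := by
  rw [wp_eq_iff]
  push_cast
  rw [wp_cast]
  simp

/-- This is invariance of the form under the reflection in α_i, applied to the pair x, α_i. -/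
theorem rootForm_root (i : κ) (x : E) :
    2 * R.RootForm x (R.root i) =
      R.toLinearMap x (R.coroot i) * R.RootForm (R.root i) (R.root i) := by
  have h := R.rootForm_reflection_reflection_apply i x (R.root i)
  rw [RootPairing.reflection_apply_self, RootPairing.reflection_apply] at h
  simp only [map_sub, map_neg, map_smul, LinearMap.sub_apply, LinearMap.smul_apply,
    smul_eq_mul] at h
  have h2 : (R.coroot' i) x = R.toLinearMap x (R.coroot i) := rfl
  rw [h2] at h
  linarith

theorem rootForm_root_pos [R.IsCrystallographic] (i : κ) :
    0 < R.RootForm (R.root i) (R.root i) := by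
  rw [RootPairing.rootForm_root_self]
  refine Finset.sum_pos' (fun j _ => mul_self_nonneg _) ⟨i, Finset.mem_univ _, ?_⟩
  simp

/-! ### Faithfulness of W on the roots, and conjugation of reflections -/

instance finite_weylGroup [R.IsRootSystem] : Finite R.weylGroup := by
  refine Finite.of_injective (fun w : R.weylGroup => fun i : κ => w • i) ?_
  intro w v h
  apply Subtype.ext
  apply RootPairing.Equiv.weightHom_injective R
  apply LinearEquiv.toLinearMap_injective
  have hs : Submodule.span ℝ (Set.range R.root) = ⊤ := RootPairing.IsRootSystem.span_root_eq_top
  refine LinearMap.ext_on_range hs fun i => ?_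
  have h1 := congrFun h i
  change w.1 • R.root i = v.1 • R.root i
  rw [← RootPairing.Equiv.root_indexEquiv_eq_smul, ← RootPairing.Equiv.root_indexEquiv_eq_smul]
  exact congrArg R.root h1

theorem weyl_ext [R.IsRootSystem] {w v : R.weylGroup} (h : ∀ i : κ, w • i = v • i) : w = v := by
  apply Subtype.ext
  apply RootPairing.Equiv.weightHom_injective R
  apply LinearEquiv.toLinearMap_injective
  have hs : Submodule.span ℝ (Set.range R.root) = ⊤ := RootPairing.IsRootSystem.span_root_eq_top
  refine LinearMap.ext_on_range hs fun i => ?_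
  change w.1 • R.root i = v.1 • R.root i
  rw [← RootPairing.Equiv.root_indexEquiv_eq_smul, ← RootPairing.Equiv.root_indexEquiv_eq_smul]
  exact congrArg R.root (h i)

theorem refl_mul_self [R.IsRootSystem] (i : κ) : refl R i * refl R i = 1 :=
  weyl_ext fun j => by
    rw [mul_smul, one_smul, refl_smul_idx, refl_smul_idx, RootPairing.reflectionPerm_self]

theorem refl_inv [R.IsRootSystem] (i : κ) : (refl R i)⁻¹ = refl R i :=
  inv_eq_of_mul_eq_one_left (refl_mul_self i)

theorem refl_conj [R.IsRootSystem] [R.IsCrystallographic] (w : R.weylGroup) (i : κ) :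
    w * refl R i * w⁻¹ = refl R (w • i) := by
  refine weyl_ext fun j => rootWt_injective (R := R) ?_
  rw [mul_smul, mul_smul, rootWt_smul, rootWt_smul, rootWt_smul, rootWt_smul, refl_smul, refl_smul,
    smul_sub, rootWt_smul, smul_inv_smul, wp_inv_smul, inv_inv]
  congr 1
  exact ((DistribSMul.toAddMonoidHom (weightLattice R) w).map_zsmul _ _)

/-! ### Simple roots and fundamental weights -/

variable [R.IsRootSystem] (b : R.Base)

/-- The fundamental weights as elements of the weight lattice. -/
def fw (k : b.support) : weightLattice R := ⟨fundamentalWeight b k, fundamentalWeight_mem b k⟩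

theorem wp_fw_self (k : b.support) : wp (k : κ) (fw b k) = 1 := by
  rw [wp_eq_iff]
  change R.toLinearMap (fundamentalWeight b k) _ = _
  rw [fundamentalWeight_coroot]
  simp

theorem wp_fw_ne {j k : b.support} (h : j ≠ k) : wp (j : κ) (fw b k) = 0 := by
  rw [wp_eq_iff]
  change R.toLinearMap (fundamentalWeight b k) _ = _
  rw [fundamentalWeight_coroot]
  simp [Finsupp.single_eq_of_ne' h]

theorem wp_ext {x y : weightLattice R} (h : ∀ k : b.support, wp (k : κ) x = wp (k : κ) y) :
    x = y := by
  ext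
  apply R.toPerfPair.injective
  refine b.toCoweightBasis.ext fun k => ?_
  rw [RootPairing.Base.toCoweightBasis_apply]
  change R.toLinearMap (x : E) _ = R.toLinearMap (y : E) _
  rw [← wp_cast, ← wp_cast, h]

theorem wp_sum_fw (f : b.support → ℤ) (j : b.support) :
    wp (j : κ) (∑ k, f k • fw b k) = f j := by
  rw [map_sum, Finset.sum_eq_single j]
  · simp [wp_fw_self]
  · intro k _ hk
    simp [wp_fw_ne b hk.symm]
  · simp

theorem eq_sum_fw (x : weightLattice R) : x = ∑ k : b.support, wp (k : κ) x • fw b k :=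
  wp_ext b fun j => (wp_sum_fw b (fun k => wp (k : κ) x) j).symm

/-- The number `wp i (fw b k)` is the coefficient of the simple coroot α_k^∨ in α_i^∨, so this is
the expansion of α_i^∨ in simple coroots. Likewise `wp i (rho b)` is the height of α_i^∨. All later
comparisons of coroots are made through these integers. -/
theorem wp_eq_sum (i : κ) (x : weightLattice R) :
    wp i x = ∑ k : b.support, wp (k : κ) x * wp i (fw b k) := by
  conv_lhs => rw [eq_sum_fw b x]
  simp [map_sum]

theorem rho_eq : rho b = ∑ k : b.support, fw b k := rfl

theorem wp_rho (i : κ) : wp i (rho b) = ∑ k : b.support, wp i (fw b k) := by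
  rw [rho_eq, map_sum]

theorem wp_rho_simple (k : b.support) : wp (k : κ) (rho b) = 1 := by
  rw [wp_rho, Finset.sum_eq_single k]
  · exact wp_fw_self b k
  · intro j _ hj
    exact wp_fw_ne b hj.symm
  · simp

theorem wp_neg_coroot {i j : κ} (h : R.coroot j = - R.coroot i) (x : weightLattice R) :
    wp j x = - wp i x := by
  rw [wp_eq_iff, h]
  push_cast
  rw [wp_cast]
  simp

theorem wp_fw_sign (i : κ) :
    (∀ k, 0 ≤ wp i (fw b k)) ∨ (∀ k, wp i (fw b k) ≤ 0) := by
  have key : ∀ y ∈ AddSubmonoid.closure (R.coroot '' b.support), ∀ k : b.support,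
      0 ≤ R.toLinearMap (fw b k : E) y := by
    intro y hy k
    induction hy using AddSubmonoid.closure_induction with
    | mem y hy =>
      obtain ⟨j, hj, rfl⟩ := hy
      rw [← wp_cast]
      rcases eq_or_ne (⟨j, hj⟩ : b.support) k with rfl | h
      · have := wp_fw_self b ⟨j, hj⟩
        simp only at this
        rw [this]; simp
      · have := wp_fw_ne b h
        simp only at this
        rw [this]; simp
    | zero => simp
    | add y z _ _ hy hz => rw [map_add]; positivity
  rcases b.coroot_mem_or_neg_mem i with h | h
  · left
    intro k
    have := key _ h k
    rw [← wp_cast] at this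
    exact_mod_cast this
  · right
    intro k
    have := key _ h k
    rw [map_neg, ← wp_cast] at this
    have h2 : (wp i (fw b k) : ℝ) ≤ 0 := by linarith
    exact_mod_cast h2

/-- The coefficients of a coroot have one sign, so height zero makes all of them vanish. The coroot
would then pair to zero with everything, whereas (α, α^∨) = 2. -/
theorem wp_rho_ne_zero (i : κ) : wp i (rho b) ≠ 0 := by
  intro h
  rw [wp_rho] at h
  have h0 : ∀ k, wp i (fw b k) = 0 := by
    rcases wp_fw_sign b i with hs | hs
    · intro k
      exact (Finset.sum_eq_zero_iff_of_nonneg fun k _ => hs k).1 h k (Finset.mem_univ _)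
    · intro k
      exact (Finset.sum_eq_zero_iff_of_nonpos fun k _ => hs k).1 h k (Finset.mem_univ _)
  have h1 : R.toLinearMap (R.root i) (R.coroot i) = 0 := by
    classical
    obtain ⟨f, hf⟩ := (Submodule.mem_span_range_iff_exists_fun ℝ).1
      (show R.toPerfPair (R.root i) ∈ Submodule.span ℝ (Set.range b.toCoweightBasis.coord) by
        rw [← Module.Basis.coe_dualBasis, Module.Basis.span_eq]; trivial)
    have : R.toLinearMap (R.root i) (R.coroot i) =
        ∑ k, f k * R.toLinearMap (fw b k : E) (R.coroot i) := by
      change R.toPerfPair (R.root i) (R.coroot i) = _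
      rw [← hf, LinearMap.sum_apply]
      refine Finset.sum_congr rfl fun k _ => ?_
      rw [LinearMap.smul_apply, smul_eq_mul, ← fundamentalWeight_coroot]
      rfl
    rw [this]
    refine Finset.sum_eq_zero fun k _ => ?_
    rw [← wp_cast, h0]
    simp
  rw [RootPairing.root_coroot_eq_pairing, RootPairing.pairing_same] at h1
  norm_num at h1

theorem wp_fw_nonneg {i : κ} (h : 0 < wp i (rho b)) (k : b.support) : 0 ≤ wp i (fw b k) := by
  rcases wp_fw_sign b i with hs | hs
  · exact hs k
  · rw [wp_rho] at h
    exact absurd h (not_lt.2 (Finset.sum_nonpos fun k _ => hs k))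

theorem wp_nonneg_of_dominant {i : κ} (h : 0 < wp i (rho b)) {x : weightLattice R}
    (hx : ∀ k : b.support, 0 ≤ wp (k : κ) x) : 0 ≤ wp i x := by
  rw [wp_eq_sum b]
  exact Finset.sum_nonneg fun k _ => mul_nonneg (hx k) (wp_fw_nonneg b h k)

theorem idx_ext {i j : κ} (h : ∀ k : b.support, wp i (fw b k) = wp j (fw b k)) : i = j := by
  classical
  apply R.coroot.injective
  apply R.flip.toPerfPair.injective
  have hs : Submodule.span ℝ (Set.range R.root) = ⊤ := RootPairing.IsRootSystem.span_root_eq_top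
  ext x
  change R.toLinearMap x (R.coroot i) = R.toLinearMap x (R.coroot j)
  obtain ⟨f, hf⟩ := (Submodule.mem_span_range_iff_exists_fun ℝ).1
      (show R.toPerfPair x ∈ Submodule.span ℝ (Set.range b.toCoweightBasis.coord) by
        rw [← Module.Basis.coe_dualBasis, Module.Basis.span_eq]; trivial)
  have : ∀ i, R.toLinearMap x (R.coroot i) =
        ∑ k, f k * R.toLinearMap (fw b k : E) (R.coroot i) := by
    intro i
    change R.toPerfPair x (R.coroot i) = _
    rw [← hf, LinearMap.sum_apply]
    refine Finset.sum_congr rfl fun k _ => ?_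
    rw [LinearMap.smul_apply, smul_eq_mul, ← fundamentalWeight_coroot]
    rfl
  rw [this, this]
  simp_rw [← wp_cast, h]

/-- Nonnegative integer coefficients with sum 1 are those of a single simple coroot. -/
theorem mem_support_of_wp_rho {i : κ} (h : wp i (rho b) = 1) : i ∈ b.support := by
  classical
  have hpos : ∀ k, 0 ≤ wp i (fw b k) := fun k => wp_fw_nonneg b (by rw [h]; norm_num) k
  rw [wp_rho] at h
  obtain ⟨k, hk⟩ : ∃ k, wp i (fw b k) ≠ 0 := by
    by_contra! hc
    simp [hc] at h
  have hk1 : wp i (fw b k) = 1 ∧ ∀ j ≠ k, wp i (fw b j) = 0 := by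
    have h1 := Finset.add_sum_erase Finset.univ (fun k => wp i (fw b k)) (Finset.mem_univ k)
    have h2 : 0 ≤ ∑ j ∈ Finset.univ.erase k, wp i (fw b j) :=
      Finset.sum_nonneg fun j _ => hpos j
    have h3 := hpos k
    have h4 : ∑ j ∈ Finset.univ.erase k, wp i (fw b j) = 0 := by omega
    refine ⟨by omega, fun j hj => ?_⟩
    exact (Finset.sum_eq_zero_iff_of_nonneg fun j _ => hpos j).1 h4 j (by simp [hj])
  have : i = k := idx_ext b fun j => by
    rcases eq_or_ne k j with rfl | hj
    · rw [hk1.1, wp_fw_self]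
    · rw [hk1.2 j hj.symm, wp_fw_ne b hj]
  rw [this]
  exact k.2

theorem rootForm_rho_root [R.IsCrystallographic] (i : κ) :
    2 * R.RootForm (rho b : E) (R.root i) =
      wp i (rho b) * R.RootForm (R.root i) (R.root i) := by
  rw [rootForm_root, wp_cast]

/-- `IsPos` refers to roots and `wp` to coroots. The link is (ρ, α), which is additive in roots and
has the sign of (ρ, α^∨), so induction by adding simple roots applies to it. -/
theorem isPos_iff_wp_rho [R.IsCrystallographic] (i : κ) : b.IsPos i ↔ 0 < wp i (rho b) := by
  have key : ∀ i, b.IsPos i → 0 < wp i (rho b) := by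
    intro i hi
    have h : 0 < R.RootForm (rho b : E) (R.root i) := by
      refine hi.induction_on_add (p := fun i => 0 < R.RootForm (rho b : E) (R.root i)) ?_ ?_
      · intro j hj
        have h1 := rootForm_rho_root b j
        have h2 := wp_rho_simple b ⟨j, hj⟩
        simp only at h2
        rw [h2] at h1
        have := rootForm_root_pos (R := R) j
        push_cast at h1
        linarith
      · intro i j k hk hi hj
        have h1 := rootForm_rho_root b j
        have h2 := wp_rho_simple b ⟨j, hj⟩
        simp only at h2
        rw [h2] at h1
        have := rootForm_root_pos (R := R) j
        push_cast at h1
        rw [hk, map_add]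
        linarith
    have h1 := rootForm_rho_root b i
    have h2 := rootForm_root_pos (R := R) i
    have h3 : 0 < (wp i (rho b) : ℝ) * R.RootForm (R.root i) (R.root i) := by linarith
    have := pos_of_mul_pos_left h3 h2.le
    exact_mod_cast this
  refine ⟨key i, fun h => ?_⟩
  let := R.indexNeg
  rcases RootPairing.Base.IsPos.or_neg b i with hi | hi
  · exact hi
  · have := key _ hi
    rw [wp_neg_coroot (i := i) (by simp)] at this
    omega

end

section

variable {κ E E' : Type*} [Fintype κ] [AddCommGroup E] [Module ℝ E] [AddCommGroup E'] [Module ℝ E']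
variable {R : RootPairing κ ℝ E E'}
variable [R.IsRootSystem] (b : R.Base) [R.IsCrystallographic]

/-! ### The highest coroot -/

theorem wp_of_coroot_add {i j k : κ} (h : R.coroot k = R.coroot i + R.coroot j)
    (x : weightLattice R) : wp k x = wp i x + wp j x := by
  rw [wp_eq_iff, h, map_add]
  push_cast
  rw [wp_cast, wp_cast]

theorem wp_of_coroot_sub {i j k : κ} (h : R.coroot k = R.coroot i - R.coroot j)
    (x : weightLattice R) : wp k x = wp i x - wp j x := by
  rw [wp_eq_iff, h, map_sub]
  push_cast
  rw [wp_cast, wp_cast]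

theorem pairingIn_flip (i j : κ) : R.flip.pairingIn ℤ i j = R.pairingIn ℤ j i := by
  have h1 := R.flip.algebraMap_pairingIn ℤ i j
  have h2 := R.algebraMap_pairingIn ℤ j i
  rw [RootPairing.pairing_flip, ← h2] at h1
  exact_mod_cast h1

theorem exists_coroot_add {i j : κ} (h : R.pairingIn ℤ j i < 0)
    (hne : R.coroot i ≠ - R.coroot j) : ∃ k, R.coroot k = R.coroot i + R.coroot j := by
  rw [← pairingIn_flip] at h
  exact R.flip.root_add_root_mem_of_pairingIn_neg h hne

theorem exists_coroot_sub {i j : κ} (h : 0 < R.pairingIn ℤ j i)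
    (hne : i ≠ j) : ∃ k, R.coroot k = R.coroot i - R.coroot j := by
  rw [← pairingIn_flip] at h
  exact R.flip.root_sub_root_mem_of_pairingIn_pos h hne

theorem idx_eq_of_le_of_rho_le {i j : κ} (h : ∀ k, wp i (fw b k) ≤ wp j (fw b k))
    (h' : wp j (rho b) ≤ wp i (rho b)) : i = j := by
  refine idx_ext b fun k => ?_
  rw [wp_rho, wp_rho] at h'
  exact (Finset.sum_eq_sum_iff_of_le fun k _ => h k).1
    (le_antisymm (Finset.sum_le_sum fun k _ => h k) h') k (Finset.mem_univ _)

/-- A positive coroot which is maximal for the coefficientwise order. -/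
structure IsMaxCoroot (i : κ) : Prop where
  pos : 0 < wp i (rho b)
  eq_of_le : ∀ j, (∀ k, wp i (fw b k) ≤ wp j (fw b k)) → i = j

variable {b}

/-- If α_k had negative pairing with a maximal coroot, then adding α_k^∨ would give a larger coroot.
-/
theorem IsMaxCoroot.dominant {i : κ} (hi : IsMaxCoroot b i) (k : b.support) :
    0 ≤ wp i (rootWt R k) := by
  by_contra! h
  rw [wp_rootWt] at h
  obtain ⟨j, hj⟩ := exists_coroot_add h (by
    intro h0
    have h1 := wp_neg_coroot h0 (rho b)
    rw [wp_rho_simple] at h1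
    have := hi.pos
    omega)
  have h2 := fun x => wp_of_coroot_add hj x
  have h3 := hi.eq_of_le j fun l => by
    rw [h2]
    have := wp_fw_nonneg b (i := (k : κ)) (by rw [wp_rho_simple]; norm_num) l
    omega
  have h4 := h2 (rho b)
  rw [← h3, wp_rho_simple] at h4
  omega

theorem wp_simple_nonpos {j k : b.support} (h : j ≠ k) : wp (j : κ) (rootWt R k) ≤ 0 := by
  rw [wp_rootWt]
  exact b.pairingIn_le_zero_of_ne (fun h' => h (Subtype.ext h').symm) k.2 j.2

/-- Let Z be the set of simple coroots missing from the maximal one. For k ∈ Z the dominance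
inequality is a sum of nonpositive terms, so α_k is orthogonal to every α_j with j ∉ Z. The span of
the roots in Z is then W-stable, which contradicts irreducibility unless Z is empty. -/
theorem IsMaxCoroot.one_le [R.IsIrreducible] {i : κ} (hi : IsMaxCoroot b i) [R.IsReduced]
    (k : b.support) : 1 ≤ wp i (fw b k) := by
  by_contra! hk
  have hnn := fun k => wp_fw_nonneg b hi.pos k
  set Z : Set b.support := {k | wp i (fw b k) = 0} with hZ
  have hkZ : k ∈ Z := by
    have := hnn k
    simp only [hZ, Set.mem_ofPred_eq]
    omega
  have hperp : ∀ k ∈ Z, ∀ j ∉ Z, wp (j : κ) (rootWt R k) = 0 := by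
    intro k hk j hj
    have h0 := hi.dominant k
    rw [wp_eq_sum b] at h0
    have hle : ∀ j ∈ (Finset.univ : Finset b.support), wp (j : κ) (rootWt R (k : κ)) * wp i (fw b j) ≤ 0 := by
      intro j _
      rcases eq_or_ne j k with rfl | hne
      · have : wp i (fw b j) = 0 := hk
        rw [this]; simp
      · exact mul_nonpos_of_nonpos_of_nonneg (wp_simple_nonpos hne) (hnn j)
    have h1 := (Finset.sum_eq_zero_iff_of_nonpos hle).1
      (le_antisymm (Finset.sum_nonpos hle) h0) j (Finset.mem_univ _)
    exact (mul_eq_zero.1 h1).resolve_right hj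
  obtain ⟨l, hl⟩ : ∃ l, l ∉ Z := by
    by_contra! hall
    have := hi.pos
    rw [wp_rho, Finset.sum_eq_zero fun k _ => hall k] at this
    omega
  set q : Submodule ℝ E := Submodule.span ℝ ((fun k : b.support => R.root k) '' Z) with hq
  have hinv : ∀ j ∈ b.support, q ∈ Module.End.invtSubmodule (R.reflection j : E →ₗ[ℝ] E) := by
    intro j hj
    rw [Module.End.mem_invtSubmodule, hq, Submodule.span_le]
    rintro _ ⟨k, hk, rfl⟩
    change R.reflection j (R.root k) ∈ q
    rw [R.reflection_apply_root' ℤ]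
    refine sub_mem (Submodule.subset_span ⟨k, hk, rfl⟩) ?_
    by_cases hjZ : (⟨j, hj⟩ : b.support) ∈ Z
    · have hjq : R.root j ∈ Submodule.span ℝ ((fun k : b.support => R.root k) '' Z) :=
        Submodule.subset_span ⟨⟨j, hj⟩, hjZ, rfl⟩
      exact zsmul_mem hjq _
    · have := hperp k hk _ hjZ
      rw [wp_rootWt] at this
      simp only at this
      rw [this, zero_smul]
      exact zero_mem _
  have htop : q = ⊤ := by
    refine RootPairing.IsIrreducible.eq_top_of_invtSubmodule_reflection (P := R) q
      ((b.forall_mem_support_invtSubmodule_iff q).1 hinv) ?_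
    intro h0
    have : R.root k ∈ q := Submodule.subset_span ⟨k, hkZ, rfl⟩
    rw [h0, Submodule.mem_bot] at this
    exact R.ne_zero k this
  have hmem : b.toWeightBasis l ∈ Submodule.span ℝ (b.toWeightBasis '' Z) := by
    have : (b.toWeightBasis '' Z) = ((fun k : b.support => R.root k) '' Z) := by
      ext; simp
    rw [this, ← hq, htop]
    trivial
  exact b.toWeightBasis.linearIndependent.notMem_span_image hl hmem

/-- Two distinct maximal coroots have positive pairing, because one is dominant and the other has
full support. Their difference is then a coroot, hence positive or negative, so the two are
comparable. -/
theorem IsMaxCoroot.unique [R.IsIrreducible] [R.IsReduced] {i j : κ} (hi : IsMaxCoroot b i)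
    (hj : IsMaxCoroot b j) : i = j := by
  by_contra hne
  have hnn : ∀ k : b.support, 0 ≤ wp (k : κ) (rootWt R j) := by
    intro k
    have := hj.dominant k
    rw [wp_rootWt] at this ⊢
    by_contra! hlt
    rw [R.pairingIn_lt_zero_iff] at hlt
    omega
  have hpos : 0 < R.pairingIn ℤ j i := by
    rw [← wp_rootWt, wp_eq_sum b]
    obtain ⟨k, hk⟩ : ∃ k : b.support, wp (k : κ) (rootWt R j) ≠ 0 := by
      by_contra! h0
      have : rootWt R j = 0 := wp_ext b fun k => by rw [h0, map_zero]
      have h2 : R.root j = 0 := congrArg Subtype.val this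
      exact R.ne_zero j h2
    refine Finset.sum_pos' (fun k _ => mul_nonneg (hnn k) (wp_fw_nonneg b hi.pos k))
      ⟨k, Finset.mem_univ _, ?_⟩
    have := hnn k
    have := hi.one_le k
    positivity
  obtain ⟨l, hl⟩ := exists_coroot_sub hpos hne
  have h2 := fun x => wp_of_coroot_sub hl x
  rcases lt_or_gt_of_ne (wp_rho_ne_zero b l) with h | h
  · apply hne
    refine hi.eq_of_le j fun k => ?_
    have h1 : wp l (fw b k) ≤ 0 := by
      rcases wp_fw_sign b l with hs | hs
      · rw [wp_rho] at h
        exact absurd h (not_lt.2 (Finset.sum_nonneg fun k _ => hs k))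
      · exact hs k
    have := h2 (fw b k)
    omega
  · apply hne
    refine (hj.eq_of_le i fun k => ?_).symm
    have h1 := wp_fw_nonneg b h k
    have := h2 (fw b k)
    omega

variable (b) in
/-- The coroot `α_θ^∨` is the highest one. -/
structure IsHighest (θ : κ) : Prop where
  le : ∀ i k, wp i (fw b k) ≤ wp θ (fw b k)
  one_le : ∀ k, 1 ≤ wp θ (fw b k)
  dominant : ∀ k : b.support, 0 ≤ wp θ (rootWt R k)

variable (b) in
theorem exists_isHighest [R.IsIrreducible] [R.IsReduced] : ∃ θ, IsHighest b θ := by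
  have : Nonempty κ := by
    by_contra h
    rw [not_nonempty_iff] at h
    have hs : Submodule.span ℝ (Set.range R.root) = ⊤ := RootPairing.IsRootSystem.span_root_eq_top
    have : Nontrivial E := RootPairing.IsIrreducible.nontrivial R
    rw [Set.range_eq_empty, Submodule.span_empty] at hs
    exact bot_ne_top hs
  -- Above any positive coroot there is a maximal one: take greatest height among the coroots
  -- dominating it.
  have hmax : ∀ i, 0 < wp i (rho b) → ∃ j, IsMaxCoroot b j ∧ ∀ k, wp i (fw b k) ≤ wp j (fw b k) := by
    intro i hi
    obtain ⟨j, hj, hmx⟩ := Set.exists_max_image {j | ∀ k, wp i (fw b k) ≤ wp j (fw b k)}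
      (fun j => wp j (rho b)) (Set.toFinite _) ⟨i, fun k => le_rfl⟩
    refine ⟨j, ⟨lt_of_lt_of_le hi (hmx i fun k => le_rfl), fun l hl => ?_⟩, hj⟩
    exact idx_eq_of_le_of_rho_le b hl (hmx l fun k => (hj k).trans (hl k))
  obtain ⟨s⟩ := b.support_nonempty.to_subtype
  obtain ⟨θ, hθ, -⟩ := hmax s (by rw [wp_rho_simple]; norm_num)
  refine ⟨θ, fun i k => ?_, hθ.one_le, hθ.dominant⟩
  rcases lt_or_gt_of_ne (wp_rho_ne_zero b i) with h | h
  · refine le_trans ?_ (wp_fw_nonneg b hθ.pos k)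
    rcases wp_fw_sign b i with hs | hs
    · rw [wp_rho] at h
      exact absurd h (not_lt.2 (Finset.sum_nonneg fun k _ => hs k))
    · exact hs k
  · obtain ⟨j, hj, hij⟩ := hmax i h
    rw [hθ.unique hj]
    exact hij k

theorem IsHighest.rho_le {θ : κ} (hθ : IsHighest b θ) (i : κ) : wp i (rho b) ≤ wp θ (rho b) := by
  rw [wp_rho, wp_rho]
  exact Finset.sum_le_sum fun k _ => hθ.le i k

theorem IsHighest.rho_pos [R.IsIrreducible] {θ : κ} (hθ : IsHighest b θ) : 0 < wp θ (rho b) := by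
  rcases lt_or_gt_of_ne (wp_rho_ne_zero b θ) with h | h
  · rw [wp_rho] at h
    exact absurd h (not_lt.2 (Finset.sum_nonneg fun k _ => by linarith [hθ.one_le k]))
  · exact h

theorem IsHighest.coxeterNumber_eq {θ : κ} (hθ : IsHighest b θ) [R.IsIrreducible] :
    (coxeterNumber b : ℤ) = 1 + wp θ (rho b) := by
  have h : ∀ i, ⌊R.toLinearMap (rho b : E) (R.coroot i)⌋₊ = (wp i (rho b)).toNat := by
    intro i
    rw [← wp_cast]
    rw [← Int.floor_toNat, Int.floor_intCast]
  have h2 : (Finset.univ.sup fun i => ⌊R.toLinearMap (rho b : E) (R.coroot i)⌋₊) =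
      (wp θ (rho b)).toNat := by
    simp_rw [h]
    refine le_antisymm (Finset.sup_le fun i _ => Int.toNat_le_toNat (hθ.rho_le i))
      (Finset.le_sup (f := fun i => (wp i (rho b)).toNat) (Finset.mem_univ θ))
  rw [coxeterNumber, h2]
  push_cast
  rw [Int.toNat_of_nonneg hθ.rho_pos.le]

end

section

variable {κ E E' : Type*} [Fintype κ] [AddCommGroup E] [Module ℝ E] [AddCommGroup E'] [Module ℝ E']
variable {R : RootPairing κ ℝ E E'}
variable [R.IsRootSystem] (b : R.Base) [R.IsCrystallographic]

/-! ### The Weyl group: words in the simple reflections -/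

theorem wp_smul_neg (w : R.weylGroup) (i : κ) (x : weightLattice R) :
    wp (w • R.reflectionPerm i i) x = - wp (w • i) x := by
  have h1 := wp_inv_smul w⁻¹ i x
  have h2 := wp_inv_smul w⁻¹ (R.reflectionPerm i i) x
  rw [inv_inv] at h1 h2
  rw [← h1, ← h2, wp_refl_self]

/-- The product of the simple reflections of a word. -/
def word (l : List b.support) : R.weylGroup := (l.map fun k => refl R (k : κ)).prod

theorem word_nil : word b [] = 1 := rfl

theorem word_cons (k : b.support) (l : List b.support) :
    word b (k :: l) = refl R (k : κ) * word b l := by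
  simp [word]

theorem word_append (l l' : List b.support) : word b (l ++ l') = word b l * word b l' := by
  simp [word]

variable [R.IsReduced]

theorem exists_word_refl (i : κ) : ∃ l, refl R i = word b l := by
  refine b.induction_reflect i (p := fun i => ∃ l, refl R i = word b l) ?_ ?_ ?_
  · rintro i ⟨l, hl⟩
    refine ⟨l, ?_⟩
    rw [← hl]
    have := refl_conj (refl R i) i
    rw [refl_smul_idx] at this
    rw [← this, mul_assoc, mul_inv_cancel, mul_one]
  · intro i hi
    exact ⟨[⟨i, hi⟩], by simp [word]⟩
  · rintro i j ⟨l, hl⟩ hj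
    refine ⟨⟨j, hj⟩ :: (l ++ [⟨j, hj⟩]), ?_⟩
    have := refl_conj (refl R j) i
    rw [refl_smul_idx] at this
    rw [← this, word_cons, word_append, ← hl, refl_inv, mul_assoc]
    simp [word]

theorem exists_word (w : R.weylGroup) : ∃ l, w = word b l := by
  obtain ⟨g, hg⟩ := w
  induction hg using RootPairing.weylGroup.induction with
  | mem i => exact exists_word_refl b i
  | one => exact ⟨[], rfl⟩
  | mul g₁ g₂ hg₁ hg₂ h₁ h₂ =>
    obtain ⟨l₁, h₁⟩ := h₁
    obtain ⟨l₂, h₂⟩ := h₂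
    refine ⟨l₁ ++ l₂, ?_⟩
    rw [word_append, ← h₁, ← h₂]
    rfl

theorem refl_smul_pos {i : κ} (hi : 0 < wp i (rho b)) (k : b.support) (hne : i ≠ k) :
    0 < wp (refl R (k : κ) • i) (rho b) := by
  rw [← isPos_iff_wp_rho] at hi ⊢
  exact hi.reflectionPerm k.2 hne

/-- The exchange condition. Reading the word from the right, the image of α_k turns negative at some
letter s_j. Only α_j is made negative by s_j, so the image just before is α_j, and conjugating s_k
shows that s_k cancels this letter. -/
theorem exists_word_exchange (l : List b.support) (k : b.support)
    (h : wp (word b l • (k : κ)) (rho b) < 0) :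
    ∃ l' : List b.support, l'.length + 1 = l.length ∧ word b l * refl R (k : κ) = word b l' := by
  induction l with
  | nil =>
    rw [word_nil, one_smul, wp_rho_simple] at h
    omega
  | cons j l ih =>
    rw [word_cons, mul_smul] at h
    rcases lt_or_gt_of_ne (wp_rho_ne_zero b (word b l • (k : κ))) with h1 | h1
    · obtain ⟨l', hl', h'⟩ := ih h1
      exact ⟨j :: l', by simp [hl'], by rw [word_cons, word_cons, mul_assoc, h']⟩
    · have hj : word b l • (k : κ) = j := by
        by_contra hne
        have := refl_smul_pos b h1 j hne
        omega
      refine ⟨l, by simp, ?_⟩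
      have := refl_conj (word b l) (k : κ)
      rw [hj] at this
      rw [word_cons, ← this, mul_assoc, mul_assoc, inv_mul_cancel_left, mul_assoc, refl_mul_self,
        mul_one]

/-- Write w = w₀ s_k. As w fixes ρ, the coroot wα_k^∨ has height 1, so w₀α_k^∨ is negative and the
exchange condition gives a shorter word for w. -/
theorem eq_one_of_smul_rho {w : R.weylGroup} (hw : w • rho b = rho b) : w = 1 := by
  obtain ⟨l, rfl⟩ := exists_word b w
  induction hn : l.length using Nat.strong_induction_on generalizing l with
  | _ n ih =>
    rcases List.eq_nil_or_concat l with rfl | ⟨l₀, k, rfl⟩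
    · rfl
    · rw [List.concat_eq_append] at hw hn ⊢
      have e : word b (l₀ ++ [k]) = word b l₀ * refl R (k : κ) := by
        rw [word_append]; simp [word]
      have h1 : wp (word b l₀ • (k : κ)) (rho b) < 0 := by
        have h2 := wp_smul (word b (l₀ ++ [k])) (k : κ) (rho b)
        rw [hw, wp_rho_simple, e, mul_smul, refl_smul_idx, wp_smul_neg] at h2
        omega
      obtain ⟨l', hl', h'⟩ := exists_word_exchange b l₀ k h1
      rw [e, h'] at hw ⊢
      refine ih l'.length ?_ l' hw rfl
      rw [← hn]
      simp
      omega

/-! ### Regular weights modulo `N` -/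

variable {b}

-- The squared distance to r takes nonnegative integer values, so a closest point y exists. Moving
-- from y to y - tα_i changes the squared distance by (α_i, α_i) · t(t - (y - r, α_i^∨)), which must
-- be nonnegative.
variable (R) in
theorem exists_closest (O : Set (weightLattice R)) (hO : O.Nonempty) (r : weightLattice R) :
    ∃ y ∈ O, ∀ (i : κ) (t : ℤ), y - t • rootWt R i ∈ O → 0 ≤ t * (t - wp i (y - r)) := by
  choose f hf using fun y : weightLattice R => rootForm_int R (y - r) (y - r)
  have hnn : ∀ y, 0 ≤ f y := fun y => by
    have : 0 ≤ R.RootForm ((y - r : weightLattice R) : E) ((y - r : weightLattice R) : E) := by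
      rw [RootPairing.rootForm_apply_apply]
      exact Finset.sum_nonneg fun i _ => mul_self_nonneg _
    rw [hf] at this
    exact_mod_cast this
  obtain ⟨y, hy, hmin⟩ := (measure fun y => (f y).toNat).wf.has_min O hO
  refine ⟨y, hy, fun i t ht => ?_⟩
  have h1 : ¬ (f (y - t • rootWt R i)).toNat < (f y).toNat := hmin _ ht
  have h2 : f y ≤ f (y - t • rootWt R i) := by
    have := hnn y
    have := hnn (y - t • rootWt R i)
    omega
  have h3 : (f y : ℝ) ≤ f (y - t • rootWt R i) := by exact_mod_cast h2
  rw [← hf, ← hf] at h3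
  have h4 : ((y - t • rootWt R i - r : weightLattice R) : E) =
      ((y - r : weightLattice R) : E) - (t : ℝ) • R.root i := by
    rw [Int.cast_smul_eq_zsmul]
    simp only [AddSubgroup.coe_sub, AddSubgroup.coe_zsmul, rootWt]
    abel
  rw [h4] at h3
  set z : E := ((y - r : weightLattice R) : E) with hz
  have h5 := rootForm_root (R := R) i z
  have h6 : R.RootForm (R.root i) z = R.RootForm z (R.root i) := by
    have := R.rootForm_symmetric.eq (R.root i) z
    simpa using this
  have h7 := rootForm_root_pos (R := R) i
  simp only [map_sub, map_smul, LinearMap.sub_apply, LinearMap.smul_apply, smul_eq_mul, h6] at h3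
  rw [hz, ← wp_cast, ← hz] at h5
  have h8 : 0 ≤ R.RootForm (R.root i) (R.root i) * ((t : ℝ) * (t - wp i (y - r))) := by
    have : R.RootForm (R.root i) (R.root i) * ((t : ℝ) * (t - wp i (y - r))) =
        t * (t * R.RootForm (R.root i) (R.root i)) - t * (2 * R.RootForm z (R.root i)) := by
      rw [h5]; ring
    rw [this]
    linarith
  have h9 := nonneg_of_mul_nonneg_right h8 h7
  exact_mod_cast h9

theorem IsHighest.neg_rho_le {θ : κ} (hθ : IsHighest b θ) (i : κ) :
    - wp θ (rho b) ≤ wp i (rho b) := by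
  have := hθ.rho_le (R.reflectionPerm i i)
  rw [wp_refl_self] at this
  omega

theorem IsHighest.eq_one_of_smul_rho {θ : κ} (hθ : IsHighest b θ) {N : ℤ}
    (hN : N = 2 + wp θ (rho b)) {w : R.weylGroup} {p : weightLattice R}
    (h : w • rho b = rho b + N • p) : w = 1 := by
  refine Daha.eq_one_of_smul_rho b (wp_ext b fun k => ?_)
  have h1 : wp (k : κ) (w • rho b) = 1 + N * wp (k : κ) p := by
    rw [h, map_add, map_zsmul, wp_rho_simple, smul_eq_mul]
  rw [wp_rho_simple]
  have h2 := wp_inv_smul w (k : κ) (rho b)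
  have h3 := hθ.rho_le (w⁻¹ • (k : κ))
  have h4 := hθ.neg_rho_le (w⁻¹ • (k : κ))
  -- The value 1 + N(p, α_k^∨) is the height of a coroot, hence lies between -(N - 2) and N - 2.
  -- Already 1 - N and 1 + N are outside this range.
  have h5 : wp (k : κ) p = 0 := by
    have hθ0 := hθ.rho_le (k : κ)
    rw [wp_rho_simple] at hθ0
    rcases lt_trichotomy (wp (k : κ) p) 0 with hlt | heq | hgt
    · exfalso
      have : N * wp (k : κ) p ≤ N * (-1) := mul_le_mul_of_nonneg_left (by omega) (by omega)
      omega
    · exact heq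
    · exfalso
      have : N * 1 ≤ N * wp (k : κ) p := mul_le_mul_of_nonneg_left (by omega) (by omega)
      omega
  rw [h1, h5]
  simp

theorem exists_strictly_dominant (O : Set (weightLattice R)) (hO : O.Nonempty)
    (hW : ∀ y ∈ O, ∀ i, refl R i • y ∈ O) (hreg : ∀ y ∈ O, ∀ i, wp i y ≠ 0) :
    ∃ y ∈ O, ∀ k : b.support, 1 ≤ wp (k : κ) y := by
  obtain ⟨y, hy, h⟩ := exists_closest R O hO (rho b)
  refine ⟨y, hy, fun k => ?_⟩
  -- The move is the simple reflection, with t = (y, α_k^∨). The second factor equals (ρ, α_k^∨) =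
  -- 1, so the inequality reads t ≥ 0.
  have h1 := h k (wp (k : κ) y) (by rw [← refl_smul]; exact hW y hy k)
  rw [map_sub, wp_rho_simple] at h1
  have h2 := hreg y hy k
  have h3 : 0 ≤ wp (k : κ) y := by linarith
  omega

theorem IsHighest.exists_eq_smul_rho [R.IsIrreducible] {θ : κ} (hθ : IsHighest b θ) {N : ℤ}
    (hN : N = 2 + wp θ (rho b)) (x : weightLattice R) (hx : ∀ i, ¬ N ∣ wp i x) :
    ∃ (w : R.weylGroup) (p : weightLattice R), x = w • rho b + N • p := by
  classical
  have hzs : ∀ (w : R.weylGroup) (n : ℤ) (z : weightLattice R), w • (n • z) = n • (w • z) :=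
    fun w n z => (DistribSMul.toAddMonoidHom (weightLattice R) w).map_zsmul _ _
  set O : Set (weightLattice R) := {y | ∃ (w : R.weylGroup) (p : weightLattice R),
    y = w • x + N • p} with hOdef
  have hOW : ∀ y ∈ O, ∀ w : R.weylGroup, w • y ∈ O := by
    rintro _ ⟨v, p, rfl⟩ w
    exact ⟨w * v, w • p, by rw [smul_add, mul_smul, hzs]⟩
  have hOT : ∀ y ∈ O, ∀ p : weightLattice R, y + N • p ∈ O := by
    rintro _ ⟨v, p, rfl⟩ p'
    exact ⟨v, p + p', by rw [smul_add, add_assoc]⟩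
  have hreg : ∀ y ∈ O, ∀ i, ¬ N ∣ wp i y := by
    rintro _ ⟨v, p, rfl⟩ i hd
    rw [map_add, map_zsmul, smul_eq_mul, wp_inv_smul, dvd_add_left (dvd_mul_right _ _)] at hd
    exact hx _ hd
  suffices h : rho b ∈ O by
    obtain ⟨w, p, h⟩ := h
    refine ⟨w⁻¹, - (w⁻¹ • p), ?_⟩
    rw [h, smul_add, inv_smul_smul, hzs, smul_neg]
    abel
  obtain ⟨y, hy, hclose⟩ := exists_closest R O ⟨x, 1, 0, by simp⟩ (rho b)
  have hρ0 := hθ.rho_pos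
  have h1 : ∀ k : b.support, 1 ≤ wp (k : κ) y := by
    intro k
    have h1 := hclose k (wp (k : κ) y) (by rw [← refl_smul]; exact hOW y hy _)
    rw [map_sub, wp_rho_simple] at h1
    have h2 : wp (k : κ) y ≠ 0 := fun h0 => hreg y hy k (by rw [h0]; exact dvd_zero _)
    have h3 : 0 ≤ wp (k : κ) y := by linarith
    omega
  have h2 : wp θ y ≤ 1 + wp θ (rho b) := by
    -- The move is the affine reflection y ↦ s_θ y + Nα_θ, with t = (y, ϑ) - N. The second factor is
    -- (ρ, ϑ) - N = -2, so t ≤ 0; regularity excludes t = 0.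
    have h1 := hclose θ (wp θ y - N) (by
      have : y - (wp θ y - N) • rootWt R θ = refl R θ • y + N • rootWt R θ := by
        rw [refl_smul, sub_smul]; abel
      rw [this]
      exact hOT _ (hOW y hy _) _)
    rw [map_sub] at h1
    have h2 : wp θ y ≠ N := fun h0 => hreg y hy θ (by rw [h0])
    have h3 : wp θ y - N - (wp θ y - wp θ (rho b)) = -2 := by omega
    rw [h3] at h1
    omega
  by_cases h0 : ∀ k : b.support, wp (k : κ) y = 1
  · have : y = rho b := wp_ext b fun k => by rw [h0, wp_rho_simple]
    rwa [← this]
  push Not at h0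
  obtain ⟨r, hr⟩ := h0
  -- With n_k ≥ 1 the coefficients of ϑ, the excess ∑ (y_k - 1)n_k is at most 1. So at most one
  -- coordinate of y differs from 1; it is then 2, and its n_k is 1.
  have hsum : ∑ k : b.support, (wp (k : κ) y - 1) * wp θ (fw b k) ≤ 1 := by
    rw [wp_eq_sum b θ y, wp_rho] at h2
    simp_rw [sub_mul, one_mul, Finset.sum_sub_distrib]
    omega
  have hterm : ∀ k : b.support, 0 ≤ (wp (k : κ) y - 1) * wp θ (fw b k) := fun k =>
    mul_nonneg (by have := h1 k; omega) (by have := hθ.one_le k; omega)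
  have hsplit := Finset.add_sum_erase Finset.univ
    (fun k : b.support => (wp (k : κ) y - 1) * wp θ (fw b k)) (Finset.mem_univ r)
  have hrest : 0 ≤ ∑ k ∈ Finset.univ.erase r, (wp (k : κ) y - 1) * wp θ (fw b k) :=
    Finset.sum_nonneg fun k _ => hterm k
  have hr1 : 1 ≤ wp (r : κ) y - 1 := by have := h1 r; omega
  have hr2 := hθ.one_le r
  have hr3 : (wp (r : κ) y - 1) * wp θ (fw b r) ≤ 1 := by linarith
  have hr4 : wp (r : κ) y - 1 = 1 := by nlinarith
  have hr5 : wp θ (fw b r) = 1 := by rw [hr4] at hr3; omega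
  have hrest0 : ∑ k ∈ Finset.univ.erase r, (wp (k : κ) y - 1) * wp θ (fw b k) = 0 := by
    have : (wp (r : κ) y - 1) * wp θ (fw b r) = 1 := by rw [hr4, hr5]; norm_num
    linarith
  have hother : ∀ k : b.support, k ≠ r → wp (k : κ) y = 1 := by
    intro k hk
    have := (Finset.sum_eq_zero_iff_of_nonneg fun k _ => hterm k).1 hrest0 k (by simp [hk])
    rcases mul_eq_zero.1 this with h | h
    · omega
    · have := hθ.one_le k
      omega
  have hyr : y = rho b + fw b r := wp_ext b fun k => by
    rw [map_add, wp_rho_simple]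
    rcases eq_or_ne k r with rfl | hk
    · rw [wp_fw_self]; omega
    · rw [wp_fw_ne b hk, hother k hk]; norm_num
  -- The case y = ρ + ω_r with n_r = 1. The translate y' takes the value 1 on -ϑ and on every α_k^∨
  -- with k ≠ r, that is, on the extended simple system with α_r^∨ removed.
  set y' := y + N • (-fw b r) with hy'
  have hy'O : y' ∈ O := hOT y hy _
  have hy'v : ∀ i, wp i y' = wp i (rho b) - (N - 1) * wp i (fw b r) := by
    intro i
    rw [hy', hyr, map_add, map_add, map_zsmul, map_neg, smul_eq_mul]
    ring
  obtain ⟨v, ⟨hvO, w, hw⟩, hv⟩ := exists_strictly_dominant (b := b)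
    {v | v ∈ O ∧ ∃ w : R.weylGroup, v = w • y'} ⟨y', hy'O, 1, by simp⟩
    (by
      rintro _ ⟨hv, w, rfl⟩ i
      exact ⟨hOW _ hv _, refl R i * w, by rw [mul_smul]⟩)
    (fun v hv i h0 => hreg v hv.1 i (by rw [h0]; exact dvd_zero _))
  let γ : b.support → κ := fun j => if j = r then R.reflectionPerm θ θ else j
  have hγr : γ r = R.reflectionPerm θ θ := by simp [γ]
  have hγn : ∀ j, j ≠ r → γ j = j := fun j hj => by simp [γ, hj]
  have hγ : ∀ j, wp (γ j) y' = 1 := by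
    intro j
    rw [hy'v]
    rcases eq_or_ne j r with rfl | hj
    · rw [hγr, wp_refl_self, wp_refl_self, hr5]
      omega
    · rw [hγn j hj, wp_rho_simple, wp_fw_ne b hj]
      simp
  have hγinj : Function.Injective γ := by
    intro i j hij
    have hcontra : ∀ k : b.support, (k : κ) ≠ R.reflectionPerm θ θ := by
      intro k hk
      have := wp_rho_simple b k
      rw [hk, wp_refl_self] at this
      omega
    rcases eq_or_ne i r with hi | hi <;> rcases eq_or_ne j r with hj | hj
    · exact hi.trans hj.symm
    · rw [hi, hγr, hγn j hj] at hij
      exact absurd hij.symm (hcontra j)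
    · rw [hj, hγr, hγn i hi] at hij
      exact absurd hij (hcontra i)
    · rw [hγn i hi, hγn j hj] at hij
      exact Subtype.ext hij
  -- The point v = w y' is strictly dominant and takes the value 1 on w γ_j^∨. This coroot is
  -- therefore positive, its height is at most its value on v, and so it is simple.
  have hsimple : ∀ j, wp (w • γ j) (rho b) = 1 := by
    intro j
    have h3 : wp (w • γ j) v = 1 := by rw [hw, wp_smul, hγ]
    rw [wp_eq_sum b] at h3
    have hpos : 0 < wp (w • γ j) (rho b) := by
      rcases lt_or_gt_of_ne (wp_rho_ne_zero b (w • γ j)) with h | h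
      · exfalso
        rcases wp_fw_sign b (w • γ j) with hs | hs
        · rw [wp_rho] at h
          exact absurd h (not_lt.2 (Finset.sum_nonneg fun k _ => hs k))
        · have : ∑ k : b.support, wp (k : κ) v * wp (w • γ j) (fw b k) ≤ 0 :=
            Finset.sum_nonpos fun k _ => mul_nonpos_of_nonneg_of_nonpos
              (by have := hv k; omega) (hs k)
          omega
      · exact h
    have hle : wp (w • γ j) (rho b) ≤ 1 := by
      rw [wp_rho, ← h3]
      refine Finset.sum_le_sum fun k _ => ?_
      have h4 := wp_fw_nonneg b hpos k
      have h5 := hv k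
      nlinarith
    omega
  let f : b.support → b.support := fun j => ⟨w • γ j, mem_support_of_wp_rho b (hsimple j)⟩
  have hf : Function.Injective f := fun i j hij =>
    hγinj (MulAction.injective w (congrArg Subtype.val hij))
  -- The coroots w γ_j^∨ are distinct simple coroots, hence all of them, so v has every coordinate
  -- equal to 1.
  have hvρ : v = rho b := wp_ext b fun k => by
    obtain ⟨j, rfl⟩ := Finite.surjective_of_injective hf k
    rw [wp_rho_simple]
    change wp (w • γ j) v = 1
    rw [hw, wp_smul, hγ]
  rwa [← hvρ]

end

section

variable {κ E E' : Type*} [Fintype κ] [AddCommGroup E] [Module ℝ E] [AddCommGroup E'] [Module ℝ E']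
variable {R : RootPairing κ ℝ E E'}
variable [R.IsRootSystem] {b : R.Base} [R.IsCrystallographic]

/-! ### The sum of the positive roots -/

open Classical in
/-- The set of positive roots. -/
def posRoots (b : R.Base) : Finset κ := Finset.univ.filter fun i => b.IsPos i

theorem mem_posRoots {i : κ} : i ∈ posRoots b ↔ 0 < wp i (rho b) := by
  simp [posRoots, ← isPos_iff_wp_rho]

theorem rootWt_neg (i : κ) : rootWt R (R.reflectionPerm i i) = - rootWt R i := by
  ext
  simp [rootWt]

theorem pairingIn_smul (w : R.weylGroup) (i j : κ) :
    R.pairingIn ℤ (w • i) (w • j) = R.pairingIn ℤ i j := by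
  rw [← wp_rootWt, rootWt_smul, wp_smul, wp_rootWt]

theorem rootWt_reflectionPerm (i j : κ) :
    rootWt R (R.reflectionPerm j i) = rootWt R i - R.pairingIn ℤ i j • rootWt R j := by
  rw [← refl_smul_idx, rootWt_smul, refl_smul, wp_rootWt]

theorem pairingIn_reflectionPerm_left (i j k : κ) :
    R.pairingIn ℤ (R.reflectionPerm j i) k =
      R.pairingIn ℤ i k - R.pairingIn ℤ i j * R.pairingIn ℤ j k := by
  rw [← wp_rootWt, rootWt_reflectionPerm, map_sub, map_zsmul, wp_rootWt, wp_rootWt, smul_eq_mul]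

theorem pairingIn_reflectionPerm_right (i j k : κ) :
    R.pairingIn ℤ i (R.reflectionPerm j k) =
      R.pairingIn ℤ i k - R.pairingIn ℤ i j * R.pairingIn ℤ j k := by
  rw [RootPairing.pairingIn_reflectionPerm, pairingIn_reflectionPerm_left]

theorem wp_reflectionPerm (i j : κ) (x : weightLattice R) :
    wp (R.reflectionPerm j i) x = wp i x - R.pairingIn ℤ j i * wp j x := by
  have := wp_inv_smul (refl R j) i x
  rw [refl_inv, refl_smul_idx] at this
  rw [← this, refl_smul, map_sub, map_zsmul, wp_rootWt, smul_eq_mul, mul_comm]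

/-- The reflection s_k permutes the positive roots other than α_k and changes the sign of their
pairings with α_k^∨. These cancel, and α_k itself contributes 2. -/
theorem sum_posRoots [R.IsReduced] : ∑ i ∈ posRoots b, rootWt R i = (2 : ℤ) • rho b := by
  classical
  refine wp_ext b fun k => ?_
  rw [map_sum, map_zsmul, wp_rho_simple, ← Finset.add_sum_erase (posRoots b) _
    (mem_posRoots.2 (by rw [wp_rho_simple]; norm_num) : (k : κ) ∈ posRoots b)]
  have h : ∑ i ∈ (posRoots b).erase k, wp (k : κ) (rootWt R i) =
      ∑ i ∈ (posRoots b).erase k, - wp (k : κ) (rootWt R i) := by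
    have hmem : ∀ i ∈ (posRoots b).erase k, refl R (k : κ) • i ∈ (posRoots b).erase k := by
      intro i hi
      rw [Finset.mem_erase, mem_posRoots] at hi ⊢
      refine ⟨fun h => ?_, refl_smul_pos b hi.2 k hi.1⟩
      have h2 := refl_smul_pos b hi.2 k hi.1
      have h3 : i = R.reflectionPerm k k := by
        rw [← refl_smul_idx]
        nth_rewrite 2 [← h]
        rw [← mul_smul, refl_mul_self, one_smul]
      have h4 := hi.2
      rw [h3, wp_refl_self, wp_rho_simple] at h4
      omega
    refine Finset.sum_bij' (fun i _ => refl R (k : κ) • i) (fun i _ => refl R (k : κ) • i)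
      hmem hmem ?_ ?_ ?_
    · intro i _
      rw [← mul_smul, refl_mul_self, one_smul]
    · intro i _
      rw [← mul_smul, refl_mul_self, one_smul]
    · intro i _
      rw [refl_smul_idx, wp_rootWt, wp_rootWt, pairingIn_reflectionPerm_left,
        RootPairing.pairingIn_same]
      ring
  rw [Finset.sum_neg_distrib] at h
  have h2 : wp (k : κ) (rootWt R (k : κ)) = 2 := by rw [wp_rootWt, RootPairing.pairingIn_same]
  rw [h2]
  simp only [smul_eq_mul]
  omega

/-! ### The Coxeter number and the square length ratios -/

theorem IsHighest.pairingIn_nonneg {θ : κ} (hθ : IsHighest b θ) {i : κ} (hi : i ∈ posRoots b) :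
    0 ≤ R.pairingIn ℤ i θ := by
  rw [mem_posRoots, ← isPos_iff_wp_rho] at hi
  refine hi.induction_on_add (p := fun i => 0 ≤ R.pairingIn ℤ i θ) ?_ ?_
  · intro k hk
    have := hθ.dominant ⟨k, hk⟩
    rwa [wp_rootWt] at this
  · intro i k l h hi hk
    have := hθ.dominant ⟨k, hk⟩
    rw [wp_rootWt] at this
    simp only at this
    rw [RootPairing.pairingIn_eq_add_of_root_eq_add h]
    omega

theorem IsHighest.sum_pairingIn [R.IsReduced] {θ : κ} (hθ : IsHighest b θ) :
    2 * wp θ (rho b) = ∑ i ∈ Finset.univ.filter (fun i => 0 < R.pairingIn ℤ i θ),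
      R.pairingIn ℤ i θ := by
  have h1 : wp θ (∑ i ∈ posRoots b, rootWt R i) = 2 * wp θ (rho b) := by
    rw [sum_posRoots, map_zsmul, smul_eq_mul]
  rw [← h1, map_sum]
  simp_rw [wp_rootWt]
  symm
  refine Finset.sum_subset ?_ ?_
  · intro i hi
    rw [Finset.mem_filter] at hi
    rw [mem_posRoots]
    by_contra! hneg
    have hne := wp_rho_ne_zero b i
    have := hθ.pairingIn_nonneg (b := b) (i := R.reflectionPerm i i)
      (mem_posRoots.2 (by rw [wp_refl_self]; omega))
    rw [RootPairing.pairingIn_reflectionPerm_self_left] at this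
    omega
  · intro i hi hn
    have := hθ.pairingIn_nonneg hi
    simp only [Finset.mem_filter, Finset.mem_univ, true_and] at hn
    omega

variable [R.IsReduced]

/-- By irreducibility the orbit of a root spans E, so it is not contained in a hyperplane. -/
theorem exists_smul_pairingIn_ne_zero [R.IsIrreducible] (i j : κ) :
    ∃ w : R.weylGroup, R.pairingIn ℤ (w • i) j ≠ 0 := by
  by_contra! h
  have h1 : Submodule.span ℝ (MulAction.orbit R.weylGroup (R.root i)) ≤
      LinearMap.ker (R.coroot' j) := by
    rw [Submodule.span_le]
    rintro _ ⟨w, rfl⟩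
    rw [SetLike.mem_coe, LinearMap.mem_ker]
    change R.toLinearMap ((w • rootWt R i : weightLattice R) : E) (R.coroot j) = 0
    rw [← rootWt_smul, ← wp_cast, wp_rootWt, h]
    simp
  rw [RootPairing.span_orbit_eq_top] at h1
  have h2 : R.root j ∈ LinearMap.ker (R.coroot' j) := h1 trivial
  rw [LinearMap.mem_ker, RootPairing.root_coroot'_eq_pairing, RootPairing.pairing_same] at h2
  norm_num at h2

theorem pairingIn_cases (i j : κ) : i = j ∨ i = R.reflectionPerm j j ∨
    (R.pairingIn ℤ i j, R.pairingIn ℤ j i) ∈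
        ({(0, 0), (1, 1), (-1, -1), (1, 2), (2, 1), (-1, -2), (-2, -1), (1, 3), (3, 1), (-1, -3),
          (-3, -1)} : Set (ℤ × ℤ)) := by
  by_cases h1 : i = j
  · exact Or.inl h1
  by_cases h2 : i = R.reflectionPerm j j
  · exact Or.inr (Or.inl h2)
  refine Or.inr (Or.inr (R.pairingIn_pairingIn_mem_set_of_isCrystal_of_isRed' i j
    (fun h => h1 (R.root.injective h)) (fun h => h2 (R.root.injective ?_))))
  rw [h]
  simp

/-- The root with the highest coroot is short: if two root lengths occur, some root is longer than θ
and not orthogonal to it. -/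
theorem IsHighest.exists_two_le_pairingIn [R.IsIrreducible] {θ : κ} (hθ : IsHighest b θ) {i j : κ}
    (hij : 2 ≤ R.pairingIn ℤ i j) (hne : i ≠ j) :
    ∃ δ, δ ≠ θ ∧ 2 ≤ R.pairingIn ℤ δ θ := by
  have key : ∀ α β : κ, 2 ≤ R.pairingIn ℤ α β → α ≠ β → 0 < R.pairingIn ℤ β θ →
      ∃ δ, δ ≠ θ ∧ 2 ≤ R.pairingIn ℤ δ θ := by
    intro α β hαβ hne hβ
    rcases pairingIn_cases (R := R) β θ with rfl | rfl | h
    · exact ⟨α, hne, hαβ⟩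
    · rw [RootPairing.pairingIn_reflectionPerm_self_left, RootPairing.pairingIn_same] at hβ
      omega
    by_cases h2 : 2 ≤ R.pairingIn ℤ β θ
    · refine ⟨β, ?_, h2⟩
      rintro rfl
      rw [RootPairing.pairingIn_same] at h
      simp at h
    have h1 : R.pairingIn ℤ β θ = 1 := by omega
    rw [h1] at h
    by_cases h3 : R.pairingIn ℤ θ β = 1
    · set w := refl R β * refl R θ with hw
      have hwβ : w • β = R.reflectionPerm θ θ := by
        apply rootWt_injective (R := R)
        rw [hw, mul_smul, refl_smul_idx, refl_smul_idx, rootWt_reflectionPerm,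
          pairingIn_reflectionPerm_left, rootWt_reflectionPerm, rootWt_neg, h1, h3,
          RootPairing.pairingIn_same]
        module
      have hp : R.pairingIn ℤ (w • α) θ = - R.pairingIn ℤ α β := by
        rw [← pairingIn_smul w α β, hwβ, RootPairing.pairingIn_reflectionPerm_self_right, neg_neg]
      refine ⟨R.reflectionPerm (w • α) (w • α), ?_, ?_⟩
      · intro h0
        apply hne
        apply MulAction.injective w
        apply rootWt_injective (R := R)
        change rootWt R (w • α) = rootWt R (w • β)
        have := congrArg (rootWt R) h0
        rw [rootWt_neg] at this
        rw [hwβ, rootWt_neg, ← this, neg_neg]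
      · rw [RootPairing.pairingIn_reflectionPerm_self_left, hp, neg_neg]
        exact hαβ
    · exfalso
      have h4 : 2 ≤ R.pairingIn ℤ θ β := by
        simp only [Set.mem_insert_iff, Prod.mk.injEq, Set.mem_singleton_iff] at h
        omega
      -- With c = (θ, β^∨) ≥ 2, the coroot cϑ - β^∨ of -s_θ β is bounded by ϑ. Hence β^∨ ≥ (c - 1)ϑ
      -- ≥ ϑ, which forces β = θ.
      have h5 : ∀ k, wp θ (fw b k) ≤ wp β (fw b k) := by
        intro k
        have h6 := hθ.le (R.reflectionPerm (R.reflectionPerm θ β) (R.reflectionPerm θ β)) k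
        rw [wp_refl_self, wp_reflectionPerm] at h6
        have h7 := hθ.one_le k
        nlinarith
      have h8 : θ = β := idx_ext b fun k => le_antisymm (h5 k) (hθ.le β k)
      rw [h8, RootPairing.pairingIn_same] at h1
      omega
  -- Conjugating, and changing both signs if necessary, makes the pairing of the shorter root with θ
  -- positive.
  obtain ⟨w, hw⟩ := exists_smul_pairingIn_ne_zero (R := R) j θ
  rcases lt_or_gt_of_ne hw with h | h
  · refine key (R.reflectionPerm (w • i) (w • i)) (R.reflectionPerm (w • j) (w • j)) ?_ ?_ ?_
    · rw [RootPairing.pairingIn_reflectionPerm_self_left,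
        RootPairing.pairingIn_reflectionPerm_self_right, neg_neg, pairingIn_smul]
      exact hij
    · intro h0
      apply hne
      apply MulAction.injective w
      apply rootWt_injective (R := R)
      change rootWt R (w • i) = rootWt R (w • j)
      have := congrArg (rootWt R) h0
      rwa [rootWt_neg, rootWt_neg, neg_inj] at this
    · rw [RootPairing.pairingIn_reflectionPerm_self_left]
      omega
  · exact key (w • i) (w • j) (by rwa [pairingIn_smul]) (fun h0 => hne (MulAction.injective w h0)) h

theorem even_card_of_involution {ι : Type*} (s : Finset ι) (g : ι → ι) (hmem : ∀ a ∈ s, g a ∈ s)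
    (hne : ∀ a ∈ s, g a ≠ a) (hinv : ∀ a ∈ s, g (g a) = a) : Even s.card := by
  have h : ∑ _x ∈ s, (1 : ZMod 2) = 0 :=
    Finset.sum_involution (fun a _ => g a) (fun _ _ => by decide) (fun a ha _ => hne a ha) hmem hinv
  rw [Finset.sum_const, nsmul_eq_mul, mul_one, ZMod.natCast_eq_zero_iff] at h
  exact even_iff_two_dvd.2 h

/-- With A the roots of pairing 1 with θ, and B the roots other than θ of pairing 2, 2(ρ, ϑ) = 2 +
|A| + 2|B|. Since |B| is even and 4 divides |A|, the number (ρ, ϑ) is odd, and so is N = 2 + (ρ, ϑ).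
-/
theorem IsHighest.not_two_dvd [R.IsIrreducible] {θ : κ} (hθ : IsHighest b θ) {i j : κ}
    (hij : R.pairingIn ℤ i j = 2) (hne : i ≠ j) : ¬ (2 : ℤ) ∣ 2 + wp θ (rho b) := by
  classical
  have hG : R.IsNotG2 := by
    rw [← RootPairing.not_isG2_iff_isNotG2]
    intro hG
    have h1 := RootPairing.IsG2.pairingIn_mem_zero_one_three R i j
      (fun h => hne (R.root.injective h)) (fun h => by
        have : i = R.reflectionPerm j j := R.root.injective (by rw [h]; simp)
        rw [this, RootPairing.pairingIn_reflectionPerm_self_left, RootPairing.pairingIn_same] at hij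
        omega)
    rw [hij] at h1
    simp at h1
  have hb : ∀ i j : κ, -2 ≤ R.pairingIn ℤ i j ∧ R.pairingIn ℤ i j ≤ 2 := by
    intro i j
    have := RootPairing.IsNotG2.pairingIn_mem_zero_one_two (P := R) i j
    simp only [Set.mem_insert_iff, Set.mem_singleton_iff] at this
    omega
  have hdouble : ∀ i j : κ, (2 : ℤ) • rootWt R i ≠ rootWt R j := by
    intro i j h
    have h1 := congrArg (wp i) h
    rw [map_zsmul, wp_rootWt, wp_rootWt, RootPairing.pairingIn_same] at h1
    have := (hb j i).2
    simp only [smul_eq_mul] at h1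
    omega
  obtain ⟨δ, hδ, hδ2⟩ := hθ.exists_two_le_pairingIn (le_of_eq hij.symm) hne
  have hδθ : R.pairingIn ℤ δ θ = 2 := le_antisymm (hb _ _).2 hδ2
  have hθδ : R.pairingIn ℤ θ δ = 1 := by
    rcases pairingIn_cases (R := R) δ θ with h | h | h
    · exact absurd h hδ
    · rw [h, RootPairing.pairingIn_reflectionPerm_self_left, RootPairing.pairingIn_same] at hδθ
      omega
    · rw [hδθ] at h
      simpa using h
  -- The short root φ = θ - δ is orthogonal to θ; together with δ they span a system of type B₂.
  set φ := R.reflectionPerm δ θ with hφ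
  have hφw : rootWt R φ = rootWt R θ - rootWt R δ := by
    rw [hφ, rootWt_reflectionPerm, hθδ, one_smul]
  have hψ : ∀ α, R.pairingIn ℤ α φ = R.pairingIn ℤ α θ - 2 * R.pairingIn ℤ α δ := by
    intro α
    rw [hφ, pairingIn_reflectionPerm_right, hδθ]
    ring
  have hφθ : R.pairingIn ℤ φ θ = 0 := by
    rw [hφ, pairingIn_reflectionPerm_left, hθδ, hδθ, RootPairing.pairingIn_same]
    norm_num
  have hθφ : R.pairingIn ℤ θ φ = 0 := by
    rw [hψ, hθδ, RootPairing.pairingIn_same]; norm_num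
  -- the roots with pairing one
  set A := Finset.univ.filter fun α : κ => R.pairingIn ℤ α θ = 1 with hA
  set B := Finset.univ.filter fun α : κ => α ≠ θ ∧ R.pairingIn ℤ α θ = 2 with hB
  have hsum : 2 * wp θ (rho b) = 2 + A.card + 2 * B.card := by
    rw [hθ.sum_pairingIn]
    have hun : Finset.univ.filter (fun i => 0 < R.pairingIn ℤ i θ) = insert θ (A ∪ B) := by
      ext α
      simp only [hA, hB, Finset.mem_filter, Finset.mem_univ, true_and, Finset.mem_insert,
        Finset.mem_union]
      constructor
      · intro h
        have := (hb α θ).2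
        by_cases hαθ : α = θ
        · exact Or.inl hαθ
        · right
          have : R.pairingIn ℤ α θ = 1 ∨ R.pairingIn ℤ α θ = 2 := by omega
          tauto
      · rintro (rfl | h | h)
        · rw [RootPairing.pairingIn_same]; norm_num
        · omega
        · omega
    have hdis : Disjoint A B := by
      rw [Finset.disjoint_left]
      intro α h1 h2
      simp only [hA, hB, Finset.mem_filter, Finset.mem_univ, true_and] at h1 h2
      omega
    have hnot : θ ∉ A ∪ B := by
      simp [hA, hB]
    rw [hun, Finset.sum_insert hnot, Finset.sum_union hdis, RootPairing.pairingIn_same,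
      Finset.sum_congr rfl (g := fun _ => (1 : ℤ)) (s₁ := A)
        (fun α hα => (Finset.mem_filter.1 hα).2),
      Finset.sum_congr rfl (g := fun _ => (2 : ℤ)) (s₁ := B)
        (fun α hα => (Finset.mem_filter.1 hα).2.2)]
    simp
    ring
  have hneg : ∀ α, rootWt R (R.reflectionPerm (R.reflectionPerm θ α) (R.reflectionPerm θ α)) =
      R.pairingIn ℤ α θ • rootWt R θ - rootWt R α := by
    intro α
    rw [rootWt_neg, rootWt_reflectionPerm]
    abel
  -- The map α ↦ 2θ - α, which is -s_θ on B, is an involution whose only possible fixed point θ is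
  -- excluded.
  have hBeven : Even B.card := by
    refine even_card_of_involution B
      (fun α => R.reflectionPerm (R.reflectionPerm θ α) (R.reflectionPerm θ α)) ?_ ?_ ?_
    · intro α hα
      simp only [hB, Finset.mem_filter, Finset.mem_univ, true_and] at hα ⊢
      refine ⟨fun h => hα.1 ?_, ?_⟩
      · have h1 := hneg α
        rw [h, hα.2] at h1
        apply rootWt_injective (R := R)
        rw [eq_sub_iff_add_eq] at h1
        rw [two_smul, add_right_inj] at h1
        exact h1
      · rw [← wp_rootWt, hneg, map_sub, map_zsmul, wp_rootWt, wp_rootWt, hα.2,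
          RootPairing.pairingIn_same]
        norm_num
    · intro α hα h
      simp only [hB, Finset.mem_filter, Finset.mem_univ, true_and] at hα
      have h1 := hneg α
      rw [h, hα.2] at h1
      apply hα.1
      apply rootWt_injective (R := R)
      have h2 : (2 : ℤ) • (rootWt R α - rootWt R θ) = 0 := by
        rw [smul_sub, sub_eq_zero, two_smul]
        nth_rewrite 2 [h1]
        abel
      have h3 : ((2 : ℤ) • (rootWt R α - rootWt R θ) : weightLattice R) = 0 := h2
      refine wp_ext b fun k => ?_
      have h4 := congrArg (wp (k : κ)) h3
      rw [map_zsmul, map_sub, map_zero, smul_eq_mul] at h4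
      omega
    · intro α hα
      simp only [hB, Finset.mem_filter, Finset.mem_univ, true_and] at hα
      apply rootWt_injective (R := R)
      rw [hneg, ← wp_rootWt, hneg, map_sub, map_zsmul, wp_rootWt, wp_rootWt, hα.2,
        RootPairing.pairingIn_same]
      norm_num
  -- The map u = -s_θ s_φ keeps the pairings with θ and φ on A, so it preserves each part of A with
  -- a given pairing with φ.
  set u : κ → κ := fun α => R.reflectionPerm (R.reflectionPerm θ (R.reflectionPerm φ α))
      (R.reflectionPerm θ (R.reflectionPerm φ α)) with hu
  have huw : ∀ α, R.pairingIn ℤ α θ = 1 → rootWt R (u α) =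
      rootWt R θ - rootWt R α + R.pairingIn ℤ α φ • rootWt R φ := by
    intro α hα
    rw [hu, hneg, pairingIn_reflectionPerm_left, hφθ, hα, rootWt_reflectionPerm]
    module
  have hpart : ∀ s : ℤ, Even (A.filter fun α => R.pairingIn ℤ α φ = s).card := by
    intro s
    have hθu : ∀ α, R.pairingIn ℤ α θ = 1 → R.pairingIn ℤ (u α) θ = 1 := by
      intro α hα
      rw [← wp_rootWt, huw α hα, map_add, map_sub, map_zsmul, wp_rootWt, wp_rootWt, wp_rootWt, hφθ,
        hα, RootPairing.pairingIn_same]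
      norm_num
    have hφu : ∀ α, R.pairingIn ℤ α θ = 1 → R.pairingIn ℤ (u α) φ = R.pairingIn ℤ α φ := by
      intro α hα
      rw [← wp_rootWt, huw α hα, map_add, map_sub, map_zsmul, wp_rootWt, wp_rootWt, wp_rootWt, hθφ,
        RootPairing.pairingIn_same, smul_eq_mul]
      ring
    refine even_card_of_involution _ u ?_ ?_ ?_
    · intro α hα
      simp only [hA, Finset.mem_filter, Finset.mem_univ, true_and] at hα ⊢
      exact ⟨hθu α hα.1, (hφu α hα.1).trans hα.2⟩
    · intro α hα h
      simp only [hA, Finset.mem_filter, Finset.mem_univ, true_and] at hα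
      have h1 := huw α hα.1
      rw [h] at h1
      have h2 : (2 : ℤ) • rootWt R α = rootWt R θ + R.pairingIn ℤ α φ • rootWt R φ := by
        rw [two_smul]
        nth_rewrite 1 [h1]
        abel
      have h3 := hψ α
      have h4 := hb α φ
      rw [hα.1] at h3
      -- The pairing with φ is odd and at most 2 in absolute value. A fixed point of u would make 2α
      -- equal to θ ± φ, which is the root 2θ - δ or δ; no root is twice another.
      have h5 : R.pairingIn ℤ α φ = 1 ∨ R.pairingIn ℤ α φ = -1 := by omega
      rcases h5 with h5 | h5
      · refine hdouble α (R.reflectionPerm (R.reflectionPerm θ δ) (R.reflectionPerm θ δ)) ?_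
        rw [h2, hneg, h5, hφw, hδθ]
        module
      · refine hdouble α δ ?_
        rw [h2, h5, hφw]
        module
    · intro α hα
      simp only [hA, Finset.mem_filter, Finset.mem_univ, true_and] at hα
      apply rootWt_injective (R := R)
      rw [huw _ (hθu α hα.1), hφu α hα.1, huw α hα.1]
      module
  -- Since φ is orthogonal to θ, s_φ exchanges the two parts of A on which the pairing with φ is 1
  -- and -1. They are equally large, and each is even by `hpart`.
  have hA4 : ∃ n : ℤ, (A.card : ℤ) = 4 * n := by
    have hAun : A = A.filter (fun α => R.pairingIn ℤ α φ = 1) ∪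
        A.filter (fun α => R.pairingIn ℤ α φ = -1) := by
      rw [← Finset.filter_or]
      refine (Finset.filter_true_of_mem fun α hα => ?_).symm
      have h1 := (Finset.mem_filter.1 hα).2
      have h3 := hψ α
      have h4 := hb α φ
      rw [h1] at h3
      omega
    have hcard : (A.filter (fun α => R.pairingIn ℤ α φ = 1)).card =
        (A.filter (fun α => R.pairingIn ℤ α φ = -1)).card := by
      have hm : ∀ s : ℤ, ∀ α ∈ A.filter (fun α => R.pairingIn ℤ α φ = s),
          R.reflectionPerm φ α ∈ A.filter (fun α => R.pairingIn ℤ α φ = -s) := by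
        intro s α hα
        simp only [hA, Finset.mem_filter, Finset.mem_univ, true_and] at hα ⊢
        rw [pairingIn_reflectionPerm_left α φ θ, pairingIn_reflectionPerm_left α φ φ, hφθ, hα.1,
          hα.2, RootPairing.pairingIn_same]
        constructor <;> ring
      refine Finset.card_bij' (fun α _ => R.reflectionPerm φ α) (fun α _ => R.reflectionPerm φ α)
        (hm 1) (fun α hα => by simpa using hm (-1) α hα) ?_ ?_ <;>
      · intro α _
        exact R.reflectionPerm_self φ α
    obtain ⟨n, hn⟩ := hpart (-1)
    refine ⟨n, ?_⟩
    rw [hAun, Finset.card_union_of_disjoint, hcard, hn]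
    · push_cast; ring
    · rw [Finset.disjoint_left]
      intro α h1 h2
      rw [Finset.mem_filter] at h1 h2
      omega
  obtain ⟨n, hn⟩ := hA4
  obtain ⟨m, hm⟩ := hBeven
  omega

end

section

variable {κ E E' : Type*} [Fintype κ] [AddCommGroup E] [Module ℝ E] [AddCommGroup E'] [Module ℝ E']
variable {R : RootPairing κ ℝ E E'}

variable [R.IsRootSystem] [R.IsCrystallographic] [R.IsReduced] {b : R.Base}

/-! ### Type G₂ and the prime 3 -/

theorem pairingIn_eq_one_iff_of_three [R.IsIrreducible] {δ θ : κ} (h : R.pairingIn ℤ δ θ = 3) :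
    ∃ s t, s ≠ t ∧ ∀ i, R.pairingIn ℤ i θ = 1 ↔ i = s ∨ i = t := by
  classical
  let _ := RootPairing.EmbeddedG2.ofPairingInThree R δ θ h
  have e1 : R.toLinearMap (RootPairing.EmbeddedG2.shortRoot R) (R.coroot θ) = 2 := by
    change R.toLinearMap (R.root θ) (R.coroot θ) = 2
    simp
  have e2 : R.toLinearMap (RootPairing.EmbeddedG2.longRoot R) (R.coroot θ) = -3 := 
    RootPairing.EmbeddedG2.pairing_long_short R
  have hp : ∀ i, R.pairingIn ℤ i θ = 1 ↔ R.toLinearMap (R.root i) (R.coroot θ) = 1 := by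
    intro i
    rw [RootPairing.root_coroot_eq_pairing, ← R.algebraMap_pairingIn ℤ]
    simp
  refine ⟨RootPairing.EmbeddedG2.twoShortAddLong R, R.reflectionPerm
    (RootPairing.EmbeddedG2.shortAddLong R) (RootPairing.EmbeddedG2.shortAddLong R), ?_, ?_⟩
  · intro h0
    have h1 := congrArg R.root h0
    have h2 := RootPairing.EmbeddedG2.linearIndependent_short_long R
    rw [LinearIndependent.pair_iff] at h2
    -- If the two roots coincided, then 2s + l = -(s + l), i.e. 3s + 2l = 0, for the short and long
    -- simple roots s and l.
    have h3 := h2 3 2 (by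
      have e3 : R.root (RootPairing.EmbeddedG2.twoShortAddLong R) = _ :=
        RootPairing.EmbeddedG2.twoShortAddLongRoot_eq R
      have e4 : R.root (RootPairing.EmbeddedG2.shortAddLong R) = _ := RootPairing.EmbeddedG2.shortAddLongRoot_eq R
      rw [e3] at h1
      simp only [RootPairing.root_reflectionPerm, RootPairing.reflection_apply_self] at h1
      rw [e4] at h1
      rw [← sub_eq_zero] at h1
      rw [← h1]
      module)
    norm_num at h3
  intro i
  rw [hp]
  constructor
  · intro hi
    have hm := RootPairing.EmbeddedG2.mem_allRoots R i
    have key : R.root i = RootPairing.EmbeddedG2.twoShortAddLongRoot R ∨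
        R.root i = - RootPairing.EmbeddedG2.shortAddLongRoot R := by
      generalize R.root i = x at hm hi
      simp only [RootPairing.EmbeddedG2.allRoots, List.mem_cons, List.not_mem_nil, or_false] at hm
      rcases hm with h | h | h | h | h | h | h | h | h | h | h | h
      all_goals first
        | exact Or.inl h
        | exact Or.inr h
        | exfalso
          rw [h] at hi
          simp only [RootPairing.EmbeddedG2.shortAddLongRoot_eq,
            RootPairing.EmbeddedG2.twoShortAddLongRoot_eq,
            RootPairing.EmbeddedG2.threeShortAddLongRoot_eq,
            RootPairing.EmbeddedG2.threeShortAddTwoLongRoot_eq, map_add, map_neg, map_smul,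
            LinearMap.add_apply, LinearMap.neg_apply, LinearMap.smul_apply, e1, e2] at hi
          norm_num at hi
    rcases key with h | h
    · exact Or.inl (R.root.injective h)
    · exact Or.inr (R.root.injective (by rw [h]; simp))
  · rintro (rfl | rfl)
    · have : R.root (RootPairing.EmbeddedG2.twoShortAddLong R) = _ :=
        RootPairing.EmbeddedG2.twoShortAddLongRoot_eq R
      rw [this]
      simp only [map_add, map_smul, LinearMap.add_apply, LinearMap.smul_apply, e1, e2]
      norm_num
    · have : R.root (RootPairing.EmbeddedG2.shortAddLong R) = _ :=
        RootPairing.EmbeddedG2.shortAddLongRoot_eq R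
      rw [RootPairing.root_reflectionPerm, RootPairing.reflection_apply_self, this]
      simp only [map_add, map_neg, LinearMap.add_apply, LinearMap.neg_apply, e1, e2]
      norm_num

/-- In 2(ρ, ϑ) the root θ contributes 2, exactly two roots contribute 1, and all others 3. So 2(ρ,
ϑ) ≡ 4 and N = 2 + (ρ, ϑ) ≡ 1 modulo 3. -/
theorem IsHighest.not_three_dvd [R.IsIrreducible] {θ : κ} (hθ : IsHighest b θ) {i j : κ}
    (hij : R.pairingIn ℤ i j = 3) : ¬ (3 : ℤ) ∣ 2 + wp θ (rho b) := by
  classical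
  have hG : R.IsG2 := (RootPairing.isG2_iff R).2
    ⟨R.reflectionPerm i i, j, by rw [RootPairing.pairingIn_reflectionPerm_self_left, hij]⟩
  have hG3 := fun i j => RootPairing.IsG2.pairingIn_mem_zero_one_three R i j
  obtain ⟨δ, hδ, hδ2⟩ := hθ.exists_two_le_pairingIn (i := i) (j := j) (by omega) (by
    rintro rfl
    rw [RootPairing.pairingIn_same] at hij
    omega)
  have hval : ∀ i, 0 < R.pairingIn ℤ i θ → i ≠ θ →
      R.pairingIn ℤ i θ = 1 ∨ R.pairingIn ℤ i θ = 3 := by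
    intro i hi hne
    have h1 := hG3 i θ (fun h => hne (R.root.injective h)) (fun h => by
        have : i = R.reflectionPerm θ θ := R.root.injective (by rw [h]; simp)
        rw [this, RootPairing.pairingIn_reflectionPerm_self_left, RootPairing.pairingIn_same] at hi
        omega)
    simp only [Set.mem_insert_iff, Set.mem_singleton_iff] at h1
    omega
  have hδ3 : R.pairingIn ℤ δ θ = 3 := by
    rcases hval δ (by omega) hδ with h | h <;> omega
  obtain ⟨s, t, hst, hiff⟩ := pairingIn_eq_one_iff_of_three hδ3
  have hs := (hiff s).2 (Or.inl rfl)
  have ht := (hiff t).2 (Or.inr rfl)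
  have hsθ : s ≠ θ := by
    rintro rfl
    rw [RootPairing.pairingIn_same] at hs
    omega
  have htθ : t ≠ θ := by
    rintro rfl
    rw [RootPairing.pairingIn_same] at ht
    omega
  have hsum := hθ.sum_pairingIn
  set F := Finset.univ.filter fun i => 0 < R.pairingIn ℤ i θ with hF
  have hsub : ({θ, s, t} : Finset κ) ⊆ F := by
    intro i hi
    simp only [Finset.mem_insert, Finset.mem_singleton] at hi
    rw [hF, Finset.mem_filter]
    refine ⟨Finset.mem_univ _, ?_⟩
    rcases hi with rfl | rfl | rfl
    · rw [RootPairing.pairingIn_same]; norm_num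
    · omega
    · omega
  rw [← Finset.sum_sdiff hsub] at hsum
  have h3 : (3 : ℤ) ∣ ∑ i ∈ F \ {θ, s, t}, R.pairingIn ℤ i θ := by
    refine Finset.dvd_sum fun i hi => ?_
    simp only [hF, Finset.mem_sdiff, Finset.mem_filter, Finset.mem_univ, true_and,
      Finset.mem_insert, Finset.mem_singleton, not_or] at hi
    rcases hval i hi.1 hi.2.1 with h | h
    · rcases (hiff i).1 h with h | h
      · exact absurd h hi.2.2.1
      · exact absurd h hi.2.2.2
    · rw [h]
  rw [Finset.sum_insert (by simp [hsθ.symm, htθ.symm]), Finset.sum_insert (by simpa using hst),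
    Finset.sum_singleton, RootPairing.pairingIn_same, hs, ht] at hsum
  omega

/-! ### Squared lengths of roots, and nondegeneracy of the form modulo N -/

theorem rootForm_mul_pairingIn (i j : κ) :
    R.RootForm (R.root j) (R.root j) * R.pairingIn ℤ i j =
      R.RootForm (R.root i) (R.root i) * R.pairingIn ℤ j i := by
  have h1 := rootForm_root (R := R) j (R.root i)
  have h2 := rootForm_root (R := R) i (R.root j)
  rw [RootPairing.root_coroot_eq_pairing, ← R.algebraMap_pairingIn ℤ] at h1 h2
  have h3 : R.RootForm (R.root i) (R.root j) = R.RootForm (R.root j) (R.root i) :=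
    R.rootForm_symmetric.eq _ _
  simp only [eq_intCast] at h1 h2
  linarith

theorem IsHighest.exists_rootForm_eq [R.IsIrreducible] {θ : κ} (hθ : IsHighest b θ) (k : κ) :
    ∃ ν : ℤ, R.RootForm (R.root k) (R.root k) = ν * shortSq R ∧
      IsCoprime ν (2 + wp θ (rho b)) := by
  have : Nonempty κ := ⟨θ⟩
  obtain ⟨i, hi⟩ := exists_eq_ciInf_of_finite (f := fun i => R.RootForm (R.root i) (R.root i))
  replace hi : R.RootForm (R.root i) (R.root i) = shortSq R := hi
  have hle : ∀ j, shortSq R ≤ R.RootForm (R.root j) (R.root j) := fun j =>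
    ciInf_le (f := fun i => R.RootForm (R.root i) (R.root i)) (Set.finite_range _).bddBelow j
  have hpos : 0 < shortSq R := hi ▸ rootForm_root_pos i
  -- A conjugate of α_k, of the same length, that is not orthogonal to the shortest root α_i: the
  -- pair of Cartan integers then gives the length ratio, and the cases with α_i longer are
  -- impossible.
  obtain ⟨w, hw⟩ := exists_smul_pairingIn_ne_zero (R := R) k i
  have hwk : R.RootForm (R.root (w • k)) (R.root (w • k)) = R.RootForm (R.root k) (R.root k) := by
    have : R.root (w • k) = w • R.root k := congrArg Subtype.val (rootWt_smul w k)
    rw [this, rootForm_weyl]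
  rw [← hwk]
  generalize w • k = j at hw
  have hm := rootForm_mul_pairingIn (R := R) i j
  rw [hi] at hm
  have hone : ∀ {n : ℤ} (hn : n = 1 ∨ n = -1) (m : ℤ), R.pairingIn ℤ i j = n → 
      R.pairingIn ℤ j i = m * n → R.RootForm (R.root j) (R.root j) = m * shortSq R := by
    intro n hn m h1 h2
    rw [h1, h2] at hm
    rcases hn with rfl | rfl <;> push_cast at hm <;> linarith
  have htwo : Prime (2 : ℤ) := Int.prime_two
  have hthree : Prime (3 : ℤ) := Int.prime_three
  rcases pairingIn_cases (R := R) i j with h | h | h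
  · exact ⟨1, by rw [← h, hi]; simp, isCoprime_one_left⟩
  · refine ⟨1, ?_, isCoprime_one_left⟩
    rw [h] at hi
    simpa using hi
  have hl := hle j
  have c2 : ∀ {i j : κ}, R.pairingIn ℤ i j = 2 → R.pairingIn ℤ j i = 1 →
      IsCoprime 2 (2 + wp θ (rho b)) := fun h1 h2 => 
    (htwo.coprime_iff_not_dvd).2 (hθ.not_two_dvd h1 (by
      rintro rfl
      omega))
  have c3 : ∀ {i j : κ}, R.pairingIn ℤ i j = 3 → 
      IsCoprime 3 (2 + wp θ (rho b)) := fun h1 => 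
    (hthree.coprime_iff_not_dvd).2 (hθ.not_three_dvd h1)
  simp only [Set.mem_insert_iff, Prod.mk.injEq, Set.mem_singleton_iff] at h
  rcases h with ⟨h1, h2⟩ | ⟨h1, h2⟩ | ⟨h1, h2⟩ | ⟨h1, h2⟩ | ⟨h1, h2⟩ | ⟨h1, h2⟩ | ⟨h1, h2⟩ |
    ⟨h1, h2⟩ | ⟨h1, h2⟩ | ⟨h1, h2⟩ | ⟨h1, h2⟩
  · exact absurd h2 hw
  · exact ⟨1, hone (Or.inl rfl) 1 h1 h2, isCoprime_one_left⟩
  · exact ⟨1, hone (Or.inr rfl) 1 h1 h2, isCoprime_one_left⟩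
  · exact ⟨2, hone (Or.inl rfl) 2 h1 h2, c2 h2 h1⟩
  · rw [h1, h2] at hm
    push_cast at hm
    linarith
  · exact ⟨2, hone (Or.inr rfl) 2 h1 h2, c2 (i := R.reflectionPerm j j) (j := i)
      (by rw [RootPairing.pairingIn_reflectionPerm_self_left, h2]; rfl)
      (by rw [RootPairing.pairingIn_reflectionPerm_self_right, h1]; rfl)⟩
  · rw [h1, h2] at hm
    push_cast at hm
    linarith
  · exact ⟨3, hone (Or.inl rfl) 3 h1 h2, c3 h2⟩
  · rw [h1, h2] at hm
    push_cast at hm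
    linarith
  · exact ⟨3, hone (Or.inr rfl) 3 h1 h2, c3 (i := R.reflectionPerm j j) (j := i)
      (by rw [RootPairing.pairingIn_reflectionPerm_self_left, h2]; rfl)⟩
  · rw [h1, h2] at hm
    push_cast at hm
    linarith

/-- The scaled form is nondegenerate modulo `N`, when `formDenom R` is prime to `N`. -/
theorem IsHighest.mem_multiples_of_dvd_scaledForm [R.IsIrreducible] {θ : κ} (hθ : IsHighest b θ)
    {N : ℕ} (hN : (N : ℤ) = 2 + wp θ (rho b)) (hm : Nat.Coprime (formDenom R) N)
    {a : weightLattice R} (ha : ∀ c, (N : ℤ) ∣ scaledForm R a c) : a ∈ multiples R N := by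
  have key : ∀ k : b.support, (N : ℤ) ∣ wp (k : κ) a := by
    intro k
    obtain ⟨ν, hν, hc⟩ := hθ.exists_rootForm_eq (k : κ)
    rw [← hN] at hc
    -- In the normalized form (α_k, α_k) = 2ν, so (a, α_k) = ν(a, α_k^∨).
    have h1 : scaledForm R a (rootWt R k) = formDenom R * (ν * wp (k : κ) a) := by
      have h2 : (scaledForm R a (rootWt R k) : ℝ) = formDenom R * (ν * wp (k : κ) a) := by
        have h3 := rootForm_root (R := R) (k : κ) (a : E)
        have hpos : shortSq R ≠ 0 := by
          intro h0
          rw [h0, mul_zero] at hν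
          exact (rootForm_root_pos (R := R) (k : κ)).ne' hν
        rw [scaledForm_cast, normForm, wp_cast]
        change _ * (_ * R.RootForm (a : E) (R.root k)) = _
        rw [hν] at h3
        have h4 : R.RootForm (a : E) (R.root k) =
          R.toLinearMap (a : E) (R.coroot k) * (ν * shortSq R) / 2 := by linarith
        rw [h4]
        field_simp
      exact_mod_cast h2
    have h2 := ha (rootWt R k)
    rw [h1] at h2
    exact hc.symm.dvd_of_dvd_mul_left
      ((Nat.isCoprime_iff_coprime.2 hm).symm.dvd_of_dvd_mul_left h2)
  choose f hf using key
  refine ⟨∑ k, f k • fw b k, wp_ext b fun k => ?_⟩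
  change wp (k : κ) (N • _) = _
  rw [map_nsmul, wp_sum_fw, hf]
  simp

end

section

variable {κ E E' : Type*} [Fintype κ] [AddCommGroup E] [Module ℝ E] [AddCommGroup E'] [Module ℝ E']
variable {R : RootPairing κ ℝ E E'}

variable {K : Type*} [Field K]

/-! ### The sign character -/

theorem sgn_one : sgn K (1 : R.weylGroup) = 1 := by
  simp [sgn]

theorem sgn_mul (w v : R.weylGroup) : sgn K (w * v) = sgn K w * sgn K v := by
  simp [sgn, sign_mul]

/-- A reflection is the transvection x ↦ x - (x, α^∨)α, with determinant 1 - (α, α^∨) = -1. -/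
theorem sgn_refl [R.IsRootSystem] (i : κ) : sgn K (refl R i) = -1 := by
  have : Module.Finite ℝ E :=
    ⟨RootPairing.IsRootSystem.span_root_eq_top (P := R) ▸ Submodule.fg_span (Set.finite_range _)⟩
  have h : R.weylGroupRootRep (refl R i) =
      LinearMap.transvection (-R.coroot' i) (R.root i) := by
    ext x
    change refl R i • x = _
    simp [LinearMap.transvection.apply, RootPairing.reflection_apply, sub_eq_add_neg]
  rw [sgn, h, LinearMap.transvection.det]
  norm_num

theorem sgn_mul_self (w : R.weylGroup) : sgn K w * sgn K w = 1 := by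
  have h1 : LinearMap.det (R.weylGroupRootRep w) ≠ 0 := fun h => by
    have h2 : R.weylGroupRootRep w * R.weylGroupRootRep w⁻¹ = 1 := by
      rw [← map_mul, mul_inv_cancel, map_one]
    have h3 := congrArg LinearMap.det h2
    rw [map_mul, h, zero_mul, map_one] at h3
    exact zero_ne_one h3
  rcases lt_or_gt_of_ne h1 with h | h <;> simp [sgn, sign_neg, sign_pos, h]

theorem sgn_ne_zero (w : R.weylGroup) : sgn K w ≠ 0 := fun h => by
  have := sgn_mul_self (K := K) w
  simp [h] at this

/-! ### `W` acts on Laurent polynomials by ring automorphisms -/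

theorem opT_mul (w : R.weylGroup) (f g : Poly K R) : opT w (f * g) = opT w f * opT w g :=
  AddMonoidAlgebra.mapDomain_mul (DistribSMul.toAddMonoidHom (weightLattice R) w) f g

theorem opT_one (w : R.weylGroup) : opT w (1 : Poly K R) = 1 := by
  rw [AddMonoidAlgebra.one_def, opT_single, smul_zero]

theorem opT_prod {ι : Type*} (w : R.weylGroup) (s : Finset ι) (f : ι → Poly K R) :
    opT w (∏ i ∈ s, f i) = ∏ i ∈ s, opT w (f i) := by
  classical
  induction s using Finset.induction_on with
  | empty => simp [opT_one]
  | insert i s hi ih => rw [Finset.prod_insert hi, Finset.prod_insert hi, opT_mul, ih]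

theorem opT_one_apply (f : Poly K R) : opT (1 : R.weylGroup) f = f := by
  have : opT (1 : R.weylGroup) = (1 : Module.End K (Poly K R)) :=
    end_ext fun c r => by simp [opT_single]
  rw [this]; rfl

theorem opT_mul_apply (w v : R.weylGroup) (f : Poly K R) : opT (w * v) f = opT w (opT v f) := by
  have : opT (w * v) = (opT w * opT v : Module.End K (Poly K R)) :=
    end_ext fun c r => by simp [opT_single, mul_smul]
  rw [this]; rfl

theorem coeff_opT (w : R.weylGroup) (f : Poly K R) (x : weightLattice R) :
    (opT w f).coeff (w • x) = f.coeff x := by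
  have := Finsupp.mapDomain_apply (MulAction.injective (β := weightLattice R) w) f.coeff x
  exact this

theorem T_smul_eq [R.IsCrystallographic] (ζ : Kˣ) (w : R.weylGroup) (f : Poly K R) :
    T ζ w • f = opT w f := by
  induction f using AddMonoidAlgebra.induction_linear with
  | zero => simp
  | add x y hx hy => rw [smul_add, hx, hy, map_add]
  | single c r => rw [T_smul_single, opT_single]

/-! ### The denominator formula -/

variable [R.IsRootSystem] [R.IsCrystallographic] [R.IsReduced] (b : R.Base)

theorem delta_eq : delta K b = AddMonoidAlgebra.single (rho b) 1 *
    ∏ i ∈ posRoots b, (1 - AddMonoidAlgebra.single (-rootWt R i) 1) := rfl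

/-- The factors of the positive roots other than α_k are permuted by s_k. The remaining factor X_ρ(1
- X_{-α_k}) is X_ρ - X_{ρ-α_k}, whose two terms are exchanged because s_k ρ = ρ - α_k. -/
theorem opT_simple_delta (k : b.support) : opT (refl R (k : κ)) (delta K b) = - delta K b := by
  classical
  have hk : (k : κ) ∈ posRoots b := by
    rw [mem_posRoots, wp_rho_simple]
    norm_num
  have hperm : ∏ i ∈ (posRoots b).erase k,
      opT (refl R (k : κ)) (1 - AddMonoidAlgebra.single (-rootWt R i) 1 : Poly K R) =
      ∏ i ∈ (posRoots b).erase k, (1 - AddMonoidAlgebra.single (-rootWt R i) 1) := by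
    have hmem : ∀ i ∈ (posRoots b).erase k, refl R (k : κ) • i ∈ (posRoots b).erase k := by
      intro i hi
      rw [Finset.mem_erase, mem_posRoots] at hi ⊢
      refine ⟨?_, refl_smul_pos b hi.2 k hi.1⟩
      intro h0
      have h1 := refl_smul_pos b hi.2 k hi.1
      have h2 : i = R.reflectionPerm k k := by
        rw [← refl_smul_idx, ← inv_smul_eq_iff, refl_inv, h0]
      have h3 := hi.2
      rw [h2, wp_refl_self, wp_rho_simple] at h3
      omega
    refine Finset.prod_nbij' (fun i => refl R (k : κ) • i) (fun i => refl R (k : κ) • i) hmem hmem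
      ?_ ?_ ?_
    · intro i _
      simp only [← mul_smul, refl_mul_self, one_smul]
    · intro i _
      simp only [← mul_smul, refl_mul_self, one_smul]
    · intro i _
      rw [map_sub, opT_one, opT_single, rootWt_smul, smul_neg]
  have hfac : opT (refl R (k : κ)) (AddMonoidAlgebra.single (rho b) 1 : Poly K R) *
      opT (refl R (k : κ)) (1 - AddMonoidAlgebra.single (-rootWt R (k : κ)) 1) =
      - (AddMonoidAlgebra.single (rho b) 1 *
        (1 - AddMonoidAlgebra.single (-rootWt R (k : κ)) 1)) := by
    rw [map_sub, opT_one, opT_single, opT_single, smul_neg, refl_smul, refl_smul, wp_rho_simple,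
      wp_rootWt, RootPairing.pairingIn_same, mul_sub, mul_sub, mul_one, mul_one,
      AddMonoidAlgebra.single_mul_single, AddMonoidAlgebra.single_mul_single, neg_sub, neg_sub, mul_one]
    congr 2 <;> module
  rw [delta_eq, opT_mul, opT_prod, ← Finset.mul_prod_erase _ _ hk, hperm, ← mul_assoc, hfac,
    ← Finset.mul_prod_erase (posRoots b) (fun i => 1 - AddMonoidAlgebra.single (-rootWt R i) 1) hk,
    neg_mul, mul_assoc]

theorem opT_delta (w : R.weylGroup) : opT w (delta K b) = sgn K w • delta K b := by
  obtain ⟨l, rfl⟩ := exists_word b w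
  induction l with
  | nil => rw [word_nil, opT_one_apply, sgn_one, one_smul]
  | cons k l ih =>
    rw [word_cons, opT_mul_apply, ih, map_smul, opT_simple_delta, sgn_mul, sgn_refl]
    simp

/-- The Laurent polynomials whose monomials all have smaller scalar product with `ρ` than `t`. -/
def lowerPart (K : Type*) [Field K] (b : R.Base) (t : ℝ) : Submodule K (Poly K R) where
  carrier := {f | ∀ x : weightLattice R, t ≤ R.RootForm (rho b : E) (x : E) → f.coeff x = 0}
  zero_mem' := fun _ _ => rfl
  add_mem' := fun hf hg x hx => by
    rw [AddMonoidAlgebra.coeff_add, Finsupp.add_apply, hf x hx, hg x hx, add_zero]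
  smul_mem' := fun c f hf x hx => by
    rw [AddMonoidAlgebra.coeff_smul, Finsupp.smul_apply, hf x hx, smul_zero]

theorem single_mul_mem_lowerPart {f : Poly K R} {t : ℝ} (hf : f ∈ lowerPart K b t)
    (a : weightLattice R) :
    AddMonoidAlgebra.single a 1 * f ∈
      lowerPart K b (R.RootForm (rho b : E) (a : E) + t) := by
  intro x hx
  rw [AddMonoidAlgebra.coeff_single_mul_apply, one_mul]
  apply hf
  rw [AddSubgroup.coe_add, map_add, AddSubgroup.coe_neg, map_neg]
  linarith

theorem lowerPart_mono {s t : ℝ} (h : s ≤ t) : lowerPart K b s ≤ lowerPart K b t :=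
  fun _ hf x hx => hf x (h.trans hx)

theorem rootForm_rho_pos {i : κ} (hi : i ∈ posRoots b) :
    0 < R.RootForm (rho b : E) (rootWt R i : E) := by
  have h1 := rootForm_rho_root b i
  have h2 := rootForm_root_pos (R := R) i
  rw [mem_posRoots] at hi
  have h3 : (0 : ℝ) < wp i (rho b) := by exact_mod_cast hi
  have h4 := mul_pos h3 h2
  change 0 < R.RootForm (rho b : E) (R.root i)
  linarith

theorem prod_sub_one_mem_lowerPart (s : Finset κ) (hs : s ⊆ posRoots b) :
    ∏ i ∈ s, (1 - AddMonoidAlgebra.single (-rootWt R i) 1 : Poly K R) - 1 ∈ lowerPart K b 0 := by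
  classical
  induction s using Finset.induction_on with
  | empty => simp
  | insert i s hi ih =>
    have ih' := ih ((Finset.subset_insert i s).trans hs)
    have hpos := rootForm_rho_pos b (hs (Finset.mem_insert_self i s))
    rw [Finset.prod_insert hi]
    have h1 : (AddMonoidAlgebra.single (-rootWt R i) 1 : Poly K R) ∈ lowerPart K b 0 := by
      intro x hx
      rw [AddMonoidAlgebra.coeff_single, Finsupp.single_apply, if_neg]
      rintro rfl
      rw [AddSubgroup.coe_neg, map_neg] at hx
      linarith
    have h2 := lowerPart_mono b
      (show R.RootForm (rho b : E) ((-rootWt R i : weightLattice R) : E) + 0 ≤ 0 by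
        rw [AddSubgroup.coe_neg, map_neg]; linarith)
      (single_mul_mem_lowerPart b ih' (-rootWt R i))
    convert (lowerPart K b 0).sub_mem ((lowerPart K b 0).sub_mem ih' h1) h2 using 1
    ring

theorem delta_sub_mem_lowerPart : delta K b - AddMonoidAlgebra.single (rho b) 1 ∈
    lowerPart K b (R.RootForm (rho b : E) (rho b : E)) := by
  have h := single_mul_mem_lowerPart b
    (prod_sub_one_mem_lowerPart (K := K) b _ (Finset.Subset.refl _)) (rho b)
  rw [add_zero, mul_sub, mul_one] at h
  exact h

theorem coeff_delta_rho : (delta K b).coeff (rho b) = 1 := by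
  have h := delta_sub_mem_lowerPart (K := K) b (rho b) le_rfl
  rw [AddMonoidAlgebra.coeff_sub, Finsupp.sub_apply, AddMonoidAlgebra.coeff_single,
    Finsupp.single_eq_same, sub_eq_zero] at h
  exact h

theorem coeff_smul_of_antisymm {f : Poly K R} (hf : ∀ w : R.weylGroup, opT w f = sgn K w • f)
    (w : R.weylGroup) (x : weightLattice R) : f.coeff (w • x) = sgn K w * f.coeff x := by
  have h := coeff_opT w f x
  rw [hf, AddMonoidAlgebra.coeff_smul, Finsupp.smul_apply, smul_eq_mul] at h
  rw [← h, ← mul_assoc, sgn_mul_self, one_mul]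

/-- As y - ρ is dominant, (ρ, y - ρ) is a sum over all roots of products of numbers of equal sign.
If the sum is not positive, every product vanishes. -/
theorem eq_rho_of_dominant {y : weightLattice R} (hy : ∀ k : b.support, 1 ≤ wp (k : κ) y)
    (hle : R.RootForm (rho b : E) (y : E) ≤ R.RootForm (rho b : E) (rho b : E)) : y = rho b := by
  have hdom : ∀ i, 0 ≤ wp i (rho b) * wp i (y - rho b) := by
    have h0 : ∀ i, 0 < wp i (rho b) → 0 ≤ wp i (y - rho b) := fun i hi =>
      wp_nonneg_of_dominant b hi fun k => by
        rw [map_sub, wp_rho_simple]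
        linarith [hy k]
    intro i
    rcases lt_or_gt_of_ne (wp_rho_ne_zero b i) with h | h
    · have := h0 (R.reflectionPerm i i) (by rw [wp_refl_self]; omega)
      rw [wp_refl_self] at this
      nlinarith
    · exact mul_nonneg h.le (h0 i h)
  have hsum : R.RootForm (rho b : E) ((y - rho b : weightLattice R) : E) =
      ((∑ i, wp i (rho b) * wp i (y - rho b) : ℤ) : ℝ) := by
    rw [RootPairing.rootForm_apply_apply]
    push_cast
    refine Finset.sum_congr rfl fun i _ => ?_
    rw [wp_cast, wp_cast]
    rfl
  have h1 : R.RootForm (rho b : E) ((y - rho b : weightLattice R) : E) ≤ 0 := by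
    rw [AddSubgroup.coe_sub, map_sub]
    linarith
  rw [hsum] at h1
  have h2 : ∑ i, wp i (rho b) * wp i (y - rho b) = 0 :=
    le_antisymm (by exact_mod_cast h1) (Finset.sum_nonneg fun i _ => hdom i)
  rw [Finset.sum_eq_zero_iff_of_nonneg fun i _ => hdom i] at h2
  rw [← sub_eq_zero]
  refine wp_ext b fun k => ?_
  have h3 := h2 k (Finset.mem_univ _)
  rw [wp_rho_simple, one_mul] at h3
  rw [h3, map_zero]

/-- By antisymmetry a monomial occurring in Δ is fixed by no reflection, so its orbit contains a
strictly dominant weight. The leading term of Δ being X_ρ, that weight is not above ρ, hence equals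
ρ. -/
theorem exists_of_coeff_delta_ne_zero [CharZero K] {x : weightLattice R}
    (hx : (delta K b).coeff x ≠ 0) : ∃ w : R.weylGroup, x = w • rho b := by
  classical
  have hanti := coeff_smul_of_antisymm (opT_delta (K := K) b)
  have horb : ∀ y ∈ MulAction.orbit R.weylGroup x, (delta K b).coeff y ≠ 0 := by
    rintro _ ⟨w, rfl⟩
    change (delta K b).coeff (w • x) ≠ 0
    rw [hanti]
    exact mul_ne_zero (sgn_ne_zero w) hx
  obtain ⟨y, ⟨w, hw⟩, hdom⟩ := exists_strictly_dominant (b := b) (MulAction.orbit R.weylGroup x)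
    ⟨x, MulAction.mem_orbit_self x⟩
    (fun y hy i => MulAction.mem_orbit_of_mem_orbit _ hy)
    (fun y hy i h0 => by
      have h1 := hanti (refl R i) y
      rw [refl_smul, h0, zero_smul, sub_zero, sgn_refl] at h1
      have h2 := horb y hy
      apply h2
      linear_combination h1 / 2)
  have hy := horb y ⟨w, hw⟩
  have hyρ : y = rho b := by
    refine eq_rho_of_dominant b hdom ?_
    by_contra! h
    have h1 := delta_sub_mem_lowerPart (K := K) b y h.le
    rw [AddMonoidAlgebra.coeff_sub, Finsupp.sub_apply, AddMonoidAlgebra.coeff_single,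
      Finsupp.single_apply, if_neg, sub_zero] at h1
    · exact hy h1
    · rintro rfl
      exact lt_irrefl _ h
  refine ⟨w⁻¹, ?_⟩
  rw [← hyρ, ← hw]
  exact (inv_smul_smul w x).symm

/-- The denominator formula. -/
theorem delta_eq_sum [CharZero K] [Fintype R.weylGroup] :
    delta K b = ∑ w : R.weylGroup, AddMonoidAlgebra.single (w • rho b) (sgn K w) := by
  classical
  refine AddMonoidAlgebra.ext (Finsupp.ext fun x => ?_)
  rw [AddMonoidAlgebra.coeff_sum, Finsupp.finsetSum_apply]
  simp only [AddMonoidAlgebra.coeff_single, Finsupp.single_apply]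
  by_cases hx : ∃ w : R.weylGroup, x = w • rho b
  · obtain ⟨w, rfl⟩ := hx
    rw [coeff_smul_of_antisymm (opT_delta (K := K) b), coeff_delta_rho, mul_one,
      Finset.sum_eq_single w, if_pos rfl]
    · intro v _ hv
      rw [if_neg]
      intro h
      apply hv
      have : w⁻¹ * v = 1 := eq_one_of_smul_rho b (by rw [mul_smul, h, inv_smul_smul])
      exact (inv_mul_eq_one.1 this).symm
    · intro h
      exact absurd (Finset.mem_univ w) h
  · rw [Finset.sum_eq_zero]
    · by_contra h
      exact hx (exists_of_coeff_delta_ne_zero b h)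
    · intro w _
      rw [if_neg]
      rintro rfl
      exact hx ⟨w, rfl⟩

end

section

variable {κ E E' : Type*} [Fintype κ] [AddCommGroup E] [Module ℝ E] [AddCommGroup E'] [Module ℝ E']
variable {R : RootPairing κ ℝ E E'}

variable {K : Type*} [Field K]

/-! ### The finite group `P / N P` -/

theorem mk_smul_weight (N : ℕ) (w : R.weylGroup) (x : weightLattice R) :
    (QuotientAddGroup.mk (w • x) : WeightQuot R N) = w • (QuotientAddGroup.mk x) := rfl

theorem mk_eq_mk_iff {N : ℕ} {x y : weightLattice R} :
    (QuotientAddGroup.mk x : WeightQuot R N) = QuotientAddGroup.mk y ↔ ∃ p, y = x + N • p := by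
  rw [QuotientAddGroup.eq]
  constructor
  · rintro ⟨p, hp⟩
    refine ⟨p, ?_⟩
    change N • p = _ at hp
    rw [hp]; abel
  · rintro ⟨p, rfl⟩
    refine ⟨p, ?_⟩
    change N • p = _
    abel

theorem exists_out_eq {N : ℕ} (x : weightLattice R) :
    ∃ p, x = (QuotientAddGroup.mk x : WeightQuot R N).out + N • p :=
  mk_eq_mk_iff.1 (Quotient.out_eq _)

/-- The coordinates modulo `N` with respect to the fundamental weights. -/
def weightCoord [R.IsRootSystem] (b : R.Base) (N : ℕ) :
    weightLattice R →+ (b.support → ZMod N) :=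
  AddMonoidHom.pi fun k => (Int.castAddHom (ZMod N)).comp (wp (k : κ))

theorem weightCoord_surjective [R.IsRootSystem] (b : R.Base) (N : ℕ) :
    Function.Surjective (weightCoord b N) := by
  intro f
  refine ⟨∑ k, (ZMod.cast (f k) : ℤ) • fw b k, funext fun k => ?_⟩
  change ((wp (k : κ) _ : ℤ) : ZMod N) = f k
  rw [wp_sum_fw]
  simp

theorem weightCoord_ker [R.IsRootSystem] (b : R.Base) (N : ℕ) :
    (weightCoord b N).ker = multiples R N := by
  ext x
  rw [AddMonoidHom.mem_ker]
  constructor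
  · intro h
    have key : ∀ k : b.support, (N : ℤ) ∣ wp (k : κ) x := fun k =>
      (ZMod.intCast_zmod_eq_zero_iff_dvd _ _).1 (congrFun h k)
    choose f hf using key
    refine ⟨∑ k, f k • fw b k, wp_ext b fun k => ?_⟩
    change wp (k : κ) (N • _) = _
    rw [map_nsmul, wp_sum_fw, hf]
    simp
  · rintro ⟨p, rfl⟩
    change weightCoord b N (N • p) = 0
    rw [map_nsmul]
    ext k
    simp

/-- `P / N P` in coordinates. -/
def weightQuotEquiv [R.IsRootSystem] (b : R.Base) (N : ℕ) :
    WeightQuot R N ≃+ (b.support → ZMod N) :=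
  (QuotientAddGroup.quotientAddEquivOfEq (weightCoord_ker b N).symm).trans
    (QuotientAddGroup.quotientKerEquivOfSurjective _ (weightCoord_surjective b N))

theorem finite_weightQuot [R.IsRootSystem] (b : R.Base) (N : ℕ) [NeZero N] :
    Finite (WeightQuot R N) :=
  Finite.of_equiv _ (weightQuotEquiv b N).toEquiv.symm

theorem card_weightQuot [R.IsRootSystem] (b : R.Base) (N : ℕ) [NeZero N] :
    Nat.card (WeightQuot R N) = N ^ Module.finrank ℝ E := by
  rw [Nat.card_congr (weightQuotEquiv b N).toEquiv, Module.finrank_eq_card_basis b.toWeightBasis]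
  simp [Nat.card_fun]

/-! ### Powers of `q` -/

section qPow

variable [R.IsCrystallographic]

theorem scaledForm_symm (a c : weightLattice R) : scaledForm R a c = scaledForm R c a := by
  simp only [scaledForm, normForm]
  rw [R.rootForm_symmetric.eq (a : E) (c : E) |>.symm]
  rfl

theorem qPow_symm (ζ : Kˣ) (a c : weightLattice R) : qPow ζ a c = qPow ζ c a := by
  rw [qPow, qPow, scaledForm_symm]

theorem qPow_add_left (ζ : Kˣ) (a a' c : weightLattice R) :
    qPow ζ (a + a') c = qPow ζ a c * qPow ζ a' c := by
  rw [qPow, scaledForm_add_left, zpow_add, qPow, qPow]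

theorem qPow_add_right (ζ : Kˣ) (a c c' : weightLattice R) :
    qPow ζ a (c + c') = qPow ζ a c * qPow ζ a c' := by
  rw [qPow, scaledForm_add_right, zpow_add, qPow, qPow]

theorem qPow_zero_left (ζ : Kˣ) (c : weightLattice R) : qPow ζ 0 c = 1 := by
  rw [qPow, scaledForm_zero_left, zpow_zero]

theorem qPow_neg_left (ζ : Kˣ) (a c : weightLattice R) : qPow ζ (-a) c = (qPow ζ a c)⁻¹ := by
  rw [eq_inv_iff_mul_eq_one, ← qPow_add_left, neg_add_cancel, qPow_zero_left]

variable {N : ℕ} (ζ : rootsOfUnity N K)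

theorem qPow_nsmul_left (a c : weightLattice R) : qPow (ζ : Kˣ) (N • a) c = 1 := by
  have h : ∀ n : ℕ, qPow (ζ : Kˣ) (n • a) c = qPow (ζ : Kˣ) a c ^ n := by
    intro n
    induction n with
    | zero => rw [zero_smul, qPow_zero_left, pow_zero]
    | succ n ih => rw [succ_nsmul, qPow_add_left, ih, pow_succ]
  rw [h, qPow, ← zpow_natCast, zpow_comm, zpow_natCast, (mem_rootsOfUnity N _).1 ζ.2, one_zpow]

theorem qPow_nsmul_right (a c : weightLattice R) : qPow (ζ : Kˣ) a (N • c) = 1 := by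
  rw [qPow_symm, qPow_nsmul_left]

theorem qPow_out_right (a c : weightLattice R) :
    qPow (ζ : Kˣ) a (QuotientAddGroup.mk c : WeightQuot R N).out = qPow (ζ : Kˣ) a c := by
  obtain ⟨p, hp⟩ := exists_out_eq (N := N) c
  conv_rhs => rw [hp, qPow_add_right, qPow_nsmul_right, mul_one]

theorem qPow_out_left (a c : weightLattice R) :
    qPow (ζ : Kˣ) (QuotientAddGroup.mk a : WeightQuot R N).out c = qPow (ζ : Kˣ) a c := by
  rw [qPow_symm, qPow_out_right, qPow_symm]

/-- The form is nondegenerate modulo `N`. -/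
def IsNondeg (R : RootPairing κ ℝ E E') (ζ : rootsOfUnity N K) : Prop :=
  ∀ a : weightLattice R, (∀ c : weightLattice R, qPow (ζ : Kˣ) a c = 1) → a ∈ multiples R N

open Classical in
theorem IsNondeg.sum_qPow [Fintype (WeightQuot R N)] {ζ : rootsOfUnity N K} (h : IsNondeg R ζ)
    (a : weightLattice R) :
    ∑ β : WeightQuot R N, (qPow (ζ : Kˣ) a β.out : K) =
      if a ∈ multiples R N then (Fintype.card (WeightQuot R N) : K) else 0 := by
  split_ifs with ha
  · obtain ⟨p, rfl⟩ := ha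
    rw [Finset.sum_congr rfl (g := fun _ => (1 : K))]
    · simp
    · intro β _
      change (qPow (ζ : Kˣ) (N • p) β.out : K) = 1
      rw [qPow_nsmul_left]; rfl
  · obtain ⟨c, hc⟩ : ∃ c, qPow (ζ : Kˣ) a c ≠ 1 := by
      by_contra! h0
      exact ha (h a h0)
    -- Orthogonality of characters: translating the summation variable by c multiplies the sum by
    -- q^{(a, c)} ≠ 1.
    have h1 : ∑ β : WeightQuot R N, (qPow (ζ : Kˣ) a β.out : K) =
        (qPow (ζ : Kˣ) a c : K) * ∑ β : WeightQuot R N, (qPow (ζ : Kˣ) a β.out : K) := by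
      conv_lhs => rw [← Equiv.sum_comp (Equiv.addLeft (QuotientAddGroup.mk c : WeightQuot R N))]
      rw [Finset.mul_sum]
      refine Finset.sum_congr rfl fun β _ => ?_
      obtain ⟨x, rfl⟩ := QuotientAddGroup.mk_surjective β
      rw [show Equiv.addLeft (QuotientAddGroup.mk c : WeightQuot R N) (QuotientAddGroup.mk x) =
        QuotientAddGroup.mk (c + x) from rfl, qPow_out_right, qPow_out_right,
        qPow_add_right, Units.val_mul]
    have h2 : ((qPow (ζ : Kˣ) a c : K) - 1) *
        ∑ β : WeightQuot R N, (qPow (ζ : Kˣ) a β.out : K) = 0 := by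
      rw [sub_mul, one_mul, ← h1, sub_self]
    refine (mul_eq_zero.1 h2).resolve_left fun h3 => hc (Units.ext ?_)
    rw [Units.val_one]
    exact sub_eq_zero.1 h3

theorem isNondeg_of_isPrimitiveRoot [R.IsRootSystem] [R.IsReduced] [R.IsIrreducible] {b : R.Base}
    {θ : κ} (hθ : IsHighest b θ) (hN : (N : ℤ) = 2 + wp θ (rho b)) {q : K}
    (hq : IsPrimitiveRoot q N) {ζ : rootsOfUnity N K}
    (hζ : ((ζ : Kˣ) : K) ^ formDenom R = q) : IsNondeg R ζ := by
  have hN0 : N ≠ 0 := by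
    have := hθ.rho_pos
    omega
  have hζN : ((ζ : Kˣ) : K) ^ N = 1 := by
    rw [← Units.val_pow_eq_pow_val, (mem_rootsOfUnity N _).1 ζ.2, Units.val_one]
  have hpow : ∀ n : ℕ, ((ζ : Kˣ) : K) ^ n = 1 → N ∣ n := by
    intro n hn
    refine hq.dvd_of_pow_eq_one n ?_
    rw [← hζ, ← pow_mul, mul_comm, pow_mul, hn, one_pow]
  have hprim : IsPrimitiveRoot ((ζ : Kˣ) : K) N := ⟨hζN, hpow⟩
  have hcop : Nat.Coprime (formDenom R) N := by
    rw [← hζ] at hq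
    exact (hprim.pow_iff_coprime (Nat.pos_of_ne_zero hN0) _).1 hq
  intro a ha
  refine hθ.mem_multiples_of_dvd_scaledForm hN hcop fun c => ?_
  have h1 := ha c
  rw [qPow] at h1
  have h2 : ((ζ : Kˣ) : K) ^ scaledForm R a c = 1 := by
    rw [← Units.val_zpow_eq_zpow_val, h1, Units.val_one]
  exact (hprim.zpow_eq_one_iff_dvd _).1 h2

end qPow

/-! ### Generators and modules -/

theorem HH.induction {ζ : Kˣ} {p : HH R ζ → Prop} (algebraMap : ∀ r : K, p (algebraMap K _ r))
    (X : ∀ a, p (X ζ a)) (Y : ∀ a, p (Y ζ a)) (T : ∀ w, p (T ζ w))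
    (add : ∀ x y, p x → p y → p (x + y)) (mul : ∀ x y, p x → p y → p (x * y)) (z : HH R ζ) :
    p z := by
  obtain ⟨f, rfl⟩ := RingQuot.mkAlgHom_surjective K (Rel R ζ) z
  induction f using FreeAlgebra.induction with
  | grade0 r => 
    rw [AlgHom.commutes]
    exact algebraMap r
  | grade1 g =>
    cases g with
    | X a => exact X a
    | Y a => exact Y a
    | T w => exact T w
  | mul x y hx hy => rw [map_mul]; exact mul _ _ hx hy
  | add x y hx hy => rw [map_add]; exact add _ _ hx hy

section relations

variable (ζ : Kˣ)

theorem X_zero : X ζ (0 : weightLattice R) = 1 := by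
  have := RingQuot.mkAlgHom_rel K (Rel.X_zero (R := R) (ζ := ζ))
  rwa [map_one] at this

theorem X_add (a c : weightLattice R) : X ζ (a + c) = X ζ a * X ζ c := by
  have := RingQuot.mkAlgHom_rel K (Rel.X_add (R := R) (ζ := ζ) a c)
  rwa [map_mul] at this

theorem Y_zero : Y ζ (0 : weightLattice R) = 1 := by
  have := RingQuot.mkAlgHom_rel K (Rel.Y_zero (R := R) (ζ := ζ))
  rwa [map_one] at this

theorem Y_add (a c : weightLattice R) : Y ζ (a + c) = Y ζ a * Y ζ c := by
  have := RingQuot.mkAlgHom_rel K (Rel.Y_add (R := R) (ζ := ζ) a c)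
  rwa [map_mul] at this

theorem T_one : T ζ (1 : R.weylGroup) = 1 := by
  have := RingQuot.mkAlgHom_rel K (Rel.T_one (R := R) (ζ := ζ))
  rwa [map_one] at this

theorem T_mul (w v : R.weylGroup) : T ζ (w * v) = T ζ w * T ζ v := by
  have := RingQuot.mkAlgHom_rel K (Rel.T_mul (R := R) (ζ := ζ) w v)
  rwa [map_mul] at this

theorem T_mul_X (w : R.weylGroup) (a : weightLattice R) : T ζ w * X ζ a = X ζ (w • a) * T ζ w := by
  have := RingQuot.mkAlgHom_rel K (Rel.T_X (R := R) (ζ := ζ) w a)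
  rwa [map_mul, map_mul] at this

theorem T_mul_Y (w : R.weylGroup) (a : weightLattice R) : T ζ w * Y ζ a = Y ζ (w • a) * T ζ w := by
  have := RingQuot.mkAlgHom_rel K (Rel.T_Y (R := R) (ζ := ζ) w a)
  rwa [map_mul, map_mul] at this

theorem X_mul_Y (a c : weightLattice R) :
    X ζ a * Y ζ c = (((qPow ζ a c)⁻¹ : Kˣ) : K) • (Y ζ c * X ζ a) := by
  have := RingQuot.mkAlgHom_rel K (Rel.X_Y (R := R) (ζ := ζ) a c)
  rwa [Units.smul_def, map_smul, map_mul, map_mul] at this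

end relations

/-- A `K`-subspace that is stable under the generators of `HH` is an `HH`-submodule. -/
theorem smul_mem_of_generators {ζ : Kˣ} {S : Type*} [AddCommGroup S] [Module K S]
    [Module (HH R ζ) S] [IsScalarTower K (HH R ζ) S] (M : Submodule K S)
    (hX : ∀ a : weightLattice R, ∀ s ∈ M, X ζ a • s ∈ M) (hY : ∀ a : weightLattice R, ∀ s ∈ M, Y ζ a • s ∈ M)
    (hT : ∀ w : R.weylGroup, ∀ s ∈ M, T ζ w • s ∈ M) (z : HH R ζ) : ∀ s ∈ M, z • s ∈ M := by
  induction z using HH.induction with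
  | algebraMap r => intro s hs; rw [algebraMap_smul]; exact M.smul_mem r hs
  | X a => exact hX a
  | Y a => exact hY a
  | T w => exact hT w
  | add x y hx hy => intro s hs; rw [add_smul]; exact M.add_mem (hx s hs) (hy s hs)
  | mul x y hx hy => intro s hs; rw [mul_smul]; exact hx _ (hy _ hs)

end

section

variable {κ E E' : Type*} [Fintype κ] [AddCommGroup E] [Module ℝ E] [AddCommGroup E'] [Module ℝ E']
variable {R : RootPairing κ ℝ E E'}

variable {K : Type*} [Field K] [R.IsCrystallographic] {N : ℕ}

/-! ### `V` as the group algebra of `P / N P` -/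

/-- The reduction of Laurent polynomials modulo `X^N = 1`. -/
def toQuot (K : Type*) [Field K] (R : RootPairing κ ℝ E E') (N : ℕ) :
    Poly K R →ₗ[K] AddMonoidAlgebra K (WeightQuot R N) :=
  AddMonoidAlgebra.mapDomainLinearMap K K QuotientAddGroup.mk

theorem toQuot_single (c : weightLattice R) (r : K) :
    toQuot K R N (AddMonoidAlgebra.single c r) = AddMonoidAlgebra.single (QuotientAddGroup.mk c) r := by
  simp [toQuot]

theorem toQuot_X (ζ : Kˣ) (a : weightLattice R) (f : Poly K R) :
    toQuot K R N (X ζ a • f) =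
      AddMonoidAlgebra.single (QuotientAddGroup.mk a) 1 * toQuot K R N f := by
  induction f using AddMonoidAlgebra.induction_linear with
  | zero => simp
  | add x y hx hy => rw [smul_add, map_add, map_add, hx, hy, mul_add]
  | single c r =>
    rw [X_smul_single, toQuot_single, toQuot_single, AddMonoidAlgebra.single_mul_single, one_mul]
    rfl

theorem toQuot_T (ζ : Kˣ) (w : R.weylGroup) (f : Poly K R) :
    toQuot K R N (T ζ w • f) = AddMonoidAlgebra.mapDomain (fun x => w • x) (toQuot K R N f) := by
  induction f using AddMonoidAlgebra.induction_linear with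
  | zero => simp
  | add x y hx hy => rw [smul_add, map_add, map_add, hx, hy, AddMonoidAlgebra.mapDomain_add]
  | single c r =>
    rw [T_smul_single, toQuot_single, toQuot_single, AddMonoidAlgebra.mapDomain_single,
      mk_smul_weight]

theorem coeff_toQuot_Y (ζ : rootsOfUnity N K) (a : weightLattice R) (f : Poly K R)
    (β : WeightQuot R N) :
    (toQuot K R N (Y (ζ : Kˣ) a • f)).coeff β =
      (qPow (ζ : Kˣ) β.out a : K) * (toQuot K R N f).coeff β := by
  classical
  induction f using AddMonoidAlgebra.induction_linear with
  | zero => simp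
  | add x y hx hy =>
    rw [smul_add, map_add, map_add, AddMonoidAlgebra.coeff_add, Finsupp.add_apply, hx, hy,
      AddMonoidAlgebra.coeff_add, Finsupp.add_apply, mul_add]
  | single c r =>
    rw [Y_smul_single, toQuot_single, toQuot_single, AddMonoidAlgebra.coeff_single,
      AddMonoidAlgebra.coeff_single, Finsupp.single_apply, Finsupp.single_apply]
    split_ifs with h
    · rw [← h, qPow_out_left]
    · rw [mul_zero]

theorem toQuot_surjective : Function.Surjective (toQuot K R N) := by
  intro g
  induction g using AddMonoidAlgebra.induction_linear with
  | zero => exact ⟨0, map_zero _⟩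
  | add x y hx hy =>
    obtain ⟨f, rfl⟩ := hx
    obtain ⟨g, rfl⟩ := hy
    exact ⟨f + g, map_add _ _ _⟩
  | single c r =>
    obtain ⟨x, rfl⟩ := QuotientAddGroup.mk_surjective c
    exact ⟨_, toQuot_single x r⟩

theorem single_sub_single_mem_kerV (ζ : rootsOfUnity N K) (c p : weightLattice R) (r : K) :
    AddMonoidAlgebra.single (c + N • p) r - AddMonoidAlgebra.single c r ∈ kerV R ζ := by
  have h1 : (AddMonoidAlgebra.single p 1 ^ N - 1 : Poly K R) ∈ kerV R ζ :=
    Submodule.subset_span ⟨p, rfl⟩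
  have h2 := (kerV R ζ).smul_mem (algebraMap K (HH R (ζ : Kˣ)) r * X (ζ : Kˣ) c) h1
  convert h2 using 1
  rw [mul_smul, algebraMap_smul, AddMonoidAlgebra.single_pow, AddMonoidAlgebra.one_def, smul_sub,
    X_smul_single, X_smul_single]
  simp [smul_sub]

theorem mem_kerV_iff (ζ : rootsOfUnity N K) (f : Poly K R) : f ∈ kerV R ζ ↔ toQuot K R N f = 0 := by
  constructor
  · intro hf
    induction hf using Submodule.span_induction with
    | mem x hx =>
      obtain ⟨a, rfl⟩ := hx
      rw [AddMonoidAlgebra.single_pow, AddMonoidAlgebra.one_def, map_sub, toQuot_single,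
        toQuot_single, one_pow, sub_eq_zero, mk_eq_mk_iff.2 ⟨a, (zero_add _).symm⟩]
    | zero => exact map_zero _
    | add x y _ _ hx hy => rw [map_add, hx, hy, add_zero]
    | smul z x _ hx =>
      refine smul_mem_of_generators (LinearMap.ker (toQuot K R N)) ?_ ?_ ?_ z x hx
      · intro a s hs
        rw [LinearMap.mem_ker] at hs ⊢
        rw [toQuot_X, hs, mul_zero]
      · intro a s hs
        rw [LinearMap.mem_ker] at hs ⊢
        refine AddMonoidAlgebra.ext (Finsupp.ext fun β => ?_)
        rw [coeff_toQuot_Y, hs]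
        simp
      · intro w s hs
        rw [LinearMap.mem_ker] at hs ⊢
        rw [toQuot_T, hs, AddMonoidAlgebra.mapDomain_zero]
  · let σ : AddMonoidAlgebra K (WeightQuot R N) →ₗ[K] Poly K R :=
      AddMonoidAlgebra.mapDomainLinearMap K K Quotient.out
    have key : f - σ (toQuot K R N f) ∈ kerV R ζ := by
      induction f using AddMonoidAlgebra.induction_linear with
      | zero => simp
      | add x y hx hy =>
        rw [map_add, map_add]
        convert (kerV R ζ).add_mem hx hy using 1
        abel
      | single c r =>
        obtain ⟨p, hp⟩ := exists_out_eq (N := N) c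
        have : σ (toQuot K R N (AddMonoidAlgebra.single c r)) =
            AddMonoidAlgebra.single (QuotientAddGroup.mk c : WeightQuot R N).out r := by
          simp [σ, toQuot_single]
        have h3 := single_sub_single_mem_kerV ζ (QuotientAddGroup.mk c : WeightQuot R N).out p r
        rw [← hp] at h3
        rw [this]
        exact h3
    intro hf
    rwa [hf, map_zero, sub_zero] at key

/-- `V ≅ K[P / N P]`. -/
def quotEquiv (ζ : rootsOfUnity N K) : V R ζ ≃ₗ[K] AddMonoidAlgebra K (WeightQuot R N) :=
  (Submodule.Quotient.restrictScalarsEquiv K (kerV R ζ)).symm.trans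
    ((Submodule.quotEquivOfEq _ (LinearMap.ker (toQuot K R N)) (by
      ext f
      exact mem_kerV_iff ζ f)).trans
      ((toQuot K R N).quotKerEquivOfSurjective toQuot_surjective))

theorem quotEquiv_mk (ζ : rootsOfUnity N K) (f : Poly K R) :
    quotEquiv ζ (Submodule.Quotient.mk f) = toQuot K R N f := rfl

theorem XN_smul_mk (ζ : rootsOfUnity N K) (a : weightLattice R) (f : Poly K R) :
    XN ζ a • (Submodule.Quotient.mk f : V R ζ) = Submodule.Quotient.mk (X (ζ : Kˣ) a • f) := rfl

theorem YN_smul_mk (ζ : rootsOfUnity N K) (a : weightLattice R) (f : Poly K R) :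
    YN ζ a • (Submodule.Quotient.mk f : V R ζ) = Submodule.Quotient.mk (Y (ζ : Kˣ) a • f) := rfl

theorem TN_smul_mk (ζ : rootsOfUnity N K) (w : R.weylGroup) (f : Poly K R) :
    TN ζ w • (Submodule.Quotient.mk f : V R ζ) = Submodule.Quotient.mk (T (ζ : Kˣ) w • f) := rfl

theorem quotEquiv_TN (ζ : rootsOfUnity N K) (w : R.weylGroup) (v : V R ζ) :
    quotEquiv ζ (TN ζ w • v) = AddMonoidAlgebra.mapDomain (fun x => w • x) (quotEquiv ζ v) := by
  obtain ⟨f, rfl⟩ := Submodule.Quotient.mk_surjective _ v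
  rw [TN_smul_mk, quotEquiv_mk, quotEquiv_mk, toQuot_T]

theorem finrank_V [R.IsRootSystem] (b : R.Base) [NeZero N] (ζ : rootsOfUnity N K) :
    Module.finrank K (V R ζ) = N ^ Module.finrank ℝ E := by
  have := finite_weightQuot b N
  have := Fintype.ofFinite (WeightQuot R N)
  rw [(quotEquiv ζ).finrank_eq,
    (AddMonoidAlgebra.coeffLinearEquiv K : AddMonoidAlgebra K (WeightQuot R N) ≃ₗ[K] _).finrank_eq,
    Module.finrank_finsupp_self, ← Nat.card_eq_fintype_card, card_weightQuot b]

/-! ### The orbit of `ρ` and the sign character -/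

section sign

variable [R.IsRootSystem] [R.IsReduced] [R.IsIrreducible] {b : R.Base} {θ : κ}

theorem IsHighest.eq_one_of_smul_mk_rho (hθ : IsHighest b θ) (hN : (N : ℤ) = 2 + wp θ (rho b))
    {w : R.weylGroup}
    (h : w • (QuotientAddGroup.mk (rho b) : WeightQuot R N) = QuotientAddGroup.mk (rho b)) :
    w = 1 := by
  rw [← mk_smul_weight] at h
  obtain ⟨p, hp⟩ := mk_eq_mk_iff.1 h.symm
  exact hθ.eq_one_of_smul_rho hN (p := p) (by rw [hp, natCast_zsmul])

theorem IsHighest.exists_eq_smul_mk_rho (hθ : IsHighest b θ) (hN : (N : ℤ) = 2 + wp θ (rho b))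
    {x : WeightQuot R N} (hx : ∀ i, refl R i • x ≠ x) :
    ∃ w : R.weylGroup, x = w • QuotientAddGroup.mk (rho b) := by
  obtain ⟨y, rfl⟩ := QuotientAddGroup.mk_surjective x
  obtain ⟨w, p, hp⟩ := hθ.exists_eq_smul_rho hN y (by
    rintro i ⟨z, hz⟩
    refine hx i ?_
    rw [← mk_smul_weight]
    refine mk_eq_mk_iff.2 ⟨z • rootWt R i, ?_⟩
    rw [refl_smul, hz, mul_smul, natCast_zsmul]
    abel)
  refine ⟨w, ?_⟩
  rw [← mk_smul_weight]
  refine (mk_eq_mk_iff.2 ⟨p, ?_⟩).symm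
  rw [hp, natCast_zsmul]

theorem IsHighest.stabilizer_rho (hθ : IsHighest b θ) (hN : (N : ℤ) = 2 + wp θ (rho b)) :
    MulAction.stabilizer R.weylGroup (QuotientAddGroup.mk (rho b) : WeightQuot R N) = ⊥ :=
  (Subgroup.eq_bot_iff_forall _).2 fun _ hw => hθ.eq_one_of_smul_mk_rho hN hw

theorem refl_ne_one (i : κ) : refl R i ≠ 1 := by
  intro h
  have h1 := sgn_refl (K := ℚ) (R := R) i
  rw [h, sgn_one] at h1
  norm_num at h1

theorem IsHighest.mem_orbit_rho (hθ : IsHighest b θ) (hN : (N : ℤ) = 2 + wp θ (rho b))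
    {x : WeightQuot R N} (hx : MulAction.stabilizer R.weylGroup x = ⊥) :
    x ∈ MulAction.orbit R.weylGroup (QuotientAddGroup.mk (rho b) : WeightQuot R N) := by
  obtain ⟨w, hw⟩ := hθ.exists_eq_smul_mk_rho hN (x := x) fun i hi =>
    refl_ne_one i ((Subgroup.eq_bot_iff_forall _).1 hx _ hi)
  exact ⟨w, hw.symm⟩

theorem coeff_smul_of_antisymm_quot {g : AddMonoidAlgebra K (WeightQuot R N)}
    (hg : ∀ w : R.weylGroup, AddMonoidAlgebra.mapDomain (fun x => w • x) g = sgn K w • g)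
    (w : R.weylGroup) (x : WeightQuot R N) : g.coeff (w • x) = sgn K w * g.coeff x := by
  have h : (AddMonoidAlgebra.mapDomain (fun x => w • x) g).coeff (w • x) = g.coeff x :=
    Finsupp.mapDomain_apply (MulAction.injective (β := WeightQuot R N) w) g.coeff x
  rw [hg, AddMonoidAlgebra.coeff_smul, Finsupp.smul_apply, smul_eq_mul] at h
  rw [← h, ← mul_assoc, sgn_mul_self, one_mul]

/-- Antisymmetry kills the coefficients at classes fixed by a reflection, and all remaining classes
lie in the orbit of ρ. -/
theorem IsHighest.eq_zero_of_antisymm [CharZero K] (hθ : IsHighest b θ)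
    (hN : (N : ℤ) = 2 + wp θ (rho b)) {g : AddMonoidAlgebra K (WeightQuot R N)}
    (hg : ∀ w : R.weylGroup, AddMonoidAlgebra.mapDomain (fun x => w • x) g = sgn K w • g)
    (h0 : g.coeff (QuotientAddGroup.mk (rho b)) = 0) : g = 0 := by
  refine AddMonoidAlgebra.ext (Finsupp.ext fun x => ?_)
  by_contra hx
  have hx' : g.coeff x ≠ 0 := hx
  obtain ⟨w, rfl⟩ := hθ.exists_eq_smul_mk_rho hN (x := x) fun i hi => by
    have h1 := coeff_smul_of_antisymm_quot hg (refl R i) x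
    rw [hi, sgn_refl] at h1
    apply hx'
    linear_combination h1 / 2
  rw [coeff_smul_of_antisymm_quot hg, h0, mul_zero] at hx'
  exact hx' rfl

theorem mk_delta_mem_signPart (b : R.Base) (ζ : rootsOfUnity N K) :
    (Submodule.Quotient.mk (delta K b) : V R ζ) ∈ signPart (R := R) ζ := by
  intro w
  rw [TN_smul_mk, T_smul_eq, opT_delta]
  rfl

theorem quotEquiv_antisymm {ζ : rootsOfUnity N K} {v : V R ζ} (hv : v ∈ signPart ζ)
    (w : R.weylGroup) :
    AddMonoidAlgebra.mapDomain (fun x => w • x) (quotEquiv ζ v) = sgn K w • quotEquiv ζ v := by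
  rw [← quotEquiv_TN, hv w, map_smul]

theorem IsHighest.coeff_toQuot_delta [CharZero K] (hθ : IsHighest b θ)
    (hN : (N : ℤ) = 2 + wp θ (rho b)) :
    (toQuot K R N (delta K b)).coeff (QuotientAddGroup.mk (rho b)) = 1 := by
  classical
  have := Fintype.ofFinite R.weylGroup
  rw [delta_eq_sum, map_sum, AddMonoidAlgebra.coeff_sum, Finsupp.finsetSum_apply,
    Finset.sum_eq_single 1]
  · rw [toQuot_single, one_smul, sgn_one, AddMonoidAlgebra.coeff_single, Finsupp.single_eq_same]
  · intro w _ hw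
    rw [toQuot_single, AddMonoidAlgebra.coeff_single, Finsupp.single_apply, if_neg]
    intro h
    exact hw (hθ.eq_one_of_smul_mk_rho hN h)
  · intro h
    exact absurd (Finset.mem_univ _) h

theorem IsHighest.signPart_eq [CharZero K] (hθ : IsHighest b θ)
    (hN : (N : ℤ) = 2 + wp θ (rho b)) (ζ : rootsOfUnity N K) :
    signPart ζ = Submodule.span K {(Submodule.Quotient.mk (delta K b) : V R ζ)} := by
  refine le_antisymm (fun v hv => ?_) ?_
  · set r := (quotEquiv ζ v).coeff (QuotientAddGroup.mk (rho b))
    have h1 : v - r • (Submodule.Quotient.mk (delta K b) : V R ζ) ∈ signPart ζ :=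
      (signPart ζ).sub_mem hv ((signPart ζ).smul_mem r (mk_delta_mem_signPart b ζ))
    have h2 := hθ.eq_zero_of_antisymm hN (quotEquiv_antisymm h1) (by
      rw [map_sub, map_smul, quotEquiv_mk, AddMonoidAlgebra.coeff_sub, Finsupp.sub_apply,
        AddMonoidAlgebra.coeff_smul, Finsupp.smul_apply, hθ.coeff_toQuot_delta hN, smul_eq_mul,
        mul_one, sub_self])
    rw [LinearEquiv.map_eq_zero_iff, sub_eq_zero] at h2
    rw [h2]
    exact Submodule.smul_mem _ _ (Submodule.mem_span_singleton_self _)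
  · rw [Submodule.span_singleton_le_iff_mem]
    exact mk_delta_mem_signPart b ζ

theorem IsHighest.finrank_signPart [CharZero K] (hθ : IsHighest b θ)
    (hN : (N : ℤ) = 2 + wp θ (rho b)) (ζ : rootsOfUnity N K) :
    Module.finrank K (signPart (R := R) ζ) = 1 := by
  rw [hθ.signPart_eq hN ζ]
  refine finrank_span_singleton fun h => ?_
  have h1 := congrArg (quotEquiv ζ) h
  have h2 := hθ.coeff_toQuot_delta (K := K) hN
  rw [← quotEquiv_mk ζ, h1, map_zero] at h2
  simp at h2

end sign

end

section

variable {κ E E' : Type*} [Fintype κ] [AddCommGroup E] [Module ℝ E] [AddCommGroup E'] [Module ℝ E']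
variable {R : RootPairing κ ℝ E E'}

variable {K : Type*} [Field K] [R.IsCrystallographic] {N : ℕ}

/-! ### Representations of the Weyl algebra modulo `X^N = 1 = Y^N` -/

/-- Families `x`, `y` in a `K`-algebra that satisfy the relations of the Weyl algebra modulo
`X^N = 1 = Y^N`. -/
structure IsWeylPair (ζ : rootsOfUnity N K) {A : Type*} [Ring A] [Algebra K A]
    (x y : weightLattice R → A) : Prop where
  x_zero : x 0 = 1
  x_add : ∀ a c, x (a + c) = x a * x c
  y_zero : y 0 = 1
  y_add : ∀ a c, y (a + c) = y a * y c
  x_mul_y : ∀ a c, x a * y c = (((qPow (ζ : Kˣ) a c)⁻¹ : Kˣ) : K) • (y c * x a)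
  x_pow : ∀ a, x a ^ N = 1
  y_pow : ∀ a, y a ^ N = 1

/-- The projector onto the vectors `s` with `y a s = q^{(c, a)} s`. -/
def eigenproj (ζ : rootsOfUnity N K) [Fintype (WeightQuot R N)] {A : Type*} [Ring A] [Algebra K A]
    (y : weightLattice R → A) (c : weightLattice R) : A :=
  (Fintype.card (WeightQuot R N) : K)⁻¹ •
    ∑ β : WeightQuot R N, (qPow (ζ : Kˣ) (-c) β.out : K) • y β.out

section

variable {ζ : rootsOfUnity N K}

theorem map_eigenproj [Fintype (WeightQuot R N)] {A B : Type*} [Ring A] [Algebra K A] [Ring B]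
    [Algebra K B] (φ : A →ₐ[K] B) (y : weightLattice R → A) (c : weightLattice R) :
    φ (eigenproj ζ y c) = eigenproj ζ (fun a => φ (y a)) c := by
  simp [eigenproj, map_sum]

theorem card_weightQuot_ne_zero [CharZero K] [Fintype (WeightQuot R N)] :
    (Fintype.card (WeightQuot R N) : K) ≠ 0 :=
  Nat.cast_ne_zero.2 Fintype.card_ne_zero

open Classical in
theorem eigenproj_apply [CharZero K] [Fintype (WeightQuot R N)] (hnd : IsNondeg R ζ) {S : Type*}
    [AddCommGroup S] [Module K S] (y : weightLattice R → Module.End K S) {c : weightLattice R}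
    {s : S} (hs : ∀ a, y a s = (qPow (ζ : Kˣ) c a : K) • s) (d : weightLattice R) :
    eigenproj ζ y d s = if c - d ∈ multiples R N then s else 0 := by
  have h1 : eigenproj ζ y d s = (Fintype.card (WeightQuot R N) : K)⁻¹ •
      ((∑ β : WeightQuot R N, (qPow (ζ : Kˣ) (c - d) β.out : K)) • s) := by
    rw [eigenproj, LinearMap.smul_apply, LinearMap.sum_apply, Finset.sum_smul]
    congr 1
    refine Finset.sum_congr rfl fun β _ => ?_
    rw [LinearMap.smul_apply, hs, smul_smul, ← Units.val_mul, ← qPow_add_left]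
    congr 3
    abel
  rw [h1, hnd.sum_qPow]
  split_ifs
  · rw [smul_smul, inv_mul_cancel₀ card_weightQuot_ne_zero, one_smul]
  · rw [zero_smul, smul_zero]

namespace IsWeylPair

variable {A : Type*} [Ring A] [Algebra K A] {x y : weightLattice R → A}

theorem map {B : Type*} [Ring B] [Algebra K B] (h : IsWeylPair ζ x y) (φ : A →ₐ[K] B) :
    IsWeylPair ζ (fun a => φ (x a)) (fun a => φ (y a)) where
  x_zero := by rw [h.x_zero, map_one]
  x_add a c := by rw [h.x_add, map_mul]
  y_zero := by rw [h.y_zero, map_one]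
  y_add a c := by rw [h.y_add, map_mul]
  x_mul_y a c := by rw [← map_mul, h.x_mul_y, map_smul, map_mul]
  x_pow a := by rw [← map_pow, h.x_pow, map_one]
  y_pow a := by rw [← map_pow, h.y_pow, map_one]

theorem y_mul_x (h : IsWeylPair ζ x y) (a c : weightLattice R) :
    y c * x a = (qPow (ζ : Kˣ) a c : K) • (x a * y c) := by
  rw [h.x_mul_y, smul_smul, ← Units.val_mul, mul_inv_cancel, Units.val_one, one_smul]

theorem x_nsmul (h : IsWeylPair ζ x y) (a : weightLattice R) : x (N • a) = 1 := by
  have : ∀ n : ℕ, x (n • a) = x a ^ n := by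
    intro n
    induction n with
    | zero => rw [zero_smul, h.x_zero, pow_zero]
    | succ n ih => rw [succ_nsmul, h.x_add, ih, pow_succ]
  rw [this, h.x_pow]

theorem y_nsmul (h : IsWeylPair ζ x y) (a : weightLattice R) : y (N • a) = 1 := by
  have : ∀ n : ℕ, y (n • a) = y a ^ n := by
    intro n
    induction n with
    | zero => rw [zero_smul, h.y_zero, pow_zero]
    | succ n ih => rw [succ_nsmul, h.y_add, ih, pow_succ]
  rw [this, h.y_pow]

theorem x_out (h : IsWeylPair ζ x y) (a : weightLattice R) :
    x (QuotientAddGroup.mk a : WeightQuot R N).out = x a := by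
  obtain ⟨p, hp⟩ := exists_out_eq (N := N) a
  conv_rhs => rw [hp, h.x_add, h.x_nsmul, mul_one]

theorem y_out (h : IsWeylPair ζ x y) (a : weightLattice R) :
    y (QuotientAddGroup.mk a : WeightQuot R N).out = y a := by
  obtain ⟨p, hp⟩ := exists_out_eq (N := N) a
  conv_rhs => rw [hp, h.y_add, h.y_nsmul, mul_one]

theorem y_mul_eigenproj [Fintype (WeightQuot R N)] (h : IsWeylPair ζ x y)
    (a c : weightLattice R) :
    y a * eigenproj ζ y c = (qPow (ζ : Kˣ) c a : K) • eigenproj ζ y c := by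
  rw [eigenproj, mul_smul_comm, smul_comm (qPow (ζ : Kˣ) c a : K)]
  congr 1
  conv_rhs => rw [← Equiv.sum_comp (Equiv.addLeft (QuotientAddGroup.mk a : WeightQuot R N))]
  rw [Finset.mul_sum, Finset.smul_sum]
  refine Finset.sum_congr rfl fun β _ => ?_
  obtain ⟨b, rfl⟩ := QuotientAddGroup.mk_surjective β
  rw [show Equiv.addLeft (QuotientAddGroup.mk a : WeightQuot R N) (QuotientAddGroup.mk b) =
    QuotientAddGroup.mk (a + b) from rfl, qPow_out_right, qPow_out_right, h.y_out, h.y_out,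
    h.y_add, mul_smul_comm, smul_smul, qPow_add_right, Units.val_mul, ← mul_assoc, qPow_neg_left,
    qPow_neg_left, ← Units.val_mul, mul_inv_cancel, Units.val_one, one_mul]

theorem sum_eigenproj [CharZero K] [Fintype (WeightQuot R N)] (h : IsWeylPair ζ x y)
    (hnd : IsNondeg R ζ) : ∑ γ : WeightQuot R N, eigenproj ζ y γ.out = 1 := by
  classical
  simp only [eigenproj]
  rw [← Finset.smul_sum, Finset.sum_comm]
  -- After exchanging the sums, character orthogonality in γ leaves only the term β = 0.
  have h1 : ∀ β : WeightQuot R N,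
      ∑ γ : WeightQuot R N, (qPow (ζ : Kˣ) (-γ.out) β.out : K) • y β.out =
      if β = 0 then (Fintype.card (WeightQuot R N) : K) • (1 : A) else 0 := by
    intro β
    have h2 : ∀ γ : WeightQuot R N, qPow (ζ : Kˣ) (-γ.out) β.out =
        qPow (ζ : Kˣ) (-β.out) γ.out := by
      intro γ
      rw [qPow_neg_left, qPow_neg_left, qPow_symm]
    simp only [h2]
    rw [← Finset.sum_smul, hnd.sum_qPow]
    have h3 : -β.out ∈ multiples R N ↔ β = 0 := by
      rw [neg_mem_iff, ← QuotientAddGroup.eq_zero_iff]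
      have : (QuotientAddGroup.mk β.out : WeightQuot R N) = β := Quotient.out_eq β
      rw [this]
    simp only [h3]
    split_ifs with h0
    · rw [h0, ← QuotientAddGroup.mk_zero, h.y_out, h.y_zero]
    · rw [zero_smul]
  rw [Finset.sum_congr rfl fun β _ => h1 β, Finset.sum_ite_eq' Finset.univ 0,
    if_pos (Finset.mem_univ _), smul_smul, inv_mul_cancel₀ card_weightQuot_ne_zero, one_smul]

end IsWeylPair

/-! ### Evaluation of `V` -/

theorem V.induction {p : V R ζ → Prop} (zero : p 0) (add : ∀ v v', p v → p v' → p (v + v'))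
    (single : ∀ c r, p (Submodule.Quotient.mk (AddMonoidAlgebra.single c r))) (v : V R ζ) :
    p v := by
  obtain ⟨f, rfl⟩ := Submodule.Quotient.mk_surjective _ v
  induction f using AddMonoidAlgebra.induction_linear with
  | zero => exact zero
  | add x y hx hy => exact add _ _ hx hy
  | single c r => exact single c r

/-- The evaluation of elements of `V` at a family `x` with `x (N • a) = 1`. -/
def evalV (ζ : rootsOfUnity N K) {A : Type*} [Ring A] [Algebra K A] (x : weightLattice R → A) :
    V R ζ →ₗ[K] A :=
  (Finsupp.linearCombination K fun β : WeightQuot R N => x β.out).comp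
    ((AddMonoidAlgebra.coeffLinearEquiv K).toLinearMap.comp (quotEquiv ζ).toLinearMap)

namespace IsWeylPair

variable {A : Type*} [Ring A] [Algebra K A] {x y : weightLattice R → A}

theorem evalV_single (h : IsWeylPair ζ x y) (c : weightLattice R) (r : K) :
    evalV ζ x (Submodule.Quotient.mk (AddMonoidAlgebra.single c r)) = r • x c := by
  simp [evalV, quotEquiv_mk, toQuot_single, h.x_out]

theorem evalV_XN (h : IsWeylPair ζ x y) (a : weightLattice R) (v : V R ζ) :
    evalV ζ x (XN ζ a • v) = x a * evalV ζ x v := by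
  induction v using V.induction with
  | zero => simp
  | add v v' hv hv' => rw [smul_add, map_add, map_add, hv, hv', mul_add]
  | single c r =>
    rw [XN_smul_mk, X_smul_single, h.evalV_single, h.evalV_single, h.x_add, mul_smul_comm]

/-- The action of Y_a on V corresponds to conjugation by y_a, hence the factor y_a on the right; it
disappears on fixed vectors. -/
theorem evalV_YN (h : IsWeylPair ζ x y) (a : weightLattice R) (v : V R ζ) :
    evalV ζ x (YN ζ a • v) * y a = y a * evalV ζ x v := by
  induction v using V.induction with
  | zero => simp
  | add v v' hv hv' => rw [smul_add, map_add, map_add, add_mul, hv, hv', mul_add]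
  | single c r =>
    rw [YN_smul_mk, Y_smul_single, h.evalV_single, h.evalV_single, mul_smul_comm, h.y_mul_x,
      smul_mul_assoc, smul_smul, mul_comm]

theorem evalV_TN (h : IsWeylPair ζ x y) {w : R.weylGroup} {t : A}
    (ht : ∀ a, t * x a = x (w • a) * t) (v : V R ζ) :
    evalV ζ x (TN ζ w • v) * t = t * evalV ζ x v := by
  induction v using V.induction with
  | zero => simp
  | add v v' hv hv' => rw [smul_add, map_add, map_add, add_mul, hv, hv', mul_add]
  | single c r =>
    rw [TN_smul_mk, T_smul_single, h.evalV_single, h.evalV_single, mul_smul_comm, ht,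
      smul_mul_assoc]

end IsWeylPair

end

/-! ### Fixed vectors and the Stone–von Neumann decomposition -/

/-- The vectors fixed by all `y a`. -/
def fixedPart {S : Type*} [AddCommGroup S] [Module K S] (y : weightLattice R → Module.End K S) :
    Submodule K S where
  carrier := {s | ∀ a, y a s = s}
  zero_mem' := fun a => map_zero _
  add_mem' := fun hs ht a => by rw [map_add, hs a, ht a]
  smul_mem' := fun r s hs a => by rw [map_smul, hs a]

namespace IsWeylPair

variable {ζ : rootsOfUnity N K} {S : Type*} [AddCommGroup S] [Module K S]
  {x y : weightLattice R → Module.End K S}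

theorem y_apply_x_of_mem_fixedPart (h : IsWeylPair ζ x y) {u : S} (hu : u ∈ fixedPart y)
    (c a : weightLattice R) : y a (x c u) = (qPow (ζ : Kˣ) c a : K) • x c u := by
  have h1 := LinearMap.congr_fun (h.y_mul_x c a) u
  rw [Module.End.mul_apply, LinearMap.smul_apply, Module.End.mul_apply, hu a] at h1
  exact h1

theorem x_neg_apply_x (h : IsWeylPair ζ x y) (c : weightLattice R) (s : S) :
    x (-c) (x c s) = s := by
  rw [← Module.End.mul_apply, ← h.x_add, neg_add_cancel, h.x_zero, Module.End.one_apply]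

theorem x_apply_x_neg (h : IsWeylPair ζ x y) (c : weightLattice R) (s : S) :
    x c (x (-c) s) = s := by
  rw [← Module.End.mul_apply, ← h.x_add, add_neg_cancel, h.x_zero, Module.End.one_apply]

variable [Fintype (WeightQuot R N)]

theorem x_neg_eigenproj_mem (h : IsWeylPair ζ x y) (c : weightLattice R) (s : S) :
    x (-c) (eigenproj ζ y c s) ∈ fixedPart y := by
  intro a
  have h1 := LinearMap.congr_fun (h.y_mul_x (-c) a) (eigenproj ζ y c s)
  have h2 := LinearMap.congr_fun (h.y_mul_eigenproj a c) s
  rw [Module.End.mul_apply, LinearMap.smul_apply] at h2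
  rw [Module.End.mul_apply, LinearMap.smul_apply, Module.End.mul_apply, h2, map_smul, smul_smul,
    ← Units.val_mul, ← qPow_add_left, neg_add_cancel, qPow_zero_left, Units.val_one,
    one_smul] at h1
  exact h1

theorem eigenproj_mem_of_stable {M : Submodule K S} (hy : ∀ a, ∀ s ∈ M, y a s ∈ M)
    (c : weightLattice R) {s : S} (hs : s ∈ M) : eigenproj ζ y c s ∈ M := by
  rw [eigenproj, LinearMap.smul_apply, LinearMap.sum_apply]
  exact M.smul_mem _ (M.sum_mem fun β _ => M.smul_mem _ (hy _ _ hs))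

/-- The weight projectors sum to 1, so a nonzero vector has a nonzero weight component, and x shifts
that component to weight 0 without leaving M. -/
theorem exists_mem_fixedPart [CharZero K] (h : IsWeylPair ζ x y) (hnd : IsNondeg R ζ)
    {M : Submodule K S} (hM : M ≠ ⊥) (hx : ∀ a, ∀ s ∈ M, x a s ∈ M)
    (hy : ∀ a, ∀ s ∈ M, y a s ∈ M) : ∃ s ∈ M, s ∈ fixedPart y ∧ s ≠ 0 := by
  obtain ⟨s, hs, hs0⟩ := (Submodule.ne_bot_iff M).1 hM
  obtain ⟨γ, hγ⟩ : ∃ γ : WeightQuot R N, eigenproj ζ y γ.out s ≠ 0 := by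
    by_contra! h0
    have h1 := LinearMap.congr_fun (h.sum_eigenproj hnd) s
    rw [LinearMap.sum_apply, Finset.sum_eq_zero fun γ _ => h0 γ] at h1
    exact hs0 h1.symm
  refine ⟨_, hx _ _ (eigenproj_mem_of_stable hy γ.out hs), h.x_neg_eigenproj_mem γ.out s, ?_⟩
  intro h1
  have h2 := h.x_apply_x_neg γ.out (eigenproj ζ y γ.out s)
  rw [h1, map_zero] at h2
  exact hγ h2.symm

/-- The decomposition of a module over the Weyl algebra. -/
theorem bijective_lift [CharZero K] (h : IsWeylPair ζ x y) (hnd : IsNondeg R ζ) :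
    Function.Bijective (TensorProduct.lift
      ((LinearMap.lcomp K S (fixedPart y).subtype).comp (evalV ζ x))) := by
  classical
  set Ψ := TensorProduct.lift ((LinearMap.lcomp K S (fixedPart y).subtype).comp (evalV ζ x)) with hΨ
  have hΨt : ∀ v (u : fixedPart y), Ψ (v ⊗ₜ u) = evalV ζ x v u := fun v u => rfl
  -- The inverse splits s into weight components and shifts each to weight 0: s ↦ ∑ X_γ ⊗ x(-γ) e_γ
  -- s.
  let Θ : S →ₗ[K] V R ζ ⊗[K] fixedPart y := ∑ γ : WeightQuot R N,
    (TensorProduct.mk K (V R ζ) (fixedPart y)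
      (Submodule.Quotient.mk (AddMonoidAlgebra.single γ.out 1))).comp
      (LinearMap.codRestrict (fixedPart y) (x (-γ.out) * eigenproj ζ y γ.out)
        fun s => h.x_neg_eigenproj_mem γ.out s)
  have hΘ : ∀ s, Θ s = ∑ γ : WeightQuot R N,
      (Submodule.Quotient.mk (AddMonoidAlgebra.single γ.out 1) : V R ζ) ⊗ₜ[K]
      (⟨x (-γ.out) (eigenproj ζ y γ.out s), h.x_neg_eigenproj_mem γ.out s⟩ : fixedPart y) := by
    intro s
    simp only [Θ, LinearMap.sum_apply]
    rfl
  refine Function.bijective_iff_has_inverse.2 ⟨Θ, ?_, ?_⟩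
  · intro τ
    suffices h0 : Θ.comp Ψ = LinearMap.id from LinearMap.congr_fun h0 τ
    refine TensorProduct.ext' fun v u => ?_
    rw [LinearMap.comp_apply, LinearMap.id_apply]
    induction v using V.induction with
    | zero => simp
    | add v v' hv hv' => rw [TensorProduct.add_tmul, map_add, map_add, hv, hv']
    | single c r =>
      have hp := fun γ : WeightQuot R N =>
        eigenproj_apply hnd y (h.y_apply_x_of_mem_fixedPart u.2 c) γ.out
      have hmem : ∀ γ : WeightQuot R N, c - γ.out ∈ multiples R N ↔ γ = QuotientAddGroup.mk c := by
        intro γ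
        rw [← QuotientAddGroup.eq_iff_sub_mem]
        have : (QuotientAddGroup.mk γ.out : WeightQuot R N) = γ := Quotient.out_eq γ
        rw [this, eq_comm]
      have hc := exists_out_eq (N := N) c
      rw [hΨt, h.evalV_single, LinearMap.smul_apply, map_smul, hΘ,
        Finset.sum_eq_single (QuotientAddGroup.mk c)]
      · obtain ⟨p, hp'⟩ := hc
        have h1 : (Submodule.Quotient.mk (AddMonoidAlgebra.single c r) : V R ζ) =
            r • Submodule.Quotient.mk (AddMonoidAlgebra.single
              (QuotientAddGroup.mk c : WeightQuot R N).out 1) := by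
          have h2 := single_sub_single_mem_kerV ζ (QuotientAddGroup.mk c : WeightQuot R N).out p r
          rw [← hp', ← Submodule.Quotient.mk_eq_zero, Submodule.Quotient.mk_sub, sub_eq_zero] at h2
          rw [h2, ← Submodule.Quotient.mk_smul, AddMonoidAlgebra.smul_single, smul_eq_mul, mul_one]
        rw [h1, TensorProduct.smul_tmul']
        congr 2
        change x _ (eigenproj ζ y _ (x c u)) = _
        rw [hp, if_pos ((hmem _).2 rfl), ← h.x_out c, h.x_neg_apply_x]
      · intro γ _ hγ
        have h1 : (⟨x (-γ.out) (eigenproj ζ y γ.out (x c u)),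
            h.x_neg_eigenproj_mem γ.out _⟩ : fixedPart y) = 0 := by
          refine Subtype.ext ?_
          change x _ (eigenproj ζ y _ (x c u)) = 0
          rw [hp, if_neg (fun h0 => hγ ((hmem _).1 h0)), map_zero]
        rw [h1, TensorProduct.tmul_zero]
      · intro h0
        exact absurd (Finset.mem_univ _) h0
  · intro s
    rw [hΘ, map_sum]
    have h1 := LinearMap.congr_fun (h.sum_eigenproj hnd) s
    rw [LinearMap.sum_apply, Module.End.one_apply] at h1
    conv_rhs => rw [← h1]
    refine Finset.sum_congr rfl fun γ _ => ?_
    rw [hΨt, h.evalV_single, one_smul]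
    exact h.x_apply_x_neg _ _

end IsWeylPair

end

section

variable {κ E E' : Type*} [Fintype κ] [AddCommGroup E] [Module ℝ E] [AddCommGroup E'] [Module ℝ E']
variable {R : RootPairing κ ℝ E E'}

variable {K : Type*} [Field K] [R.IsCrystallographic] {N : ℕ}

/-! ### The generators of `HHN` and of the Weyl algebra -/

section

variable (ζ : rootsOfUnity N K)

theorem isWeylPair_HHN : IsWeylPair ζ (XN (R := R) ζ) (YN ζ) where
  x_zero := congrArg _ (X_zero (ζ : Kˣ))
  x_add a c := congrArg _ (X_add (ζ : Kˣ) a c)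
  y_zero := congrArg _ (Y_zero (ζ : Kˣ))
  y_add a c := congrArg _ (Y_add (ζ : Kˣ) a c)
  x_mul_y a c := congrArg _ (X_mul_Y (ζ : Kˣ) a c)
  x_pow a := by
    rw [XN, ← map_pow, ← map_one (Ideal.Quotient.mk _), ← sub_eq_zero, ← map_sub,
      Ideal.Quotient.eq_zero_iff_mem]
    exact TwoSidedIdeal.subset_span ⟨a, Or.inl rfl⟩
  y_pow a := by
    rw [YN, ← map_pow, ← map_one (Ideal.Quotient.mk _), ← sub_eq_zero, ← map_sub,
      Ideal.Quotient.eq_zero_iff_mem]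
    exact TwoSidedIdeal.subset_span ⟨a, Or.inr rfl⟩

theorem TN_one : TN ζ (1 : R.weylGroup) = 1 := congrArg _ (T_one (ζ : Kˣ))

theorem TN_mul (w v : R.weylGroup) : TN ζ (w * v) = TN ζ w * TN ζ v :=
  congrArg _ (T_mul (ζ : Kˣ) w v)

theorem TN_mul_XN (w : R.weylGroup) (a : weightLattice R) :
    TN ζ w * XN ζ a = XN ζ (w • a) * TN ζ w := congrArg _ (T_mul_X (ζ : Kˣ) w a)

theorem TN_mul_YN (w : R.weylGroup) (a : weightLattice R) :
    TN ζ w * YN ζ a = YN ζ (w • a) * TN ζ w := congrArg _ (T_mul_Y (ζ : Kˣ) w a)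

/-- `X_a` as an element of the Weyl algebra. -/
def XW (a : weightLattice R) : weylAlg R ζ :=
  ⟨XN ζ a, Algebra.subset_adjoin (Or.inl ⟨a, rfl⟩)⟩

/-- `Y_b` as an element of the Weyl algebra. -/
def YW (a : weightLattice R) : weylAlg R ζ :=
  ⟨YN ζ a, Algebra.subset_adjoin (Or.inr ⟨a, rfl⟩)⟩

theorem isWeylPair_weylAlg : IsWeylPair ζ (XW (R := R) ζ) (YW ζ) where
  x_zero := Subtype.ext (isWeylPair_HHN ζ).x_zero
  x_add a c := Subtype.ext ((isWeylPair_HHN ζ).x_add a c)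
  y_zero := Subtype.ext (isWeylPair_HHN ζ).y_zero
  y_add a c := Subtype.ext ((isWeylPair_HHN ζ).y_add a c)
  x_mul_y a c := Subtype.ext ((isWeylPair_HHN ζ).x_mul_y a c)
  x_pow a := Subtype.ext ((isWeylPair_HHN ζ).x_pow a)
  y_pow a := Subtype.ext ((isWeylPair_HHN ζ).y_pow a)

variable {ζ}

theorem HHN_smul_mem_of_generators {S : Type*} [AddCommGroup S] [Module K S]
    [Module (HHN R ζ) S] [IsScalarTower K (HHN R ζ) S] (M : Submodule K S)
    (hX : ∀ a : weightLattice R, ∀ s ∈ M, XN ζ a • s ∈ M)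
    (hY : ∀ a : weightLattice R, ∀ s ∈ M, YN ζ a • s ∈ M)
    (hT : ∀ w : R.weylGroup, ∀ s ∈ M, TN ζ w • s ∈ M) (z : HHN R ζ) : ∀ s ∈ M, z • s ∈ M := by
  obtain ⟨z, rfl⟩ := Ideal.Quotient.mk_surjective z
  induction z using HH.induction with
  | algebraMap r =>
    intro s hs
    change algebraMap K (HHN R ζ) r • s ∈ M
    rw [algebraMap_smul]
    exact M.smul_mem r hs
  | X a => exact hX a
  | Y a => exact hY a
  | T w => exact hT w
  | add x y hx hy => intro s hs; rw [map_add, add_smul]; exact M.add_mem (hx s hs) (hy s hs)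
  | mul x y hx hy => intro s hs; rw [map_mul, mul_smul]; exact hx _ (hy _ hs)

/-! ### Simplicity of `V` -/

theorem mk_one_ne_zero : (Submodule.Quotient.mk (AddMonoidAlgebra.single 0 1) : V R ζ) ≠ 0 := by
  intro h
  have h1 := congrArg (quotEquiv ζ) h
  rw [map_zero, quotEquiv_mk, toQuot_single, AddMonoidAlgebra.single_eq_zero] at h1
  exact one_ne_zero h1

instance : Nontrivial (V R ζ) := ⟨_, _, mk_one_ne_zero⟩

theorem eq_smul_mk_one_of_fixed (hnd : IsNondeg R ζ) {v : V R ζ}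
    (hv : ∀ a : weightLattice R, YN ζ a • v = v) :
    ∃ r : K, v = r • Submodule.Quotient.mk (AddMonoidAlgebra.single 0 1) := by
  classical
  refine ⟨(quotEquiv ζ v).coeff 0, (quotEquiv ζ).injective ?_⟩
  rw [map_smul, quotEquiv_mk, toQuot_single]
  refine AddMonoidAlgebra.ext (Finsupp.ext fun β => ?_)
  rw [AddMonoidAlgebra.coeff_smul, Finsupp.smul_apply, AddMonoidAlgebra.coeff_single,
    Finsupp.single_apply, QuotientAddGroup.mk_zero]
  split_ifs with h0
  · rw [← h0, smul_eq_mul, mul_one]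
  · rw [smul_zero]
    by_contra hβ
    apply h0
    -- A nonzero coefficient of a fixed vector at β forces q^{(β, a)} = 1 for all a, so β = 0 by
    -- nondegeneracy.
    have h1 : ∀ a, qPow (ζ : Kˣ) β.out a = 1 := by
      intro a
      have h2 := congrArg (fun v => (quotEquiv ζ v).coeff β) (hv a)
      obtain ⟨f, rfl⟩ := Submodule.Quotient.mk_surjective _ v
      simp only [YN_smul_mk, quotEquiv_mk] at h2 hβ
      rw [coeff_toQuot_Y] at h2
      exact Units.ext (mul_right_cancel₀ hβ (by rw [h2, Units.val_one, one_mul]))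
    have h2 := (QuotientAddGroup.eq_zero_iff β.out).2 (hnd _ h1)
    have h3 : (QuotientAddGroup.mk β.out : WeightQuot R N) = β := Quotient.out_eq β
    rw [← h3, h2]

variable [CharZero K] [Finite (WeightQuot R N)]

theorem V_eq_top_of_stable (hnd : IsNondeg R ζ) {M : Submodule K (V R ζ)} (hM : M ≠ ⊥)
    (hX : ∀ a : weightLattice R, ∀ v ∈ M, XN ζ a • v ∈ M)
    (hY : ∀ a : weightLattice R, ∀ v ∈ M, YN ζ a • v ∈ M) : M = ⊤ := by
  have := Fintype.ofFinite (WeightQuot R N)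
  obtain ⟨v, hv, hfix, hv0⟩ := ((isWeylPair_HHN ζ).map
    (Algebra.lsmul K K (V R ζ))).exists_mem_fixedPart hnd hM hX hY
  obtain ⟨r, rfl⟩ := eq_smul_mk_one_of_fixed hnd hfix
  have hr : r ≠ 0 := by
    rintro rfl
    exact hv0 (zero_smul _ _)
  have h1 : (Submodule.Quotient.mk (AddMonoidAlgebra.single 0 1) : V R ζ) ∈ M :=
    (M.smul_mem_iff hr).1 hv
  refine eq_top_iff.2 fun v _ => ?_
  induction v using V.induction with
  | zero => exact M.zero_mem
  | add v v' hv hv' => exact M.add_mem (hv trivial) (hv' trivial)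
  | single c r =>
    have h2 := M.smul_mem r (hX c _ h1)
    rw [XN_smul_mk, X_smul_single, add_zero, ← Submodule.Quotient.mk_smul,
      AddMonoidAlgebra.smul_single, smul_eq_mul, mul_one] at h2
    exact h2

theorem isSimpleModule_of_restrictScalars {A S : Type*} [Ring A] [Algebra K A] [AddCommGroup S]
    [Module K S] [Module A S] [IsScalarTower K A S] [Nontrivial S]
    (h : ∀ M : Submodule A S, M.restrictScalars K ≠ ⊥ → M.restrictScalars K = ⊤) :
    IsSimpleModule A S := by
  have : IsSimpleOrder (Submodule A S) := ⟨fun M => ?_⟩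
  · exact ⟨⟩
  by_cases hM : M = ⊥
  · exact Or.inl hM
  · exact Or.inr ((Submodule.restrictScalars_eq_top_iff K A S).1
      (h M fun h => hM ((Submodule.restrictScalars_eq_bot_iff K A S).1 h)))

theorem isSimpleModule_HHN (hnd : IsNondeg R ζ) : IsSimpleModule (HHN R ζ) (V R ζ) :=
  isSimpleModule_of_restrictScalars (K := K) fun M hM => V_eq_top_of_stable hnd hM
    (fun _ _ hv => M.smul_mem _ hv) (fun _ _ hv => M.smul_mem _ hv)

theorem isSimpleModule_weylAlg (hnd : IsNondeg R ζ) : IsSimpleModule (weylAlg R ζ) (V R ζ) :=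
  isSimpleModule_of_restrictScalars (K := K) fun M hM => V_eq_top_of_stable hnd hM
    (fun a _ hv => M.smul_mem (XW ζ a) hv) (fun a _ hv => M.smul_mem (YW ζ a) hv)

theorem isSimpleModule_HH (hnd : IsNondeg R ζ) : IsSimpleModule (HH R (ζ : Kˣ)) (V R ζ) :=
  isSimpleModule_of_restrictScalars (K := K) fun M hM => V_eq_top_of_stable hnd hM
    (fun a _ hv => M.smul_mem (X (ζ : Kˣ) a) hv) (fun a _ hv => M.smul_mem (Y (ζ : Kˣ) a) hv)

/-- Applying X_a^N - 1 to the class of 1 shows that S contains `kerV`, which is already maximal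
because V is simple over `HH`. -/
theorem eq_kerV_of_isSimpleModule (hnd : IsNondeg R ζ) {S : Submodule (HH R (ζ : Kˣ)) (Poly K R)}
    (hS : IsSimpleModule (HH R (ζ : Kˣ)) (Poly K R ⧸ S))
    (ht : Module.IsTorsionBySet (HH R (ζ : Kˣ)) (Poly K R ⧸ S) (relIdeal R (ζ : Kˣ) N)) :
    S = kerV R ζ := by
  have hle : kerV R ζ ≤ S := by
    refine Submodule.span_le.2 ?_
    rintro _ ⟨a, rfl⟩
    have h1 : X (ζ : Kˣ) a ^ N - 1 ∈ relIdeal R (ζ : Kˣ) N :=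
      TwoSidedIdeal.subset_span ⟨a, Or.inl rfl⟩
    have h2 := @ht (Submodule.Quotient.mk (AddMonoidAlgebra.single 0 1)) ⟨_, h1⟩
    change (X (ζ : Kˣ) a ^ N - 1) • (Submodule.Quotient.mk _ : Poly K R ⧸ S) = 0 at h2
    rw [← Submodule.Quotient.mk_smul, Submodule.Quotient.mk_eq_zero, sub_smul, one_smul,
      X_pow_smul_single, add_zero] at h2
    rw [AddMonoidAlgebra.single_pow, one_pow, AddMonoidAlgebra.one_def]
    exact h2
  have hco : IsCoatom (kerV R ζ) := isSimpleModule_iff_isCoatom.1 (isSimpleModule_HH hnd)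
  refine (hco.le_iff.1 hle).resolve_left ?_
  rw [isSimpleModule_iff_isCoatom] at hS
  exact hS.1

/-! ### Uniqueness over the Weyl algebra -/

/-- For a nonzero vector u fixed by all Y, the map f(X) ↦ f(X)u from V to S is linear over the Weyl
algebra and nonzero, hence bijective by Schur's lemma. -/
theorem nonempty_equiv_of_isSimpleModule_weylAlg (hnd : IsNondeg R ζ) (S : Type*) [AddCommGroup S]
    [Module (weylAlg R ζ) S] (hS : IsSimpleModule (weylAlg R ζ) S) :
    Nonempty (S ≃ₗ[weylAlg R ζ] V R ζ) := by
  have := Fintype.ofFinite (WeightQuot R N)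
  let _ : Module K S := Module.compHom S (algebraMap K (weylAlg R ζ))
  have : IsScalarTower K (weylAlg R ζ) S := IsScalarTower.of_algebraMap_smul fun _ _ => rfl
  have hp := (isWeylPair_weylAlg (R := R) ζ).map (Algebra.lsmul K K S)
  have hnt : Nontrivial S := IsSimpleModule.nontrivial (weylAlg R ζ) S
  obtain ⟨u, -, hu, hu0⟩ := hp.exists_mem_fixedPart hnd (M := ⊤) top_ne_bot
    (fun _ _ _ => trivial) (fun _ _ _ => trivial)
  have hlin : ∀ z ∈ weylAlg R ζ, ∀ hz : z ∈ weylAlg R ζ, ∀ v : V R ζ,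
      evalV ζ (fun a => Algebra.lsmul K K S (XW (R := R) ζ a)) (z • v) u =
        (⟨z, hz⟩ : weylAlg R ζ) • evalV ζ (fun a => Algebra.lsmul K K S (XW (R := R) ζ a)) v u := by
    intro z hz
    induction hz using Algebra.adjoin_induction with
    | mem z hz =>
      rintro hz' v
      rcases hz with ⟨a, rfl⟩ | ⟨a, rfl⟩
      · rw [hp.evalV_XN]
        rfl
      · have h1 := LinearMap.congr_fun (hp.evalV_YN a v) u
        rw [Module.End.mul_apply, Module.End.mul_apply, hu a] at h1
        exact h1
    | algebraMap r =>
      intro hz' v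
      rw [algebraMap_smul, map_smul]
      rfl
    | add x y hx hy hx' hy' =>
      intro hz' v
      rw [add_smul, map_add, LinearMap.add_apply, hx' hx, hy' hy, ← add_smul]
      rfl
    | mul x y hx hy hx' hy' =>
      intro hz' v
      rw [mul_smul, hx' hx, hy' hy, ← mul_smul]
      rfl
  let φ : V R ζ →ₗ[weylAlg R ζ] S :=
    { toFun := fun v => evalV ζ (fun a => Algebra.lsmul K K S (XW (R := R) ζ a)) v u
      map_add' := fun v v' => by rw [map_add, LinearMap.add_apply]
      map_smul' := fun z v => hlin z.1 z.2 z.2 v }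
  have hφ : φ ≠ 0 := by
    intro h
    have h1 := LinearMap.congr_fun h (Submodule.Quotient.mk (AddMonoidAlgebra.single 0 1))
    change evalV ζ (fun a => Algebra.lsmul K K S (XW (R := R) ζ a)) _ u = 0 at h1
    rw [hp.evalV_single, hp.x_zero, one_smul] at h1
    exact hu0 h1
  have := isSimpleModule_weylAlg hnd
  exact ⟨(LinearEquiv.ofBijective φ (φ.bijective_of_ne_zero hφ)).symm⟩

end

end

section

variable {κ E E' : Type*} [Fintype κ] [AddCommGroup E] [Module ℝ E] [AddCommGroup E'] [Module ℝ E']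
variable {R : RootPairing κ ℝ E E'}

variable {K : Type*} [Field K] [R.IsCrystallographic] {N : ℕ}

/-! ### The simple modules of `HHN` -/

section classification

variable {ζ : rootsOfUnity N K} {S : Type*} [AddCommGroup S] [Module K S] [Module (HHN R ζ) S]
  [IsScalarTower K (HHN R ζ) S]

/-- The vectors of an `HHN`-module that are fixed by all `Y_b`. -/
abbrev fixedY (ζ : rootsOfUnity N K) (S : Type*) [AddCommGroup S] [Module K S]
    [Module (HHN R ζ) S] [IsScalarTower K (HHN R ζ) S] : Submodule K S :=
  fixedPart fun a : weightLattice R => Algebra.lsmul K K S (YN ζ a)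

theorem TN_smul_mem_fixedY (w : R.weylGroup) {u : S} (hu : u ∈ fixedY (R := R) ζ S) :
    TN ζ w • u ∈ fixedY (R := R) ζ S := by
  intro a
  change YN ζ a • TN ζ w • u = TN ζ w • u
  have h1 := TN_mul_YN ζ w (w⁻¹ • a)
  rw [smul_inv_smul] at h1
  have h2 : YN ζ (w⁻¹ • a) • u = u := hu _
  rw [← mul_smul, ← h1, mul_smul, h2]

theorem smul_mem_span_of_generators {s : Set S} (f : Module.End K S)
    (h : ∀ x ∈ s, f x ∈ Submodule.span K s) : ∀ x ∈ Submodule.span K s, f x ∈ Submodule.span K s :=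
  fun x hx => (Submodule.map_span_le f s _).2 h ⟨x, hx, rfl⟩

variable [CharZero K] [Finite (WeightQuot R N)]

/-- The sum of the X_c M is an `HHN`-submodule, hence all of S. Its part of weight 0 is only M,
because X_c M has weight c. -/
theorem eq_fixedY_of_stable (hnd : IsNondeg R ζ) (hS : IsSimpleModule (HHN R ζ) S)
    {M : Submodule K S} (hM : M ≤ fixedY (R := R) ζ S) (hM0 : M ≠ ⊥)
    (hT : ∀ w : R.weylGroup, ∀ s ∈ M, TN ζ w • s ∈ M) : M = fixedY (R := R) ζ S := by
  classical
  have := Fintype.ofFinite (WeightQuot R N)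
  have hp := (isWeylPair_HHN (R := R) ζ).map (Algebra.lsmul K K S)
  set G : Set S := {s | ∃ c : weightLattice R, ∃ m ∈ M, s = XN ζ c • m} with hG
  have hX : ∀ a : weightLattice R, ∀ s ∈ Submodule.span K G, XN ζ a • s ∈ Submodule.span K G := by
    intro a
    refine smul_mem_span_of_generators (Algebra.lsmul K K S (XN ζ a)) ?_
    rintro _ ⟨c, m, hm, rfl⟩
    refine Submodule.subset_span ⟨a + c, m, hm, ?_⟩
    rw [(isWeylPair_HHN ζ).x_add, mul_smul]
    rfl
  have hY : ∀ a : weightLattice R, ∀ s ∈ Submodule.span K G, YN ζ a • s ∈ Submodule.span K G := by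
    intro a
    refine smul_mem_span_of_generators (Algebra.lsmul K K S (YN ζ a)) ?_
    rintro _ ⟨c, m, hm, rfl⟩
    have h1 := hp.y_apply_x_of_mem_fixedPart (hM hm) c a
    simp only [Algebra.lsmul_coe] at h1 ⊢
    rw [h1]
    exact Submodule.smul_mem _ _ (Submodule.subset_span ⟨c, m, hm, rfl⟩)
  have hT' : ∀ w : R.weylGroup, ∀ s ∈ Submodule.span K G, TN ζ w • s ∈ Submodule.span K G := by
    intro w
    refine smul_mem_span_of_generators (Algebra.lsmul K K S (TN ζ w)) ?_
    rintro _ ⟨c, m, hm, rfl⟩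
    refine Submodule.subset_span ⟨w • c, TN ζ w • m, hT w m hm, ?_⟩
    rw [← mul_smul, ← TN_mul_XN, mul_smul]
    rfl
  let G' : Submodule (HHN R ζ) S :=
    { Submodule.span K G with
      smul_mem' := fun z s hs => HHN_smul_mem_of_generators (Submodule.span K G) hX hY hT' z s hs }
  have hsub : ∀ m ∈ M, m ∈ Submodule.span K G := fun m hm =>
    Submodule.subset_span ⟨0, m, hm, by rw [(isWeylPair_HHN ζ).x_zero, one_smul]⟩
  have htop : G' = ⊤ := by
    refine (eq_bot_or_eq_top G').resolve_left fun h => hM0 ?_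
    refine (Submodule.eq_bot_iff M).2 fun m hm => ?_
    have : m ∈ G' := hsub m hm
    rwa [h, Submodule.mem_bot] at this
  refine le_antisymm hM fun u hu => ?_
  have hmem : u ∈ Submodule.span K G := by
    have : u ∈ G' := htop ▸ trivial
    exact this
  have hproj : ∀ s ∈ Submodule.span K G,
      eigenproj ζ (fun a : weightLattice R => Algebra.lsmul K K S (YN ζ a)) 0 s ∈ M := by
    intro s hs
    induction hs using Submodule.span_induction with
    | mem s hs =>
      obtain ⟨c, m, hm, rfl⟩ := hs
      have h1 := eigenproj_apply hnd _ (hp.y_apply_x_of_mem_fixedPart (hM hm) c) 0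
      simp only [Algebra.lsmul_coe] at h1
      rw [h1]
      split_ifs with h
      · rw [sub_zero] at h
        obtain ⟨p, rfl⟩ := h
        change XN ζ (N • p) • m ∈ M
        rw [(isWeylPair_HHN ζ).x_nsmul, one_smul]
        exact hm
      · exact M.zero_mem
    | zero => rw [map_zero]; exact M.zero_mem
    | add s s' _ _ hs hs' => rw [map_add]; exact M.add_mem hs hs'
    | smul r s _ hs => rw [map_smul]; exact M.smul_mem r hs
  have h1 := eigenproj_apply hnd (fun a : weightLattice R => Algebra.lsmul K K S (YN ζ a))
    (c := 0) (s := u) (fun a => by rw [hu a, qPow_zero_left, Units.val_one, one_smul]) 0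
  rw [sub_zero, if_pos (zero_mem _)] at h1
  have h2 := hproj u hmem
  rwa [h1] at h2

theorem exists_ne_zero_mem_fixedY (hnd : IsNondeg R ζ) (hS : IsSimpleModule (HHN R ζ) S) :
    ∃ u ∈ fixedY (R := R) ζ S, u ≠ 0 := by
  have := Fintype.ofFinite (WeightQuot R N)
  have hnt : Nontrivial S := IsSimpleModule.nontrivial (HHN R ζ) S
  obtain ⟨u, -, hu, hu0⟩ := ((isWeylPair_HHN (R := R) ζ).map
    (Algebra.lsmul K K S)).exists_mem_fixedPart hnd (M := ⊤) top_ne_bot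
    (fun _ _ _ => trivial) (fun _ _ _ => trivial)
  exact ⟨u, hu, hu0⟩

theorem finite_fixedY [R.IsRootSystem] (hnd : IsNondeg R ζ) (hS : IsSimpleModule (HHN R ζ) S) :
    Module.Finite K (fixedY (R := R) ζ S) := by
  obtain ⟨u, hu, hu0⟩ := exists_ne_zero_mem_fixedY hnd hS
  -- W is finite, and the W-translates of one nonzero fixed vector span a nonzero stable subspace of
  -- the fixed vectors.
  set O : Set S := Set.range fun w : R.weylGroup => TN ζ w • u with hO
  have hOfin : O.Finite := Set.finite_range _
  have h1 : Submodule.span K O = fixedY (R := R) ζ S := by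
    refine eq_fixedY_of_stable hnd hS (Submodule.span_le.2 ?_) ?_ fun w => ?_
    · rintro _ ⟨w, rfl⟩
      exact TN_smul_mem_fixedY w hu
    · intro h
      apply hu0
      have : u ∈ Submodule.span K O := Submodule.subset_span ⟨1, by
        change TN ζ (1 : R.weylGroup) • u = u
        rw [TN_one, one_smul]⟩
      rwa [h, Submodule.mem_bot] at this
    · refine smul_mem_span_of_generators (Algebra.lsmul K K S (TN ζ w)) ?_
      rintro _ ⟨v, rfl⟩
      refine Submodule.subset_span ⟨w * v, ?_⟩
      change TN ζ (w * v) • u = TN ζ w • TN ζ v • u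
      rw [TN_mul, mul_smul]
  rw [← h1]
  exact Module.Finite.span_of_finite K hOfin

/-- The action of `W` on the vectors fixed by all `Y_b`, in coordinates. -/
def fixedRep (ζ : rootsOfUnity N K) {S : Type*} [AddCommGroup S] [Module K S]
    [Module (HHN R ζ) S] [IsScalarTower K (HHN R ζ) S] {d : ℕ}
    (e : fixedY (R := R) ζ S ≃ₗ[K] (Fin d → K)) : Representation K R.weylGroup (Fin d → K) where
  toFun w := e.conj ((Algebra.lsmul K K S (TN ζ w)).restrict fun _ hu => TN_smul_mem_fixedY w hu)
  map_one' := by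
    refine LinearMap.ext fun u => ?_
    rw [LinearEquiv.conj_apply_apply, Module.End.one_apply, ← LinearEquiv.eq_symm_apply]
    refine Subtype.ext ?_
    change TN ζ (1 : R.weylGroup) • ((e.symm _ : fixedY (R := R) ζ S) : S) = _
    rw [TN_one, one_smul]
  map_mul' w v := by
    refine LinearMap.ext fun u => ?_
    rw [Module.End.mul_apply, LinearEquiv.conj_apply_apply, LinearEquiv.conj_apply_apply,
      LinearEquiv.conj_apply_apply, LinearEquiv.symm_apply_apply]
    congr 1
    refine Subtype.ext ?_
    change TN ζ (w * v) • ((e.symm _ : fixedY (R := R) ζ S) : S) = TN ζ w • TN ζ v • _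
    rw [TN_mul, mul_smul]
    rfl

theorem coe_symm_fixedRep {d : ℕ} (e : fixedY (R := R) ζ S ≃ₗ[K] (Fin d → K)) (w : R.weylGroup)
    (u : Fin d → K) : ((e.symm (fixedRep ζ e w u) : fixedY (R := R) ζ S) : S) =
      TN ζ w • ((e.symm u : fixedY (R := R) ζ S) : S) := by
  change ((e.symm (e.conj _ u) : fixedY (R := R) ζ S) : S) = _
  rw [LinearEquiv.conj_apply_apply, LinearEquiv.symm_apply_apply]
  rfl

theorem isIrreducible_fixedRep (hnd : IsNondeg R ζ) (hS : IsSimpleModule (HHN R ζ) S) {d : ℕ}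
    (e : fixedY (R := R) ζ S ≃ₗ[K] (Fin d → K)) : (fixedRep ζ e).IsIrreducible := by
  obtain ⟨u, hu, hu0⟩ := exists_ne_zero_mem_fixedY hnd hS
  have hbt : (⊥ : Subrepresentation (fixedRep ζ e)) ≠ ⊤ := by
    intro h
    have h1 : e ⟨u, hu⟩ ∈ (⊥ : Subrepresentation (fixedRep ζ e)).toSubmodule := by
      rw [h]
      trivial
    have h2 : e ⟨u, hu⟩ = 0 := h1
    rw [LinearEquiv.map_eq_zero_iff] at h2
    exact hu0 (congrArg Subtype.val h2)
  have : Nontrivial (Subrepresentation (fixedRep ζ e)) := ⟨_, _, hbt⟩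
  refine ⟨fun P => ?_⟩
  by_cases hP : P.toSubmodule = ⊥
  · exact Or.inl (Subrepresentation.toSubmodule_injective hP)
  right
  refine Subrepresentation.toSubmodule_injective ?_
  have h1 := eq_fixedY_of_stable hnd hS
    (M := P.toSubmodule.map ((fixedY (R := R) ζ S).subtype ∘ₗ e.symm.toLinearMap))
    (by
      rintro _ ⟨s, -, rfl⟩
      exact (e.symm s).2)
    (by
      obtain ⟨s, hs, hs0⟩ := (Submodule.ne_bot_iff _).1 hP
      refine (Submodule.ne_bot_iff _).2 ⟨_, ⟨s, hs, rfl⟩, fun h => hs0 ?_⟩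
      have h2 : e.symm s = 0 := Subtype.ext h
      rwa [LinearEquiv.map_eq_zero_iff] at h2)
    (by
      rintro w _ ⟨s, hs, rfl⟩
      exact ⟨fixedRep ζ e w s, P.apply_mem_toSubmodule w hs, coe_symm_fixedRep e w s⟩)
  refine eq_top_iff.2 fun s _ => ?_
  obtain ⟨s', hs', h3⟩ := h1.ge (e.symm s).2
  have h4 : s' = s := e.symm.injective (Subtype.ext h3)
  exact h4 ▸ hs'

/-- The factor U is the space of vectors fixed by all Y, written in coordinates, and the isomorphism
is f(X) ⊗ u ↦ f(X)u. It intertwines the diagonal action of W because T_w f(X) = (wf)(X) T_w. -/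
theorem exists_tensor_equiv [R.IsRootSystem] (hnd : IsNondeg R ζ)
    (hS : IsSimpleModule (HHN R ζ) S) :
    ∃ (d : ℕ) (U : Representation K R.weylGroup (Fin d → K)), U.IsIrreducible ∧
      ∃ e : (V R ζ ⊗[K] (Fin d → K)) ≃ₗ[K] S,
        ∀ (v : V R ζ) (u : Fin d → K),
          (∀ a : weightLattice R, e ((XN ζ a • v) ⊗ₜ[K] u) = XN ζ a • e (v ⊗ₜ[K] u)) ∧
          (∀ a : weightLattice R, e ((YN ζ a • v) ⊗ₜ[K] u) = YN ζ a • e (v ⊗ₜ[K] u)) ∧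
          (∀ w : R.weylGroup, e ((TN ζ w • v) ⊗ₜ[K] (U w u)) = TN ζ w • e (v ⊗ₜ[K] u)) := by
  have := Fintype.ofFinite (WeightQuot R N)
  have hfin := finite_fixedY hnd hS
  have hp := (isWeylPair_HHN (R := R) ζ).map (Algebra.lsmul K K S)
  let e₀ : fixedY (R := R) ζ S ≃ₗ[K] (Fin _ → K) :=
    (Module.finBasis K (fixedY (R := R) ζ S)).equivFun
  refine ⟨_, fixedRep ζ e₀, isIrreducible_fixedRep hnd hS e₀,
    (e₀.symm.lTensor (V R ζ)).trans (LinearEquiv.ofBijective _ (hp.bijective_lift hnd)), ?_⟩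
  intro v u
  have hval : ∀ (v : V R ζ) (u : Fin _ → K),
      ((e₀.symm.lTensor (V R ζ)).trans (LinearEquiv.ofBijective _ (hp.bijective_lift hnd)))
        (v ⊗ₜ[K] u) = evalV ζ (fun a : weightLattice R => Algebra.lsmul K K S (XN ζ a)) v
          ((e₀.symm u : fixedY (R := R) ζ S) : S) := fun v u => rfl
  simp only [hval]
  refine ⟨fun a => ?_, fun a => ?_, fun w => ?_⟩
  · rw [hp.evalV_XN]
    rfl
  · have h1 := LinearMap.congr_fun (hp.evalV_YN a v) ((e₀.symm u : fixedY (R := R) ζ S) : S)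
    rw [Module.End.mul_apply, Module.End.mul_apply, (e₀.symm u).2 a] at h1
    exact h1
  · have h1 := LinearMap.congr_fun (hp.evalV_TN (w := w) (t := Algebra.lsmul K K S (TN ζ w))
      (fun a => by rw [← map_mul, ← map_mul, TN_mul_XN]) v)
      ((e₀.symm u : fixedY (R := R) ζ S) : S)
    rw [coe_symm_fixedRep]
    exact h1

end classification

/-! ### The kernel of `K[X] → V` is generated by `I_o(Δ)` -/

section kernel

variable {ζ : rootsOfUnity N K} [CharZero K] [R.IsRootSystem] [R.IsReduced] [R.IsIrreducible]
  {b : R.Base} {θ : κ}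

open Classical in
theorem eigenproj_smul_single [Fintype (WeightQuot R N)] (hnd : IsNondeg R ζ)
    (c d : weightLattice R) (r : K) :
    eigenproj ζ (Y (R := R) (ζ : Kˣ)) d • (AddMonoidAlgebra.single c r : Poly K R) =
      if c - d ∈ multiples R N then AddMonoidAlgebra.single c r else 0 := by
  rw [← eigenproj_apply hnd (fun a => Algebra.lsmul K K (Poly K R) (Y (ζ : Kˣ) a)) (fun a => by
    rw [Algebra.lsmul_coe]
    beta_reduce
    rw [Y_smul_single, AddMonoidAlgebra.smul_single, smul_eq_mul]) d,
    ← map_eigenproj]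
  rfl

/-- The average over `W` of the conjugates of `z`. -/
def conjSum [Fintype R.weylGroup] (ζ : Kˣ) (z : HH R ζ) : HH R ζ :=
  ∑ w : R.weylGroup, T ζ w * z * T ζ w⁻¹

theorem conjSum_mem_invSubalg [Fintype R.weylGroup] (ζ : Kˣ) (z : HH R ζ) :
    conjSum ζ z ∈ invSubalg R ζ := by
  rw [invSubalg, Subalgebra.mem_centralizer_iff]
  rintro _ ⟨v, rfl⟩
  rw [conjSum, Finset.mul_sum, Finset.sum_mul, ← Equiv.sum_comp (Equiv.mulLeft v)
    (fun w => T ζ w * z * T ζ w⁻¹ * T ζ v)]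
  refine Finset.sum_congr rfl fun w _ => ?_
  rw [Equiv.coe_mulLeft, mul_assoc _ _ (T ζ v), ← T_mul, T_mul ζ v w]
  simp only [mul_inv_rev, mul_assoc, inv_mul_cancel, mul_one]

theorem IsHighest.smul_rho_sub_mem_iff (hθ : IsHighest b θ) (hN : (N : ℤ) = 2 + wp θ (rho b))
    (w : R.weylGroup) : w • rho b - rho b ∈ multiples R N ↔ w = 1 := by
  constructor
  · rintro h
    rw [← QuotientAddGroup.eq_iff_sub_mem] at h
    exact hθ.eq_one_of_smul_mk_rho hN h
  · rintro rfl
    rw [one_smul, sub_self]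
    exact zero_mem _

theorem IsHighest.eigenproj_smul_delta [Fintype (WeightQuot R N)] (hθ : IsHighest b θ)
    (hN : (N : ℤ) = 2 + wp θ (rho b)) (hnd : IsNondeg R ζ) :
    eigenproj ζ (Y (R := R) (ζ : Kˣ)) (rho b) • delta K b = AddMonoidAlgebra.single (rho b) 1 := by
  classical
  have := Fintype.ofFinite R.weylGroup
  rw [delta_eq_sum, Finset.smul_sum, Finset.sum_eq_single 1]
  · rw [eigenproj_smul_single hnd, if_pos ((hθ.smul_rho_sub_mem_iff hN 1).2 rfl), one_smul, sgn_one]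
  · intro w _ hw
    rw [eigenproj_smul_single hnd, if_neg fun h => hw ((hθ.smul_rho_sub_mem_iff hN w).1 h)]
  · intro h
    exact absurd (Finset.mem_univ _) h

theorem IsHighest.kerVtilde_eq [Finite (WeightQuot R N)] (hθ : IsHighest b θ)
    (hN : (N : ℤ) = 2 + wp θ (rho b)) (hnd : IsNondeg R ζ) : kerVtilde ζ b = kerV R ζ := by
  classical
  have := Fintype.ofFinite (WeightQuot R N)
  have := Fintype.ofFinite R.weylGroup
  refine le_antisymm (Submodule.span_le.2 ?_) (Submodule.span_le.2 ?_)
  · rintro _ ⟨H, hH, rfl⟩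
    exact (Submodule.Quotient.mk_eq_zero (kerV R ζ)).1 hH.2
  rintro _ ⟨a, rfl⟩
  set P := eigenproj ζ (Y (R := R) (ζ : Kˣ)) (rho b)
  -- As P sends Δ to X_ρ, the operator z sends Δ to g, which lies in the kernel. But z need not
  -- commute with W, so it is replaced by the sum of its conjugates.
  set z : HH R (ζ : Kˣ) := (X (ζ : Kˣ) (N • a) - 1) * P with hz
  set g : Poly K R := AddMonoidAlgebra.single (rho b + N • a) 1 - AddMonoidAlgebra.single (rho b) 1
    with hg
  have hzd : z • delta K b = g := by
    rw [hz, mul_smul, hθ.eigenproj_smul_delta hN hnd, sub_smul, one_smul, X_smul_single, add_comm]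
  have hgV : g ∈ kerV R ζ := single_sub_single_mem_kerV ζ _ _ _
  have hH : conjSum (ζ : Kˣ) z • delta K b = ∑ w : R.weylGroup, sgn K w⁻¹ • T (ζ : Kˣ) w • g := by
    rw [conjSum, Finset.sum_smul]
    refine Finset.sum_congr rfl fun w _ => ?_
    rw [mul_smul, T_smul_eq _ w⁻¹, opT_delta, smul_comm, mul_smul, hzd]
  have hHmem : conjSum (ζ : Kˣ) z ∈ idealIo ζ b := by
    refine ⟨conjSum_mem_invSubalg _ _, ?_⟩
    rw [← Submodule.Quotient.mk_smul, Submodule.Quotient.mk_eq_zero, hH]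
    refine Submodule.sum_mem _ fun w _ => ?_
    rw [← algebraMap_smul (HH R (ζ : Kˣ))]
    exact Submodule.smul_mem _ _ (Submodule.smul_mem _ _ hgV)
  -- Both monomials of T_w g lie in the class of wρ modulo N, which is the class of ρ only for w =
  -- 1.
  have hPg : ∀ w : R.weylGroup, P • T (ζ : Kˣ) w • g = if w = 1 then g else 0 := by
    intro w
    have h1 : ∀ p : weightLattice R,
        w • (rho b + N • p) - rho b ∈ multiples R N ↔ w = 1 := by
      intro p
      rw [← hθ.smul_rho_sub_mem_iff hN w, smul_add, add_sub_right_comm]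
      have h2 : w • (N • p) ∈ multiples R N := ⟨w • p, (smul_comm w N p).symm⟩
      exact AddSubgroup.add_mem_cancel_right _ h2
    rw [hg, smul_sub, T_smul_single, T_smul_single, smul_sub, eigenproj_smul_single hnd,
      eigenproj_smul_single hnd]
    simp only [h1, hθ.smul_rho_sub_mem_iff hN]
    split_ifs with hw
    · rw [hw, one_smul, one_smul]
    · rw [sub_zero]
  have hgt : g ∈ kerVtilde ζ b := by
    have h1 : conjSum (ζ : Kˣ) z • delta K b ∈ kerVtilde ζ b :=
      Submodule.subset_span ⟨_, hHmem, rfl⟩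
    have h2 := (kerVtilde ζ b).smul_mem P h1
    rw [hH, Finset.smul_sum, Finset.sum_eq_single 1] at h2
    · rwa [smul_comm, hPg, if_pos rfl, inv_one, sgn_one, one_smul] at h2
    · intro w _ hw
      rw [smul_comm, hPg, if_neg hw, smul_zero]
    · intro h
      exact absurd (Finset.mem_univ _) h
  -- Multiplication by X_{-ρ} turns g into the generator X_a^N - 1.
  have h3 := (kerVtilde ζ b).smul_mem (X (ζ : Kˣ) (-rho b)) hgt
  rw [hg, smul_sub, X_smul_single, X_smul_single, neg_add_cancel, neg_add_cancel_left] at h3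
  rw [AddMonoidAlgebra.single_pow, one_pow, AddMonoidAlgebra.one_def]
  exact h3

end kernel

end

end Daha

end

/-! ### Assembly of the three statements -/

theorem mainTheorem2 {κ E E' : Type*} [Fintype κ]
    [AddCommGroup E] [Module ℝ E] [AddCommGroup E'] [Module ℝ E']
    (R : RootPairing κ ℝ E E') [R.IsRootSystem] [R.IsCrystallographic] [R.IsReduced]
    [R.IsIrreducible] (b : R.Base)
    (N : ℕ) (hN : N = 1 + coxeterNumber b)
    {K : Type*} [Field K] [CharZero K] [IsCyclotomicExtension {N} ℚ K]
    (q : K) (hq : IsPrimitiveRoot q N)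
    (ζ : rootsOfUnity N K) (hζ : ((ζ : Kˣ) : K) ^ formDenom R = q) :
    -- (i) `V^•` is irreducible, of dimension `N ^ n`
    (IsSimpleModule (HHN R ζ) (V R ζ) ∧
      Module.finrank K (V R ζ) = N ^ Module.finrank ℝ E ∧
      -- it is the unique irreducible module of the Weyl algebra modulo `X^N = 1 = Y^N`
      IsSimpleModule (weylAlg R ζ) (V R ζ) ∧
      (∀ (S : Type*) [AddCommGroup S] [Module (weylAlg R ζ) S],
        IsSimpleModule (weylAlg R ζ) S → Nonempty (S ≃ₗ[weylAlg R ζ] V R ζ)) ∧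
      -- it is the unique irreducible `HH^•_N`-module that is a quotient of `K[X]`
      (∀ S : Submodule (HH R (ζ : Kˣ)) (Poly K R),
        IsSimpleModule (HH R (ζ : Kˣ)) (Poly K R ⧸ S) →
        Module.IsTorsionBySet (HH R (ζ : Kˣ)) (Poly K R ⧸ S) (relIdeal R (ζ : Kˣ) N) →
        S = kerV R ζ) ∧
      -- it is the unique irreducible `HH^•_N`-module up to tensoring with a `W`-module
      (∀ (S : Type*) [AddCommGroup S] [Module K S] [Module (HHN R ζ) S]
        [IsScalarTower K (HHN R ζ) S], IsSimpleModule (HHN R ζ) S →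
        ∃ (d : ℕ) (U : Representation K R.weylGroup (Fin d → K)), U.IsIrreducible ∧
          ∃ e : (V R ζ ⊗[K] (Fin d → K)) ≃ₗ[K] S,
            ∀ (v : V R ζ) (u : Fin d → K),
              (∀ a : weightLattice R, e ((XN ζ a • v) ⊗ₜ[K] u) = XN ζ a • e (v ⊗ₜ[K] u)) ∧
              (∀ a : weightLattice R, e ((YN ζ a • v) ⊗ₜ[K] u) = YN ζ a • e (v ⊗ₜ[K] u)) ∧
              (∀ w : R.weylGroup, e ((TN ζ w • v) ⊗ₜ[K] (U w u)) = TN ζ w • e (v ⊗ₜ[K] u)))) ∧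
    -- (ii) `V^•` is `K[P / N P]` as a `W`-module, the sign character has multiplicity one,
    -- and `W(ρ)` is the unique simple `W`-orbit in `P / N P`
    ((∃ e : V R ζ ≃ₗ[K] AddMonoidAlgebra K (WeightQuot R N), ∀ (w : R.weylGroup) (v : V R ζ),
        e (TN ζ w • v) = AddMonoidAlgebra.mapDomain (fun x => w • x) (e v)) ∧
      Module.finrank K (signPart (R := R) ζ) = 1 ∧
      signPart ζ = Submodule.span K {(Submodule.Quotient.mk (delta K b) : V R ζ)} ∧
      MulAction.stabilizer R.weylGroup (QuotientAddGroup.mk (rho b) : WeightQuot R N) = ⊥ ∧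
      (∀ x : WeightQuot R N, MulAction.stabilizer R.weylGroup x = ⊥ →
        x ∈ MulAction.orbit R.weylGroup (QuotientAddGroup.mk (rho b) : WeightQuot R N))) ∧
    -- (iii) the quotient of `K[X]` by `HH^• I_o^•(Δ^•)` is an `HH^•_N`-module and equals `V^•`
    (Module.IsTorsionBySet (HH R (ζ : Kˣ)) (Poly K R ⧸ kerVtilde ζ b)
        (relIdeal R (ζ : Kˣ) N) ∧
      kerVtilde ζ b = kerV R ζ) := by
  obtain ⟨θ, hθ⟩ := exists_isHighest b
  have hNθ : (N : ℤ) = 2 + wp θ (rho b) := by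
    rw [hN]
    push_cast
    rw [hθ.coxeterNumber_eq]
    ring
  have hN0 : NeZero N := ⟨by
    have := hθ.rho_pos
    omega⟩
  have hfin := finite_weightQuot b N
  have hnd := isNondeg_of_isPrimitiveRoot hθ hNθ hq hζ
  have hker := hθ.kerVtilde_eq hNθ hnd
  refine ⟨⟨isSimpleModule_HHN hnd, finrank_V b ζ, isSimpleModule_weylAlg hnd,
    fun S _ _ hS => nonempty_equiv_of_isSimpleModule_weylAlg hnd S hS,
    fun S hS ht => eq_kerV_of_isSimpleModule hnd hS ht,
    fun S _ _ _ _ hS => exists_tensor_equiv hnd hS⟩,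
    ⟨⟨quotEquiv ζ, quotEquiv_TN ζ⟩, hθ.finrank_signPart hNθ ζ, hθ.signPart_eq hNθ ζ,
      hθ.stabilizer_rho hNθ, fun x hx => hθ.mem_orbit_rho hNθ hx⟩, ?_, hker⟩
  rw [hker]
  exact V_torsion ζ
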